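/- Let $X$ be a complex manifold of dimension $d$ (Hausdorff, $\sigma$-compact), with its canonical orientation, and let $D=D_1\cup\dots\cup D_m$ be a divisor with normal crossings whose components $D_i$ are smooth closed complex hypersurfaces: near every point of $X$ there are holomorphic coordinates in which the $D_i$ through that point are distinct coordinate hyperplanes. For each $i$ let $\mu_i$ be a nonnegative Morse–Bott function with zero set $D_i$ in the canonical conformal class, i.e. a smooth function $\mu_i\colon X\to\mathbb R_{\ge0}$ vanishing exactly on $D_i$, with Hessian of rank $2$ along $D_i$, such that for every holomorphic local equation $f$ of $D_i$ (with $D_i=\{f=0\}$ and $df\neq0$ on $D_i$) the quotient $\mu_i/|f|^2$ extends to a positive smooth function. Let $\omega$ be a complex-valued form of top degree $2d$ on $X\smallsetminus D$ such that, for some $N\ge0$, $(\mu_1\cdots\mu_m)^N\omega$ extends to a smooth form with compact support on $X$. (This condition does not depend on the choice of the $\mu_i$.) For $\mathrm{Re}\,s_i$ sufficiently large, the integral $$\zeta(s_1,\dots,s_m;\mu,\omega)=\int_X\mu_1^{s_1/2}\cdots\mu_m^{s_m/2}\,\omega$$ converges absolutely, and it has a unique continuation to a meromorphic function of $s\in\mathbb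 C^m$ with at most simple poles on the hyperplanes $s_i=2k$, $k\in\mathbb Z$. For $M\subset[m]=\{1,\dots,m\}$ put $$I_M(\mu_1,\dots,\mu_m,\omega)=\mathrm{res}_{s_1=0}\cdots\mathrm{res}_{s_m=0}\Bigl(\prod_{i\in M}\frac1{s_i}\Bigr)\zeta(s;\mu,\omega),\qquad I_{\mathrm{finite}}=I_{[m]}.$$ Then: 1. $I_M$ is independent of $\mu_j$ for $j\notin M$: replacing each such $\mu_j$ by another nonnegative Morse–Bott function in the canonical conformal class of $D_j$ does not change $I_M$. 2. For $i\in M$ and every real-valued $\varphi\in C^\infty(X)$, $$I_M(\dots,e^{2\varphi}\mu_i,\dots,\omega)=I_M(\dots,\mu_i,\dots,\omega)+I_{M\smallsetminus\{i\}}(\mu_1,\dots,\mu_m,\varphi\,\omega).$$ 3. Consequently, for all real-valued $\varphi_1,\dots,\varphi_m\in C^\infty(X)$, $$I_{\mathrm{finite}}\bigl((e^{2\varphi_i}\mu_i)_{i=1}^m,\omega\bigr)=\sum_{M\subset[m]}I_M\Bigl(\mu,\prod_{i\notin M}\varphi_i\,\omega\Bigr)=I_{\mathrm{finite}}(\mu,\omega)+\sum_{M\subsetneq[m]}I_M\Bigl(\mu,\prod_{i\notin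 M}\varphi_i\,\omega\Bigr).$$ -/

import Mathlib

open Set Filter Topology MeasureTheory
open scoped Manifold ContDiff

noncomputable section

namespace NormalCrossing

/-- The underlying smooth real manifold of a complex manifold of dimension `d`. -/
instance isManifold_real {d : ℕ} {X : Type*} [TopologicalSpace X] [ChartedSpace (Fin d → ℂ) X]
    [IsManifold 𝓘(ℂ, Fin d → ℂ) ω X] : IsManifold 𝓘(ℝ, Fin d → ℂ) ∞ X := by
  apply isManifold_of_contDiffOn
  intro e e' he he'
  have h := (contDiffGroupoid ω 𝓘(ℂ, Fin d → ℂ)).compatible he he'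
  rw [contDiffGroupoid, mem_groupoid_of_pregroupoid] at h
  have h1 : ContDiffOn ℂ ω (𝓘(ℂ, Fin d → ℂ) ∘ (e.symm ≫ₕ e') ∘ (𝓘(ℂ, Fin d → ℂ)).symm)
      ((𝓘(ℂ, Fin d → ℂ)).symm ⁻¹' (e.symm ≫ₕ e').source ∩ range 𝓘(ℂ, Fin d → ℂ)) := h.1
  exact (h1.restrict_scalars ℝ).of_le le_top

/-! ### Top degree forms and their integrals -/

/-- Complex-valued differential forms of top degree `2 d` (no regularity required) on the real
manifold underlying a complex manifold of dimension `d`. -/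
abbrev TopForm (d : ℕ) (X : Type*) [TopologicalSpace X] [ChartedSpace (Fin d → ℂ) X] : Type _ :=
  ∀ x : X, (TangentSpace 𝓘(ℝ, Fin d → ℂ) x) [⋀^Fin (2 * d)]→L[ℝ] ℂ

/-- The frame `∂/∂x₁, ∂/∂y₁, …, ∂/∂x_d, ∂/∂y_d` of `ℂ ^ d`, which is positive for the canonical
orientation. -/
def stdFrame (d : ℕ) (j : Fin (2 * d)) : Fin d → ℂ :=
  Pi.single ⟨j / 2, by omega⟩ (if (j : ℕ) % 2 = 0 then 1 else Complex.I)

/-- The coordinate function `f` of a top form `α` in the chart `e`, given on `e.target` by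
`(e⁻¹)^* α = f dx₁ ∧ dy₁ ∧ ⋯ ∧ dx_d ∧ dy_d`. -/
def coeff {d : ℕ} {X : Type*} [TopologicalSpace X] [ChartedSpace (Fin d → ℂ) X]
    (e : OpenPartialHomeomorph X (Fin d → ℂ)) (α : TopForm d X) (y : Fin d → ℂ) : ℂ :=
  α (e.symm y) fun j =>
    mfderiv 𝓘(ℝ, Fin d → ℂ) 𝓘(ℝ, Fin d → ℂ) e.symm y (stdFrame d j)

/-- Smooth (`C^∞`) top forms. -/
def SmoothForm {d : ℕ} {X : Type*} [TopologicalSpace X] [ChartedSpace (Fin d → ℂ) X]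
    (α : TopForm d X) : Prop :=
  ∀ e ∈ atlas (Fin d → ℂ) X, ContDiffOn ℝ ∞ (coeff e α) e.target

/-- A smooth partition of unity subordinate to the domains of the charts `chartAt _ x`, `x : X`. -/
def chartPartition (d : ℕ) (X : Type*) [TopologicalSpace X] [ChartedSpace (Fin d → ℂ) X]
    [IsManifold 𝓘(ℂ, Fin d → ℂ) ω X] [T2Space X] [SigmaCompactSpace X] :
    SmoothPartitionOfUnity X 𝓘(ℝ, Fin d → ℂ) X univ :=
  (SmoothPartitionOfUnity.exists_isSubordinate_chartAt_source 𝓘(ℝ, Fin d → ℂ) X).choose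

/-- The function on the target of the chart at `c` representing `ρ_c α`, for the partition of unity
`ρ` above. -/
def localDensity {d : ℕ} {X : Type*} [TopologicalSpace X] [ChartedSpace (Fin d → ℂ) X]
    [IsManifold 𝓘(ℂ, Fin d → ℂ) ω X] [T2Space X] [SigmaCompactSpace X]
    (α : TopForm d X) (c : X) (y : Fin d → ℂ) : ℂ :=
  (chartPartition d X c ((chartAt (Fin d → ℂ) c).symm y) : ℂ)
    * coeff (chartAt (Fin d → ℂ) c) α y

/-- (Absolute) integrability of a top form of compact support. -/
def FormIntegrable {d : ℕ} {X : Type*} [TopologicalSpace X] [ChartedSpace (Fin d → ℂ) X]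
    [IsManifold 𝓘(ℂ, Fin d → ℂ) ω X] [T2Space X] [SigmaCompactSpace X]
    (α : TopForm d X) : Prop :=
  ∀ c : X, IntegrableOn (localDensity α c) (chartAt (Fin d → ℂ) c).target

/-- The integral `∫_X α` of a top form of compact support over `X` with its canonical orientation:
by a partition of unity and Lebesgue integrals in charts. Only finitely many terms of the sum are
nonzero, since the partition of unity is locally finite. -/
def formIntegral {d : ℕ} {X : Type*} [TopologicalSpace X] [ChartedSpace (Fin d → ℂ) X]
    [IsManifold 𝓘(ℂ, Fin d → ℂ) ω X] [T2Space X] [SigmaCompactSpace X]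
    (α : TopForm d X) : ℂ :=
  ∑ᶠ c : X, ∫ y in (chartAt (Fin d → ℂ) c).target, localDensity α c y

/-! ### Divisors and Morse--Bott functions -/

/-- The closed subsets `D i` are smooth complex hypersurfaces with normal crossings: near every
point `p` there are holomorphic coordinates in which the `D i` through `p` are distinct coordinate
hyperplanes. -/
def IsNormalCrossing (d : ℕ) {m : ℕ} {X : Type*} [TopologicalSpace X] [ChartedSpace (Fin d → ℂ) X]
    (D : Fin m → Set X) : Prop :=
  (∀ i, IsClosed (D i)) ∧
  ∀ p : X, ∃ e ∈ IsManifold.maximalAtlas 𝓘(ℂ, Fin d → ℂ) ω X, p ∈ e.source ∧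
    ∃ k : {i // p ∈ D i} ↪ Fin d, ∀ i, ∀ x ∈ e.source, x ∈ D i.1 ↔ e x (k i) = 0

/-- The rank at `x` of the second derivative of `μ` in the chart at `x`; at a critical point this
is the rank of the Hessian of `μ`. -/
def hessianRank (d : ℕ) {X : Type*} [TopologicalSpace X] [ChartedSpace (Fin d → ℂ) X]
    (μ : X → ℝ) (x : X) : ℕ :=
  Module.finrank ℝ (LinearMap.range
    (fderiv ℝ (fderiv ℝ (μ ∘ (chartAt (Fin d → ℂ) x).symm)) (chartAt (Fin d → ℂ) x x)).toLinearMap)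

/-- Nonnegative Morse--Bott functions with zero set `Y`, a submanifold of real codimension `r`. -/
structure IsMorseBott (d : ℕ) {X : Type*} [TopologicalSpace X] [ChartedSpace (Fin d → ℂ) X]
    (r : ℕ) (Y : Set X) (μ : X → ℝ) : Prop where
  smooth : ContMDiff 𝓘(ℝ, Fin d → ℂ) 𝓘(ℝ, ℝ) ∞ μ
  nonneg : ∀ x, 0 ≤ μ x
  zero_iff : ∀ x, μ x = 0 ↔ x ∈ Y
  hessian_rank : ∀ x ∈ Y, hessianRank d μ x = r

/-- `f` is a local equation of the hypersurface `Y` on the open set `U`. -/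
structure IsLocalEquation (d : ℕ) {X : Type*} [TopologicalSpace X] [ChartedSpace (Fin d → ℂ) X]
    (Y U : Set X) (f : X → ℂ) : Prop where
  holomorphic : MDifferentiableOn 𝓘(ℂ, Fin d → ℂ) 𝓘(ℂ, ℂ) f U
  zero_iff : ∀ x ∈ U, f x = 0 ↔ x ∈ Y
  simple : ∀ x ∈ U ∩ Y, mfderiv 𝓘(ℂ, Fin d → ℂ) 𝓘(ℂ, ℂ) f x ≠ 0

/-- Nonnegative Morse--Bott functions in the canonical conformal class of a smooth complex
hypersurface `Y`: for every local equation `f` of `Y`, the quotient `μ / |f|²` extends to a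
positive smooth function. -/
structure IsCanonicalMorseBott (d : ℕ) {X : Type*} [TopologicalSpace X]
    [ChartedSpace (Fin d → ℂ) X] (Y : Set X) (μ : X → ℝ) : Prop where
  morseBott : IsMorseBott d 2 Y μ
  canonical : ∀ (U : Set X) (f : X → ℂ), IsOpen U → IsLocalEquation d Y U f →
    ∃ g : X → ℝ, ContMDiffOn 𝓘(ℝ, Fin d → ℂ) 𝓘(ℝ, ℝ) ∞ g U ∧
      ∀ x ∈ U, 0 < g x ∧ μ x = g x * ‖f x‖ ^ 2

/-- `α` is a top form on the complement of the union of the `D i` such that `(∏ μ_i)^N α` extends,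
for some `N`, to a smooth form with compact support on `X`. The values of `α` on the `D i` are
irrelevant. -/
def HasPolesAlong {d m : ℕ} {X : Type*} [TopologicalSpace X] [ChartedSpace (Fin d → ℂ) X]
    (D : Fin m → Set X) (μ : Fin m → X → ℝ) (α : TopForm d X) : Prop :=
  ∃ (N : ℕ) (β : TopForm d X), SmoothForm β ∧ (∃ K : Set X, IsCompact K ∧ ∀ x ∉ K, β x = 0) ∧
    ∀ x ∉ ⋃ i, D i, ((∏ i, μ i x) ^ N) • α x = β x

/-! ### The zeta function -/

/-- The form `μ₁^{s₁/2} ⋯ μ_m^{s_m/2} α`. -/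
def weightedForm {d m : ℕ} {X : Type*} [TopologicalSpace X] [ChartedSpace (Fin d → ℂ) X]
    (μ : Fin m → X → ℝ) (α : TopForm d X) (s : Fin m → ℂ) : TopForm d X :=
  fun x => (∏ i, (μ i x : ℂ) ^ (s i / 2)) • α x

/-- The complement of the hyperplanes `s_i = 2 k`, `k ∈ ℤ`. -/
def regularSet (m : ℕ) : Set (Fin m → ℂ) := {s | ∀ i, ∀ k : ℤ, s i ≠ 2 * k}

open Classical in
/-- `Z` is a meromorphic function on `ℂ ^ m` with at most simple poles on the hyperplanes
`s_i = 2 k`, `k ∈ ℤ` (its values on these hyperplanes being irrelevant). -/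
def HasSimplePoles {m : ℕ} (Z : (Fin m → ℂ) → ℂ) : Prop :=
  ∀ a : Fin m → ℂ, ∃ h : (Fin m → ℂ) → ℂ, AnalyticAt ℂ h a ∧
    ∀ᶠ s in 𝓝 a, s ∈ regularSet m →
      (∏ i with ∃ k : ℤ, a i = 2 * k, (s i - a i)) * Z s = h s

/-- `Z` is a meromorphic continuation, with at most simple poles on the hyperplanes `s_i = 2 k`, of
`∫_X μ₁^{s₁/2} ⋯ μ_m^{s_m/2} α`, which converges absolutely for `Re s_i` large enough. -/
structure IsZetaContinuation {d m : ℕ} {X : Type*} [TopologicalSpace X]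
    [ChartedSpace (Fin d → ℂ) X] [IsManifold 𝓘(ℂ, Fin d → ℂ) ω X] [T2Space X]
    [SigmaCompactSpace X] (μ : Fin m → X → ℝ) (α : TopForm d X) (Z : (Fin m → ℂ) → ℂ) : Prop where
  eq_integral : ∃ R : ℝ, ∀ s : Fin m → ℂ, (∀ i, R < (s i).re) →
    FormIntegrable (weightedForm μ α s) ∧ Z s = formIntegral (weightedForm μ α s)
  meromorphic : HasSimplePoles Z

/-- The zeta function `ζ(s; μ, α)`: the meromorphic continuation of the above integral. -/
def zeta {d m : ℕ} {X : Type*} [TopologicalSpace X]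
    [ChartedSpace (Fin d → ℂ) X] [IsManifold 𝓘(ℂ, Fin d → ℂ) ω X] [T2Space X]
    [SigmaCompactSpace X] (μ : Fin m → X → ℝ) (α : TopForm d X) : (Fin m → ℂ) → ℂ :=
  Classical.epsilon (IsZetaContinuation μ α)

/-- The residue at `c` of a function with an isolated singularity at `c`. -/
def residue (f : ℂ → ℂ) (c : ℂ) : ℂ :=
  limUnder (𝓝[>] (0 : ℝ)) fun r => (2 * Real.pi * Complex.I)⁻¹ * ∮ z in C(c, r), f z

/-- The iterated residue `res_{s₁ = 0} ⋯ res_{s_m = 0} F`; the residue in the last variable is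
taken first. -/
def iteratedResidue : (m : ℕ) → ((Fin m → ℂ) → ℂ) → ℂ
  | 0, F => F Fin.elim0
  | m + 1, F => iteratedResidue m fun s => residue (fun z => F (Fin.snoc s z)) 0

/-- `I_M(μ, α) = res_{s₁ = 0} ⋯ res_{s_m = 0} (∏_{i ∈ M} 1 / s_i) ζ(s; μ, α)`. -/
def residueCoeff {d m : ℕ} {X : Type*} [TopologicalSpace X]
    [ChartedSpace (Fin d → ℂ) X] [IsManifold 𝓘(ℂ, Fin d → ℂ) ω X] [T2Space X]
    [SigmaCompactSpace X] (M : Finset (Fin m)) (μ : Fin m → X → ℝ) (α : TopForm d X) : ℂ :=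
  iteratedResidue m fun s => (∏ i ∈ M, 1 / s i) * zeta μ α s

/-- The finite part `I_finite = I_{[m]}`. -/
def finitePart {d m : ℕ} {X : Type*} [TopologicalSpace X]
    [ChartedSpace (Fin d → ℂ) X] [IsManifold 𝓘(ℂ, Fin d → ℂ) ω X] [T2Space X]
    [SigmaCompactSpace X] (μ : Fin m → X → ℝ) (α : TopForm d X) : ℂ :=
  residueCoeff Finset.univ μ α

/-- The product `φ α` of a real function and a top form. -/
def mulForm {d : ℕ} {X : Type*} [TopologicalSpace X] [ChartedSpace (Fin d → ℂ) X]
    (φ : X → ℝ) (α : TopForm d X) : TopForm d X :=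
  fun x => φ x • α x

end NormalCrossing

end

/-! # Zeta functions of divisors with normal crossings

**Continuation.** A partition of unity reduces the integral to forms supported in coordinates `z`
in which `μ_i` is a positive smooth multiple of `|z_{k i}|²`, or positive. The positive factors are
entire in `s` after taking powers, so one has to continue integrals over `ℂ ^ d` of
`∏ |z_{k i}| ^ s_i · G_s(z)`, where `G_s` is smooth with compact support and holomorphic in `s`. Since
`∂/∂ζ (ζ ^ (n + 1) |ζ| ^ s) = (n + 1 + s / 2) ζ ^ n |ζ| ^ s`, integration by parts multiplies the
integrand by `ζ` at the cost of the factor `-(n + 1 + s / 2)` and of a derivative of `G_s`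
(`IsHolFamily.integral_update`). After `n` steps in each variable the integral converges for
`Re s_i > -n - 2`, and it is analytic there by dominated convergence and Osgood's lemma
(`IsHolFamily.analyticAt_integral`, which is needed for `Re s_i > -n - 1` only). The factors
accumulated (`poleFactor`) have simple zeros, at even integers; dividing by them and glueing gives
the continuation (`exists_hasSimplePoles_of_poleFactor`). A pole of `α` along the divisor is removed
by a shift of `s` by an even integer, which preserves the set of hyperplanes `s_i = 2 k`. Uniqueness
is the identity theorem on the complement of the hyperplanes, which is connected.

**Variation.** As `e ^ w = 1 + w + w² E(w)` with `E` entire, replacing `μ_j` by `e ^ (2 φ) μ_j`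
replaces the zeta function `ζ(s; α)` by `ζ(s; α) + s_j ζ(s; φ α) + s_j² Z(s)`, where `Z` is the
continuation of the integral of `∏ μ_i ^ (s_i / 2) φ² E(s_j φ) α`, which is of the kind treated above,
and has simple poles (`exists_zeta_rescale`). The iterated residue of a function without a pole along
`s_j = 0` vanishes, whatever its poles along the other hyperplanes (`iteratedResidue_eq_zero`). If
`j ∉ M`, the two last terms, divided by `∏_{i ∈ M} s_i`, have no such pole; if `j ∈ M`, the last one
has none and the second contributes `I_{M ∖ j}(φ α)`. Since any two functions in the canonical class
of `D_j` differ by a factor `e ^ (2 φ)` (`exists_eq_exp_mul`), this gives the independence of `I_M`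
of `μ_j` for `j ∉ M`, and, rescaling one function after the other, the formula for `I_finite`
(`residueCoeff_piecewise`).
-/

noncomputable section

namespace NormalCrossing

/-! ### Holomorphic functions of several variables -/

/-- The radial retraction of a normed space onto the closed ball of radius `r` around `a`. It makes
functions that are continuous on that ball continuous everywhere, without changing them there. -/
def ballRetraction {E : Type*} [NormedAddCommGroup E] [NormedSpace ℝ E] (a : E) (r : ℝ) (x : E) :
    E :=
  a + (r / max r ‖x - a‖) • (x - a)

section ballRetraction

variable {E : Type*} [NormedAddCommGroup E] [NormedSpace ℝ E] {a : E} {r : ℝ}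

lemma continuous_ballRetraction (hr : 0 < r) : Continuous (ballRetraction a r) := by
  unfold ballRetraction
  have : ∀ x : E, max r ‖x - a‖ ≠ 0 := fun x => (lt_max_of_lt_left hr).ne'
  fun_prop (disch := assumption)

lemma ballRetraction_mem (hr : 0 < r) (x : E) : ballRetraction a r x ∈ Metric.closedBall a r := by
  have h : 0 < max r ‖x - a‖ := lt_max_of_lt_left hr
  rw [ballRetraction, mem_closedBall_iff_norm, add_sub_cancel_left, norm_smul, Real.norm_eq_abs,
    abs_of_nonneg (by positivity), div_mul_eq_mul_div, div_le_iff₀ h]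
  exact mul_le_mul_of_nonneg_left (le_max_right _ _) hr.le

lemma ballRetraction_of_mem (hr : 0 < r) {x : E} (hx : x ∈ Metric.closedBall a r) :
    ballRetraction a r x = x := by
  rw [mem_closedBall_iff_norm] at hx
  rw [ballRetraction, max_eq_left hx, div_self hr.ne', one_smul, add_sub_cancel]

end ballRetraction

/-- A jointly continuous family of holomorphic functions, indexed by a compact space, is a
holomorphic function with values in the Banach space of continuous functions on that space. -/
lemma analyticAt_continuousMap {P F : Type*} [TopologicalSpace P] [CompactSpace P]
    [NormedAddCommGroup F] [NormedSpace ℂ F] [CompleteSpace F]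
    (f : C(ℂ × P, F)) {c : ℂ} {r : ℝ} (hr : 0 < r)
    (hd : ∀ p, DifferentiableOn ℂ (fun ζ => f (ζ, p)) (Metric.ball c r)) :
    AnalyticAt ℂ (fun ζ => (f.curry ζ : C(P, F))) c := by
  set ρ : NNReal := ⟨r / 2, by positivity⟩ with hρ
  have hρ0 : 0 < ρ := by rw [← NNReal.coe_pos]; change 0 < r / 2; positivity
  have hρr : (ρ : ℝ) < r := by change r / 2 < r; linarith
  have hc : Continuous f.curry := f.curry.continuous
  have hci : CircleIntegrable f.curry c ρ := hc.continuousOn.circleIntegrable ρ.2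
  refine (hasFPowerSeriesOn_cauchy_integral hci hρ0).analyticAt.congr ?_
  filter_upwards [Metric.ball_mem_nhds c (NNReal.coe_pos.2 hρ0)] with w hw
  ext p
  have hne : ∀ θ, circleMap c ρ θ - w ≠ 0 := fun θ h =>
    (circleMap_ne_mem_ball hw θ) (sub_eq_zero.1 h)
  have hint : IntervalIntegrable (fun θ => deriv (circleMap c ρ) θ •
      ((circleMap c ρ θ - w)⁻¹ • f.curry (circleMap c ρ θ))) volume 0 (2 * Real.pi) := by
    apply Continuous.intervalIntegrable
    simp only [deriv_circleMap]
    fun_prop (disch := assumption)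
  have h1 : (∮ z in C(c, ρ), (z - w)⁻¹ • f.curry z) p
      = ∮ z in C(c, ρ), (z - w)⁻¹ • f (z, p) := by
    have := ContinuousLinearMap.intervalIntegral_comp_comm (ContinuousMap.evalCLM ℂ p) hint
    simp only [circleIntegral]
    simpa using this.symm
  change (2 * Real.pi * Complex.I : ℂ)⁻¹ • ((∮ z in C(c, ρ), (z - w)⁻¹ • f.curry z) p) = f (w, p)
  rw [h1]
  have hdd : DiffContOnCl ℂ (fun ζ => f (ζ, p)) (Metric.ball c ρ) := by
    refine DifferentiableOn.diffContOnCl_ball (U := Metric.ball c r) (hd p) ?_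
    exact Metric.closedBall_subset_ball hρr
  exact hdd.two_pi_i_inv_smul_circleIntegral_sub_inv_smul hw

/-- The pairing `(k, u) ↦ ∫ k u` of continuous functions on `[0, 2π]`. -/
def circlePairing (F : Type*) [NormedAddCommGroup F] [NormedSpace ℂ F] [CompleteSpace F] :
    C(Icc (0 : ℝ) (2 * Real.pi), ℂ) →L[ℂ] C(Icc (0 : ℝ) (2 * Real.pi), F) →L[ℂ] F :=
  LinearMap.mkContinuous₂
    (LinearMap.mk₂ ℂ (fun k u => ∫ θ in (0 : ℝ)..2 * Real.pi,
        k (projIcc 0 _ Real.two_pi_pos.le θ) • u (projIcc 0 _ Real.two_pi_pos.le θ))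
      (fun k k' u => by
        rw [← intervalIntegral.integral_add]
        · simp [add_smul]
        all_goals exact Continuous.intervalIntegrable (by fun_prop) _ _)
      (fun a k u => by
        rw [← intervalIntegral.integral_smul]
        simp [mul_smul])
      (fun k u u' => by
        rw [← intervalIntegral.integral_add]
        · simp [smul_add]
        all_goals exact Continuous.intervalIntegrable (by fun_prop) _ _)
      (fun a k u => by
        rw [← intervalIntegral.integral_smul]
        simp [smul_comm a]))
    (2 * Real.pi) fun k u => by
      refine (intervalIntegral.norm_integral_le_of_norm_le_const (C := ‖k‖ * ‖u‖) ?_).trans ?_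
      · intro θ _
        rw [norm_smul]
        gcongr
        · exact k.norm_coe_le_norm _
        · exact u.norm_coe_le_norm _
      · rw [sub_zero, abs_of_pos Real.two_pi_pos]
        exact le_of_eq (by ring)

lemma circlePairing_apply {F : Type*} [NormedAddCommGroup F] [NormedSpace ℂ F] [CompleteSpace F]
    (k : C(Icc (0 : ℝ) (2 * Real.pi), ℂ)) (u : C(Icc (0 : ℝ) (2 * Real.pi), F)) :
    circlePairing F k u = ∫ θ in (0 : ℝ)..2 * Real.pi,
        k (projIcc 0 _ Real.two_pi_pos.le θ) • u (projIcc 0 _ Real.two_pi_pos.le θ) :=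
  rfl

/-- Osgood's lemma for globally continuous functions. In the induction step the Cauchy integral in
the first variable exhibits `f` as the pairing of the Cauchy kernel with the values of `f` on a
circle, both of which are analytic functions with values in spaces of continuous functions. -/
lemma analyticAt_of_continuous_of_separately (m : ℕ) :
    ∀ {F : Type} [NormedAddCommGroup F] [NormedSpace ℂ F] [CompleteSpace F]
      (f : (Fin m → ℂ) → F), Continuous f → ∀ (a : Fin m → ℂ) (r : ℝ), 0 < r →
      (∀ z ∈ Metric.ball a r, ∀ i,
        DifferentiableAt ℂ (fun ζ => f (Function.update z i ζ)) (z i)) →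
      AnalyticAt ℂ f a := by
  induction m with
  | zero =>
    intro F _ _ _ f _ a r _ _
    have : f = fun _ => f a := by
      ext x
      rw [Subsingleton.elim x a]
    rw [this]
    exact analyticAt_const
  | succ m ih =>
    intro F _ _ _ f hf a r hr hd
    set ρ := r / 2 with hρ
    have hρ0 : 0 < ρ := by positivity
    set q : ℝ → Icc (0 : ℝ) (2 * Real.pi) := projIcc 0 _ Real.two_pi_pos.le with hq
    -- the values of `f` on the circle of radius `ρ` in the first variable
    let g : C((Fin m → ℂ) × Icc (0 : ℝ) (2 * Real.pi), F) :=
      ⟨fun p => f (Fin.cons (circleMap (a 0) ρ p.2) p.1), by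
        refine hf.comp (continuous_pi fun i => ?_)
        refine Fin.cases ?_ (fun j => ?_) i
        · simp only [Fin.cons_zero]; fun_prop
        · simp only [Fin.cons_succ]; fun_prop⟩
    have hg : AnalyticAt ℂ (fun w => (g.curry w : C(Icc (0 : ℝ) (2 * Real.pi), F)))
        (Fin.tail a) := by
      refine ih _ g.curry.continuous (Fin.tail a) r hr fun w hw i => ?_
      let g' : C(ℂ × Icc (0 : ℝ) (2 * Real.pi), F) :=
        ⟨fun p => g (Function.update w i p.1, p.2), by
          refine g.continuous.comp (Continuous.prodMk ?_ continuous_snd)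
          exact (continuous_const.update i continuous_fst)⟩
      -- the ball in which the `i`-th variable may move
      obtain ⟨δ, hδ, hδr⟩ : ∃ δ > 0, ∀ ζ ∈ Metric.ball (w i) δ,
          Function.update w i ζ ∈ Metric.ball (Fin.tail a) r := by
        have : Continuous fun ζ => Function.update w i ζ := continuous_const.update i continuous_id
        have h2 := this.continuousAt.preimage_mem_nhds (x := w i)
          (Metric.isOpen_ball.mem_nhds (by simpa using hw))
        exact Metric.mem_nhds_iff.1 h2
      refine (analyticAt_continuousMap g' hδ fun p => ?_).differentiableAt
      intro ζ hζ
      have hmem : (Fin.cons (circleMap (a 0) ρ p) (Function.update w i ζ) : Fin (m + 1) → ℂ)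
          ∈ Metric.ball a r := by
        rw [mem_ball_iff_norm, pi_norm_lt_iff hr]
        refine Fin.cases ?_ fun j => ?_
        · rw [Pi.sub_apply, Fin.cons_zero, circleMap_sub_center, norm_circleMap_zero,
            abs_of_pos hρ0]
          linarith
        · have := hδr ζ hζ
          rw [mem_ball_iff_norm, pi_norm_lt_iff hr] at this
          simpa only [Pi.sub_apply, Fin.cons_succ, Fin.tail] using this j
      have := hd _ hmem i.succ
      simp only [Fin.cons_succ, Function.update_self] at this
      refine DifferentiableAt.differentiableWithinAt ?_
      convert! this using 2 with ζ'
      change f _ = f _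
      rw [← Fin.cons_update, Function.update_idem]
    -- the Cauchy kernel
    let κ : C(ℂ × Icc (0 : ℝ) (2 * Real.pi), ℂ) :=
      ⟨fun p => (2 * Real.pi * Complex.I)⁻¹ * (circleMap 0 ρ p.2 * Complex.I
        * (circleMap (a 0) ρ p.2 - ballRetraction (a 0) (ρ / 2) p.1)⁻¹), by
        have h1 := continuous_ballRetraction (a := a 0) (half_pos hρ0)
        have h2 : ∀ p : ℂ × Icc (0 : ℝ) (2 * Real.pi),
            circleMap (a 0) ρ p.2 - ballRetraction (a 0) (ρ / 2) p.1 ≠ 0 := fun p h => by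
          refine circleMap_ne_mem_ball (w := ballRetraction (a 0) (ρ / 2) p.1) (c := a 0) (R := ρ)
            ?_ p.2 (sub_eq_zero.1 h)
          exact Metric.closedBall_subset_ball (by linarith)
            (ballRetraction_mem (half_pos hρ0) p.1)
        fun_prop (disch := assumption)⟩
    have hκ : AnalyticAt ℂ (fun ζ => (κ.curry ζ : C(Icc (0 : ℝ) (2 * Real.pi), ℂ))) (a 0) := by
      refine analyticAt_continuousMap κ (half_pos hρ0) fun p => ?_
      have : DifferentiableOn ℂ (fun ζ => (2 * Real.pi * Complex.I)⁻¹ *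
          (circleMap 0 ρ p * Complex.I * (circleMap (a 0) ρ p - ζ)⁻¹))
          (Metric.ball (a 0) (ρ / 2)) := by
        have h2 : ∀ ζ ∈ Metric.ball (a 0) (ρ / 2), circleMap (a 0) ρ p - ζ ≠ 0 := fun ζ hζ h =>
          circleMap_ne_mem_ball (Metric.ball_subset_ball (by linarith) hζ) p (sub_eq_zero.1 h)
        fun_prop (disch := assumption)
      refine this.congr fun ζ hζ => ?_
      change _ * (_ * (_ - ballRetraction (a 0) (ρ / 2) ζ)⁻¹) = _
      rw [ballRetraction_of_mem (half_pos hρ0) (Metric.ball_subset_closedBall hζ)]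
    have htail : AnalyticAt ℂ (fun z : Fin (m + 1) → ℂ => Fin.tail z) a := by
      have h : (fun z : Fin (m + 1) → ℂ => Fin.tail z)
          = ContinuousLinearMap.pi fun i : Fin m =>
            ContinuousLinearMap.proj (R := ℂ) (φ := fun _ : Fin (m + 1) => ℂ) i.succ := rfl
      rw [h]
      exact ContinuousLinearMap.analyticAt _ _
    have hhead : AnalyticAt ℂ (fun z : Fin (m + 1) → ℂ => z 0) a :=
      (ContinuousLinearMap.proj (R := ℂ) (φ := fun _ : Fin (m + 1) => ℂ) 0).analyticAt a
    have hmain : AnalyticAt ℂ (fun z : Fin (m + 1) → ℂ =>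
        circlePairing F (κ.curry (z 0)) (g.curry (Fin.tail z))) a :=
      ((circlePairing F).analyticAt_bilinear _).comp₂ (hκ.comp_of_eq hhead rfl)
        (hg.comp_of_eq htail rfl)
    refine hmain.congr ?_
    filter_upwards [Metric.ball_mem_nhds a (half_pos hρ0)] with z hz
    have hz' := hz
    rw [mem_ball_iff_norm, pi_norm_lt_iff (half_pos hρ0)] at hz
    have hz0 : z 0 ∈ Metric.ball (a 0) (ρ / 2) := by
      rw [mem_ball_iff_norm]; exact hz 0
    have hzρ : z 0 ∈ Metric.ball (a 0) ρ := Metric.ball_subset_ball (by linarith) hz0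
    have hdiff : DiffContOnCl ℂ (fun ζ => f (Fin.cons ζ (Fin.tail z))) (Metric.ball (a 0) ρ) := by
      refine DifferentiableOn.diffContOnCl_ball (U := Metric.ball (a 0) r) (fun ζ hζ => ?_)
        (Metric.closedBall_subset_ball (by linarith))
      have hmem : (Fin.cons ζ (Fin.tail z) : Fin (m + 1) → ℂ) ∈ Metric.ball a r := by
        rw [mem_ball_iff_norm, pi_norm_lt_iff hr]
        refine Fin.cases ?_ fun j => ?_
        · simpa only [Pi.sub_apply, Fin.cons_zero, mem_ball_iff_norm] using hζ
        · have := hz j.succ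
          simp only [Pi.sub_apply, Fin.cons_succ, Fin.tail] at this ⊢
          linarith
      have := hd _ hmem 0
      simp only [Fin.cons_zero] at this
      refine DifferentiableAt.differentiableWithinAt ?_
      convert! this using 2 with ζ'
      rw [Fin.update_cons_zero]
    have hC := hdiff.two_pi_i_inv_smul_circleIntegral_sub_inv_smul hzρ
    rw [Fin.cons_self_tail] at hC
    rw [← hC, circlePairing_apply, circleIntegral, ← intervalIntegral.integral_smul]
    refine intervalIntegral.integral_congr fun θ hθ => ?_
    rw [uIcc_of_le Real.two_pi_pos.le] at hθ
    have hqθ : (q θ : ℝ) = θ := by rw [hq, projIcc_of_mem _ hθ]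
    change ((2 * Real.pi * Complex.I)⁻¹ * (circleMap 0 ρ (q θ) * Complex.I
        * (circleMap (a 0) ρ (q θ) - ballRetraction (a 0) (ρ / 2) (z 0))⁻¹))
        • f (Fin.cons (circleMap (a 0) ρ (q θ)) (Fin.tail z)) = _
    rw [hqθ, ballRetraction_of_mem (half_pos hρ0) (Metric.ball_subset_closedBall hz0),
      deriv_circleMap]
    simp only [smul_smul, mul_assoc]

/-- **Osgood's lemma**: a continuous function of several complex variables that is holomorphic in
each variable is analytic. -/
theorem analyticAt_of_continuousOn_of_separately {m : ℕ} {f : (Fin m → ℂ) → ℂ} {a : Fin m → ℂ}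
    {r : ℝ} (hr : 0 < r) (hf : ContinuousOn f (Metric.ball a r))
    (hd : ∀ z ∈ Metric.ball a r, ∀ i,
      DifferentiableAt ℂ (fun ζ => f (Function.update z i ζ)) (z i)) :
    AnalyticAt ℂ f a := by
  have hr2 := half_pos hr
  have hsub : Metric.closedBall a (r / 2) ⊆ Metric.ball a r :=
    Metric.closedBall_subset_ball (by linarith)
  have h1 : Continuous (f ∘ ballRetraction a (r / 2)) :=
    hf.comp_continuous (continuous_ballRetraction hr2) fun x => hsub (ballRetraction_mem hr2 x)
  refine (analyticAt_of_continuous_of_separately m _ h1 a (r / 2) hr2 fun z hz i => ?_).congr ?_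
  · refine (hd z (Metric.ball_subset_ball (by linarith) hz) i).congr_of_eventuallyEq ?_
    have hc : Continuous fun ζ => Function.update z i ζ := continuous_const.update i continuous_id
    have := hc.continuousAt.preimage_mem_nhds (x := z i)
      (Metric.isOpen_ball.mem_nhds (by simpa using hz))
    filter_upwards [this] with ζ hζ
    rw [Function.comp_apply, ballRetraction_of_mem hr2 (Metric.ball_subset_closedBall hζ)]
  · filter_upwards [Metric.ball_mem_nhds a hr2] with z hz
    rw [Function.comp_apply, ballRetraction_of_mem hr2 (Metric.ball_subset_closedBall hz)]

/-- An integral depending on complex parameters is analytic in them if the integrand is holomorphic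
in the parameters and dominated by an integrable function. -/
theorem analyticAt_integral {m : ℕ} {α : Type*} [MeasurableSpace α] {ν : Measure α}
    {K : (Fin m → ℂ) → α → ℂ} {a : Fin m → ℂ} {r : ℝ} (hr : 0 < r) {B : α → ℝ}
    (hmeas : ∀ s ∈ Metric.ball a r, AEStronglyMeasurable (K s) ν) (hB : Integrable B ν)
    (hbound : ∀ᵐ x ∂ν, ∀ s ∈ Metric.ball a r, ‖K s x‖ ≤ B x)
    (hdiff : ∀ᵐ x ∂ν, DifferentiableOn ℂ (fun s => K s x) (Metric.ball a r)) :
    AnalyticAt ℂ (fun s => ∫ x, K s x ∂ν) a := by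
  have hnhds : ∀ s ∈ Metric.ball a r, Metric.ball a r ∈ 𝓝 s := fun s hs =>
    Metric.isOpen_ball.mem_nhds hs
  refine analyticAt_of_continuousOn_of_separately hr (fun s hs => ?_) fun s hs i => ?_
  · refine ContinuousAt.continuousWithinAt (continuousAt_of_dominated (bound := B) ?_ ?_ hB ?_)
    · filter_upwards [hnhds s hs] with t ht using hmeas t ht
    · filter_upwards [hnhds s hs] with t ht
      filter_upwards [hbound] with x hx using hx t ht
    · filter_upwards [hdiff] with x hx
      exact (hx.differentiableAt (hnhds s hs)).continuousAt
  · have hcont : Continuous fun ζ => Function.update s i ζ :=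
      continuous_const.update i continuous_id
    have hupd : Differentiable ℂ fun ζ : ℂ => Function.update s i ζ := fun ζ =>
      (hasFDerivAt_update s ζ).differentiableAt
    obtain ⟨δ, hδ, hδr⟩ : ∃ δ > 0, ∀ ζ ∈ Metric.ball (s i) δ,
        Function.update s i ζ ∈ Metric.ball a r :=
      Metric.mem_nhds_iff.1 (hcont.continuousAt.preimage_mem_nhds (x := s i)
        (Metric.isOpen_ball.mem_nhds (by simpa using hs)))
    have hδ2 := half_pos hδ
    have hsub : Metric.ball (s i) (δ / 2) ⊆ Metric.ball (s i) δ :=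
      Metric.ball_subset_ball (by linarith)
    have hK : ∀ᵐ x ∂ν, DifferentiableOn ℂ (fun ζ => K (Function.update s i ζ) x)
        (Metric.ball (s i) δ) := by
      filter_upwards [hdiff] with x hx
      exact hx.comp hupd.differentiableOn hδr
    have hself : Function.update s i (s i) = s := Function.update_eq_self i s
    refine (hasDerivAt_integral_of_dominated_loc_of_deriv_le (s := Metric.ball (s i) (δ / 2))
      (F := fun ζ x => K (Function.update s i ζ) x)
      (F' := fun ζ x => deriv (fun ζ => K (Function.update s i ζ) x) ζ)
      (bound := fun x => B x / (δ / 2)) (Metric.ball_mem_nhds _ hδ2) ?_ ?_ ?_ ?_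
      (hB.div_const _) ?_).2.differentiableAt
    · filter_upwards [Metric.ball_mem_nhds (s i) hδ] with ζ hζ using hmeas _ (hδr ζ hζ)
    · refine Integrable.mono' hB (hmeas _ (by rwa [hself])) ?_
      filter_upwards [hbound] with x hx using hx _ (by rwa [hself])
    · -- the derivative is a limit of difference quotients, hence measurable
      have hlim : Tendsto (fun n : ℕ => s i + ((δ / (n + 2) : ℝ) : ℂ)) atTop (𝓝[≠] (s i)) := by
        refine tendsto_nhdsWithin_iff.2 ⟨?_, Eventually.of_forall fun n => ?_⟩
        · have h0 : Tendsto (fun n : ℕ => δ / ((n : ℝ) + 2)) atTop (𝓝 0) :=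
            Tendsto.div_atTop tendsto_const_nhds
              (tendsto_atTop_add_const_right _ _ tendsto_natCast_atTop_atTop)
          have := ((Complex.continuous_ofReal.tendsto 0).comp h0).const_add (s i)
          simpa using this
        · simp only [mem_compl_iff, mem_singleton_iff, add_eq_left, Complex.ofReal_eq_zero]
          positivity
      refine aestronglyMeasurable_of_tendsto_ae atTop
        (f := fun (n : ℕ) x => slope (fun ζ => K (Function.update s i ζ) x) (s i)
          (s i + ((δ / (n + 2) : ℝ) : ℂ))) (fun n => ?_) ?_
      · simp only [slope, vsub_eq_sub]
        have h1 : AEStronglyMeasurable (K (Function.update s i (s i))) ν :=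
          hmeas _ (by rwa [hself])
        have hmem : s i + ((δ / (n + 2) : ℝ) : ℂ) ∈ Metric.ball (s i) δ := by
          rw [mem_ball_iff_norm, add_sub_cancel_left, Complex.norm_real, Real.norm_eq_abs,
            abs_of_pos (by positivity), div_lt_iff₀ (by positivity)]
          nlinarith [(Nat.cast_nonneg n : (0 : ℝ) ≤ n)]
        exact ((hmeas _ (hδr _ hmem)).sub h1).const_smul
          ((s i + ((δ / (n + 2) : ℝ) : ℂ) - s i)⁻¹ : ℂ)
      · filter_upwards [hK] with x hx
        exact (hasDerivAt_iff_tendsto_slope.1 (hx.differentiableAt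
          (Metric.ball_mem_nhds _ hδ)).hasDerivAt).comp hlim
    · filter_upwards [hK, hbound] with x hx hbx ζ hζ
      have hball : Metric.closedBall ζ (δ / 2) ⊆ Metric.ball (s i) δ := fun w hw => by
        rw [Metric.mem_ball, Metric.mem_closedBall] at *
        linarith [dist_triangle w ζ (s i)]
      refine Complex.norm_deriv_le_of_forall_mem_sphere_norm_le hδ2
        (hx.diffContOnCl_ball hball) fun w hw => ?_
      exact hbx _ (hδr _ (hball (Metric.sphere_subset_closedBall hw)))
    · filter_upwards [hK] with x hx ζ hζ
      exact (hx.differentiableAt (Metric.isOpen_ball.mem_nhds (hsub hζ))).hasDerivAt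

/-! ### Functions with simple poles on the hyperplanes `s_i = 2 k` -/

lemma isOpen_compl_even : IsOpen {z : ℂ | ∀ k : ℤ, z ≠ 2 * k} := by
  have h : {z : ℂ | ∀ k : ℤ, z ≠ 2 * k} = (fun z : ℂ => z / 2) ⁻¹' (range ((↑) : ℤ → ℂ))ᶜ := by
    ext z
    simp only [mem_ofPred_eq, mem_preimage, mem_compl_iff, mem_range, not_exists, ne_eq]
    refine forall_congr' fun k => not_congr ?_
    rw [eq_div_iff two_ne_zero, mul_comm, eq_comm]
  rw [h]
  exact Complex.isClosedEmbedding_intCast.isClosed_range.isOpen_compl.preimage (by fun_prop)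

lemma regularSet_eq_pi (m : ℕ) :
    regularSet m = univ.pi fun _ => {z : ℂ | ∀ k : ℤ, z ≠ 2 * k} := by
  ext s
  simp [regularSet]

lemma isOpen_regularSet (m : ℕ) : IsOpen (regularSet m) := by
  rw [regularSet_eq_pi]
  exact isOpen_set_pi finite_univ fun _ _ => isOpen_compl_even

lemma isPreconnected_regularSet (m : ℕ) : IsPreconnected (regularSet m) := by
  rw [regularSet_eq_pi]
  refine isPreconnected_univ_pi fun _ => ?_
  have h : {z : ℂ | ∀ k : ℤ, z ≠ 2 * k} = (range fun k : ℤ => (2 * k : ℂ))ᶜ := by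
    ext z
    simp [eq_comm]
  rw [h]
  exact ((countable_range _).isConnected_compl_of_one_lt_rank (by simp)).isPreconnected

/-- The point with all coordinates `r + i`, which lies off all the hyperplanes. -/
lemma const_add_I_mem_regularSet (m : ℕ) (r : ℝ) :
    (fun _ => (r : ℂ) + Complex.I) ∈ regularSet m := by
  intro i k h
  have := congrArg Complex.im h
  simp at this

lemma isOpen_forall_lt_re {m : ℕ} (r : ℝ) : IsOpen {s : Fin m → ℂ | ∀ i, r < (s i).re} := by
  simp only [ofPred_forall]
  exact isOpen_iInter_of_finite fun i =>
    isOpen_lt continuous_const (Complex.continuous_re.comp (continuous_apply i))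

namespace HasSimplePoles

variable {m : ℕ} {Z Z' : (Fin m → ℂ) → ℂ}

protected lemma zero : HasSimplePoles (fun _ : Fin m → ℂ => (0 : ℂ)) :=
  fun _ => ⟨fun _ => 0, analyticAt_const, Eventually.of_forall fun _ _ => mul_zero _⟩

protected lemma add (h : HasSimplePoles Z) (h' : HasSimplePoles Z') :
    HasSimplePoles fun s => Z s + Z' s := by
  intro a
  obtain ⟨f, hf, hfZ⟩ := h a
  obtain ⟨g, hg, hgZ⟩ := h' a
  refine ⟨fun s => f s + g s, hf.fun_add hg, ?_⟩
  filter_upwards [hfZ, hgZ] with s h1 h2 hs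
  rw [mul_add, h1 hs, h2 hs]

protected lemma analytic_mul (h : HasSimplePoles Z) {P : (Fin m → ℂ) → ℂ}
    (hP : ∀ a, AnalyticAt ℂ P a) : HasSimplePoles fun s => P s * Z s := by
  intro a
  obtain ⟨f, hf, hfZ⟩ := h a
  refine ⟨fun s => P s * f s, (hP a).fun_mul hf, ?_⟩
  filter_upwards [hfZ] with s h1 hs
  rw [← h1 hs, mul_left_comm]

protected lemma sum {ι : Type*} {T : Finset ι} {Y : ι → (Fin m → ℂ) → ℂ}
    (h : ∀ i ∈ T, HasSimplePoles (Y i)) : HasSimplePoles fun s => ∑ i ∈ T, Y i s := by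
  classical
  induction T using Finset.induction_on with
  | empty => simpa using HasSimplePoles.zero
  | insert i T hi ih =>
    simp only [Finset.sum_insert hi]
    exact (h i (Finset.mem_insert_self i T)).add
      (ih fun j hj => h j (Finset.mem_insert_of_mem hj))

open Classical in
/-- The set of hyperplanes `s_i = 2 k` is invariant under shifts by even integers. -/
protected lemma comp_sub_even (h : HasSimplePoles Z) (N : ℕ) :
    HasSimplePoles fun s => Z fun i => s i - 2 * N := by
  intro a
  obtain ⟨f, hf, hfZ⟩ := h fun i => a i - 2 * N
  have hsub : AnalyticAt ℂ (fun s : Fin m → ℂ => fun i => s i - 2 * (N : ℂ)) a := by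
    have : (fun s : Fin m → ℂ => fun i => s i - 2 * (N : ℂ))
        = fun s => s - fun _ => 2 * (N : ℂ) := rfl
    rw [this]
    exact analyticAt_id.fun_sub analyticAt_const
  refine ⟨fun s => f fun i => s i - 2 * N, hf.comp_of_eq hsub rfl, ?_⟩
  have hev := hsub.continuousAt.tendsto.eventually hfZ
  filter_upwards [hev] with s h1 hs
  rw [← h1 fun i k hk => hs i (k + N) (by rw [sub_eq_iff_eq_add] at hk; rw [hk]; push_cast; ring)]
  congr 1
  refine Finset.prod_congr (Finset.filter_congr fun i _ => ?_) fun i _ => by ring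
  constructor
  · rintro ⟨k, hk⟩
    exact ⟨k - N, by rw [hk]; push_cast; ring⟩
  · rintro ⟨k, hk⟩
    exact ⟨k + N, by rw [sub_eq_iff_eq_add] at hk; rw [hk]; push_cast; ring⟩

open Classical in
lemma analyticOnNhd (h : HasSimplePoles Z) : AnalyticOnNhd ℂ Z (regularSet m) := by
  intro a ha
  obtain ⟨f, hf, hfZ⟩ := h a
  refine hf.congr ?_
  filter_upwards [hfZ, (isOpen_regularSet m).mem_nhds ha] with s h1 hs
  rw [← h1 hs, Finset.filter_false_of_mem fun i _ => ?_, Finset.prod_empty, one_mul]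
  rintro ⟨k, hk⟩
  exact ha i k hk

/-- Uniqueness of the meromorphic continuation. -/
theorem eqOn_of_eq (h : HasSimplePoles Z) (h' : HasSimplePoles Z') {R : ℝ}
    (heq : ∀ s : Fin m → ℂ, (∀ i, R < (s i).re) → Z s = Z' s) : EqOn Z Z' (regularSet m) := by
  refine h.analyticOnNhd.eqOn_of_preconnected_of_eventuallyEq h'.analyticOnNhd
    (isPreconnected_regularSet m) (const_add_I_mem_regularSet m (R + 1)) ?_
  filter_upwards [(isOpen_forall_lt_re R).mem_nhds
    (show (fun _ : Fin m => ((R + 1 : ℝ) : ℂ) + Complex.I) ∈ _ from fun i => by simp)]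
    with s hs using heq s hs

end HasSimplePoles

/-- The factor acquired by a local zeta integral after `n` integrations by parts in each
variable. -/
def poleFactor {m : ℕ} (n : ℕ) (s : Fin m → ℂ) : ℂ :=
  ∏ i, ∏ j ∈ Finset.range n, (-(s i + 2 * j + 2) / 2)

lemma analyticAt_coord {m : ℕ} (i : Fin m) (a : Fin m → ℂ) :
    AnalyticAt ℂ (fun s : Fin m → ℂ => s i) a :=
  (ContinuousLinearMap.proj (R := ℂ) (φ := fun _ : Fin m => ℂ) i).analyticAt a

lemma analyticAt_poleFactor {m : ℕ} (n : ℕ) (a : Fin m → ℂ) : AnalyticAt ℂ (poleFactor n) a := by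
  unfold poleFactor
  refine Finset.analyticAt_fun_prod _ fun i _ => Finset.analyticAt_fun_prod _ fun j _ => ?_
  exact ((((analyticAt_coord i a).fun_add analyticAt_const).fun_add
    analyticAt_const).fun_neg).fun_div analyticAt_const two_ne_zero

lemma poleFactor_ne_zero_of_mem {m : ℕ} (n : ℕ) {s : Fin m → ℂ} (hs : s ∈ regularSet m) :
    poleFactor n s ≠ 0 := by
  refine Finset.prod_ne_zero_iff.2 fun i _ => Finset.prod_ne_zero_iff.2 fun j _ h => ?_
  rw [div_eq_zero_iff, or_iff_left two_ne_zero, neg_eq_zero] at h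
  refine hs i (-(j + 1)) ?_
  push_cast
  linear_combination h

lemma poleFactor_ne_zero_of_re {m : ℕ} (n : ℕ) {s : Fin m → ℂ} (hs : ∀ i, 2 < (s i).re) :
    poleFactor n s ≠ 0 := by
  refine Finset.prod_ne_zero_iff.2 fun i _ => Finset.prod_ne_zero_iff.2 fun j _ h => ?_
  rw [div_eq_zero_iff, or_iff_left two_ne_zero, neg_eq_zero] at h
  have := congrArg Complex.re h
  simp at this
  have := hs i
  linarith [(Nat.cast_nonneg j : (0 : ℝ) ≤ j)]

open Classical in
/-- In one variable, the poles contributed by the reciprocal of the pole factor are simple. -/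
lemma exists_analyticAt_div_poleFactor (n : ℕ) (a : ℂ) :
    ∃ u : ℂ → ℂ, AnalyticAt ℂ u a ∧ ∀ z : ℂ, (∀ k : ℤ, z ≠ 2 * k) →
      (if ∃ k : ℤ, a = 2 * k then z - a else 1) / ∏ j ∈ Finset.range n, (-(z + 2 * j + 2) / 2)
        = u z := by
  have hlin : ∀ j : ℕ, AnalyticAt ℂ (fun z : ℂ => -(z + 2 * j + 2) / 2) a := fun j =>
    (((analyticAt_id.fun_add analyticAt_const).fun_add analyticAt_const).fun_neg).fun_div
      analyticAt_const two_ne_zero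
  by_cases h : ∃ j ∈ Finset.range n, a + 2 * j + 2 = 0
  · -- `a = -2 j - 2` is a zero of the factor with index `j` only, which cancels `z - a`
    obtain ⟨j, hj, hja⟩ := h
    have ha : ∃ k : ℤ, a = 2 * k := ⟨-(j + 1), by push_cast; linear_combination hja⟩
    refine ⟨fun z => -2 / ∏ l ∈ (Finset.range n).erase j, (-(z + 2 * l + 2) / 2),
      analyticAt_const.fun_div (Finset.analyticAt_fun_prod _ fun l _ => hlin l) ?_, fun z hz => ?_⟩
    · refine Finset.prod_ne_zero_iff.2 fun l hl h => ?_
      rw [div_eq_zero_iff, or_iff_left two_ne_zero, neg_eq_zero] at h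
      refine (Finset.mem_erase.1 hl).1 ?_
      have : (l : ℂ) = j := by linear_combination (h - hja) / 2
      exact_mod_cast this
    · have hz' : z + 2 * j + 2 ≠ 0 := fun h => hz (-(j + 1)) (by push_cast; linear_combination h)
      rw [if_pos ha, ← Finset.mul_prod_erase _ _ hj, show z - a = z + 2 * j + 2 by
        linear_combination -hja]
      field_simp
  · refine ⟨fun z => (if ∃ k : ℤ, a = 2 * k then z - a else 1) /
      ∏ j ∈ Finset.range n, (-(z + 2 * j + 2) / 2), ?_, fun _ _ => rfl⟩
    refine AnalyticAt.fun_div ?_ (Finset.analyticAt_fun_prod _ fun l _ => hlin l) ?_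
    · split_ifs
      · exact analyticAt_id.fun_sub analyticAt_const
      · exact analyticAt_const
    · refine Finset.prod_ne_zero_iff.2 fun l hl h' => h ⟨l, hl, ?_⟩
      rwa [div_eq_zero_iff, or_iff_left two_ne_zero, neg_eq_zero] at h'

open Classical in
/-- A function on `{Re s_i > 2}` has a continuation with simple poles on the hyperplanes `s_i = 2 k`
if, for every `n`, its product with `poleFactor n` continues analytically to
`{Re s_i > -n - 1}`. -/
theorem exists_hasSimplePoles_of_poleFactor {m : ℕ} {F : (Fin m → ℂ) → ℂ}
    {J : ℕ → (Fin m → ℂ) → ℂ}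
    (hJ : ∀ (n : ℕ) (s : Fin m → ℂ), (∀ i, -(n : ℝ) - 1 < (s i).re) → AnalyticAt ℂ (J n) s)
    (hF : ∀ (n : ℕ) (s : Fin m → ℂ), (∀ i, 2 < (s i).re) → J n s = poleFactor n s * F s) :
    ∃ Z, HasSimplePoles Z ∧ ∀ s : Fin m → ℂ, (∀ i, 2 < (s i).re) → Z s = F s := by
  -- the continuations are compatible with each other
  have hcomp : ∀ n n' : ℕ, n ≤ n' → ∀ s : Fin m → ℂ, (∀ i, -(n : ℝ) - 1 < (s i).re) →
      poleFactor n' s * J n s = poleFactor n s * J n' s := by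
    intro n n' hn s hs
    have hconv : Convex ℝ {s : Fin m → ℂ | ∀ i, -(n : ℝ) - 1 < (s i).re} := by
      simp only [ofPred_forall]
      refine convex_iInter fun i => ?_
      exact convex_halfSpace_gt
        (Complex.reLm.comp (LinearMap.proj (R := ℝ) (φ := fun _ : Fin m => ℂ) i)).isLinear _
    refine AnalyticOnNhd.eqOn_of_preconnected_of_eventuallyEq
      (U := {s : Fin m → ℂ | ∀ i, -(n : ℝ) - 1 < (s i).re}) (z₀ := fun _ => 3)
      (f := fun s => poleFactor n' s * J n s) (g := fun s => poleFactor n s * J n' s)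
      (fun t ht => (analyticAt_poleFactor n' t).fun_mul (hJ n t ht))
      (fun t ht => (analyticAt_poleFactor n t).fun_mul (hJ n' t fun i => ?_))
      hconv.isPreconnected ?_ ?_ hs
    · have : (n : ℝ) ≤ n' := by exact_mod_cast hn
      linarith [ht i]
    · intro i
      have : (0 : ℝ) ≤ n := Nat.cast_nonneg n
      simp
      linarith
    · filter_upwards [(isOpen_forall_lt_re 2).mem_nhds
        (show (fun _ : Fin m => (3 : ℂ)) ∈ _ from fun i => by simp; norm_num)] with t ht
      rw [hF n t ht, hF n' t ht]
      ring
  have hex : ∀ s : Fin m → ℂ, ∃ n : ℕ, ∀ i, -(n : ℝ) - 1 < (s i).re := by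
    intro s
    obtain ⟨C, hC⟩ := (Set.finite_range fun i => -(s i).re).bddAbove
    obtain ⟨n, hn⟩ := exists_nat_ge C
    exact ⟨n, fun i => by linarith [hC (mem_range_self i)]⟩
  choose ν hν using hex
  have hZ : ∀ (n : ℕ) (s : Fin m → ℂ), (∀ i, -(n : ℝ) - 1 < (s i).re) →
      (∀ l, poleFactor l s ≠ 0) →
      J (ν s) s / poleFactor (ν s) s = J n s / poleFactor n s := by
    intro n s hs h0
    rw [div_eq_div_iff (h0 _) (h0 _)]
    rcases le_total n (ν s) with h | h
    · linear_combination -(hcomp _ _ h s hs)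
    · linear_combination (hcomp _ _ h s (hν s))
  refine ⟨fun s => J (ν s) s / poleFactor (ν s) s, fun a => ?_, fun s hs => ?_⟩
  · choose u hu huz using fun i => exists_analyticAt_div_poleFactor (ν a) (a i)
    refine ⟨fun s => (∏ i, u i (s i)) * J (ν a) s,
      (Finset.analyticAt_fun_prod _ fun i _ => (hu i).comp_of_eq (analyticAt_coord i a) rfl).fun_mul
        (hJ _ _ (hν a)), ?_⟩
    filter_upwards [(isOpen_forall_lt_re (-(ν a : ℝ) - 1)).mem_nhds (hν a)] with s hs hreg
    rw [hZ (ν a) s hs fun l => poleFactor_ne_zero_of_mem l hreg, Finset.prod_filter]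
    rw [Finset.prod_congr rfl fun i _ => (huz i (s i) (hreg i)).symm]
    rw [Finset.prod_div_distrib, ← poleFactor]
    ring
  · change J (ν s) s / poleFactor (ν s) s = F s
    rw [hZ 0 s (fun i => by have := hs i; simp; linarith) fun l => poleFactor_ne_zero_of_re l hs,
      hF 0 s hs, mul_div_cancel_left₀ _ (poleFactor_ne_zero_of_re 0 hs)]

/-! ### Iterated residues -/

lemma residue_congr {f g : ℂ → ℂ} {c : ℂ} (h : ∀ᶠ z in 𝓝[≠] c, f z = g z) :
    residue f c = residue g c := by
  obtain ⟨ρ, hρ, hb⟩ := Metric.mem_nhdsWithin_iff.1 h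
  unfold residue limUnder
  congr 1
  refine Filter.map_congr ?_
  filter_upwards [Ioo_mem_nhdsGT hρ] with r hr
  congr 1
  refine circleIntegral.integral_congr hr.1.le fun z hz => hb ⟨?_, ?_⟩
  · rw [Metric.mem_ball, Metric.mem_sphere.1 hz]
    exact hr.2
  · rintro rfl
    have := Metric.mem_sphere.1 hz
    rw [dist_self] at this
    exact hr.1.ne this

lemma residue_zero (c : ℂ) : residue (fun _ => 0) c = 0 := by
  unfold residue
  simp only [circleIntegral, smul_zero, intervalIntegral.integral_zero, mul_zero]
  exact tendsto_const_nhds.limUnder_eq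

/-- The residue at a pole of order at most two. -/
lemma residue_eq_deriv {f h : ℂ → ℂ} {c : ℂ} (hh : AnalyticAt ℂ h c)
    (hf : ∀ᶠ z in 𝓝[≠] c, (z - c) ^ 2 * f z = h z) : residue f c = deriv h c := by
  have h1 : ∀ᶠ z in 𝓝[≠] c, f z = (1 / (z - c) ^ 2) • h z := by
    filter_upwards [hf, self_mem_nhdsWithin] with z hz hzc
    have : z - c ≠ 0 := sub_ne_zero.2 hzc
    rw [← hz, smul_eq_mul]
    field_simp
  rw [residue_congr h1]
  obtain ⟨ρ, hρ, hb⟩ := Metric.eventually_nhds_iff_ball.1 hh.eventually_analyticAt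
  refine Tendsto.limUnder_eq (tendsto_const_nhds.congr' ?_)
  filter_upwards [Ioo_mem_nhdsGT hρ] with r hr
  rw [DifferentiableOn.deriv_eq_smul_circleIntegral hr.1 fun z hz =>
    (hb z (Metric.closedBall_subset_ball hr.2 hz)).differentiableAt.differentiableWithinAt,
    smul_eq_mul, inv_mul_cancel_left₀ Complex.two_pi_I_ne_zero]

/-- `F = h / ∏ s_i²` near the origin, with `h` analytic. -/
def HasDoublePoles {m : ℕ} (F h : (Fin m → ℂ) → ℂ) : Prop :=
  AnalyticAt ℂ h 0 ∧ ∀ᶠ s in 𝓝 (0 : Fin m → ℂ), (∀ i, s i ≠ 0) → (∏ i, s i ^ 2) * F s = h s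

lemma continuous_snoc (m : ℕ) :
    Continuous fun p : (Fin m → ℂ) × ℂ => (Fin.snoc p.1 p.2 : Fin (m + 1) → ℂ) := by
  refine continuous_pi fun i => ?_
  refine Fin.lastCases ?_ (fun j => ?_) i
  · simp only [Fin.snoc_last]
    fun_prop
  · simp only [Fin.snoc_castSucc]
    fun_prop

lemma snoc_zero (m : ℕ) : (Fin.snoc (0 : Fin m → ℂ) (0 : ℂ) : Fin (m + 1) → ℂ) = 0 := by
  ext i
  refine Fin.lastCases ?_ (fun j => ?_) i
  · simp
  · simp

lemma eventually_snoc {m : ℕ} {p : (Fin (m + 1) → ℂ) → Prop} (h : ∀ᶠ s in 𝓝 0, p s) :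
    ∀ᶠ s in 𝓝 (0 : Fin m → ℂ), ∀ᶠ z in 𝓝 (0 : ℂ), p (Fin.snoc s z) := by
  refine Eventually.curry_nhds (p := fun q : (Fin m → ℂ) × ℂ => p (Fin.snoc q.1 q.2)) ?_
  refine (continuous_snoc m).continuousAt.tendsto.eventually ?_
  rwa [snoc_zero]

lemma snoc_ne_zero {m : ℕ} {s : Fin m → ℂ} {z : ℂ} (hs : ∀ i, s i ≠ 0) (hz : z ≠ 0)
    (i : Fin (m + 1)) : (Fin.snoc s z : Fin (m + 1) → ℂ) i ≠ 0 := by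
  refine Fin.lastCases ?_ (fun j => ?_) i
  · rwa [Fin.snoc_last]
  · rw [Fin.snoc_castSucc]
    exact hs j

lemma hasDerivAt_snoc {m : ℕ} (s : Fin m → ℂ) (z : ℂ) :
    HasDerivAt (fun z => (Fin.snoc s z : Fin (m + 1) → ℂ)) (Pi.single (Fin.last m) 1) z := by
  refine hasDerivAt_pi.2 fun i => ?_
  refine Fin.lastCases ?_ (fun j => ?_) i
  · simpa using hasDerivAt_id' z
  · simpa [Fin.snoc_castSucc, Pi.single_eq_of_ne (Fin.castSucc_ne_last j)] using
      hasDerivAt_const z (s j)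

lemma deriv_snoc {m : ℕ} {h : (Fin (m + 1) → ℂ) → ℂ} {s : Fin m → ℂ}
    (hh : DifferentiableAt ℂ h (Fin.snoc s 0)) :
    deriv (fun z => h (Fin.snoc s z)) 0 = fderiv ℂ h (Fin.snoc s 0) (Pi.single (Fin.last m) 1) :=
  (hh.hasFDerivAt.comp_hasDerivAt 0 (hasDerivAt_snoc s 0)).deriv

/-- The residue in the last variable replaces the numerator by its derivative. -/
lemma HasDoublePoles.residue {m : ℕ} {F h : (Fin (m + 1) → ℂ) → ℂ} (H : HasDoublePoles F h) :
    HasDoublePoles (fun s => residue (fun z => F (Fin.snoc s z)) 0)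
      (fun s => fderiv ℂ h (Fin.snoc s 0) (Pi.single (Fin.last m) 1)) := by
  refine ⟨?_, ?_⟩
  · have h1 : AnalyticAt ℂ (fun s : Fin m → ℂ => (Fin.snoc s 0 : Fin (m + 1) → ℂ)) 0 := by
      refine AnalyticAt.pi fun i => ?_
      refine Fin.lastCases ?_ (fun j => ?_) i
      · simp only [Fin.snoc_last]
        exact analyticAt_const
      · simp only [Fin.snoc_castSucc]
        exact analyticAt_coord j 0
    have h2 : AnalyticAt ℂ (fun s : Fin m → ℂ => fderiv ℂ h (Fin.snoc s 0)) 0 :=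
      H.1.fderiv.comp_of_eq h1 (snoc_zero m)
    exact ((ContinuousLinearMap.apply ℂ ℂ (Pi.single (Fin.last m) 1)).analyticAt _).comp h2
  · filter_upwards [eventually_snoc H.2, eventually_snoc H.1.eventually_analyticAt]
      with s hs han hne
    have han0 : AnalyticAt ℂ h (Fin.snoc s 0) := han.self_of_nhds
    have hP : (∏ i, s i ^ 2) ≠ 0 := Finset.prod_ne_zero_iff.2 fun i _ => pow_ne_zero 2 (hne i)
    have hcomp : AnalyticAt ℂ (fun z => h (Fin.snoc s z)) 0 := by
      refine han0.comp_of_eq (AnalyticAt.pi fun i => ?_) rfl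
      refine Fin.lastCases ?_ (fun j => ?_) i
      · simp only [Fin.snoc_last]
        exact analyticAt_id
      · simp only [Fin.snoc_castSucc]
        exact analyticAt_const
    have := residue_eq_deriv (f := fun z => F (Fin.snoc s z))
      (h := fun z => (∏ i, s i ^ 2)⁻¹ * h (Fin.snoc s z)) (analyticAt_const.fun_mul hcomp) (by
        filter_upwards [nhdsWithin_le_nhds hs, self_mem_nhdsWithin] with z hz hz0
        have := hz fun i => snoc_ne_zero hne hz0 i
        rw [Fin.prod_univ_castSucc] at this
        simp only [Fin.snoc_castSucc, Fin.snoc_last] at this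
        rw [← this, sub_zero, mul_assoc, inv_mul_cancel_left₀ hP])
    rw [this, deriv_const_mul _ hcomp.differentiableAt, deriv_snoc han0.differentiableAt,
      mul_inv_cancel_left₀ hP]

lemma iteratedResidue_congr {m : ℕ} : ∀ {F G : (Fin m → ℂ) → ℂ},
    (∀ᶠ s in 𝓝 (0 : Fin m → ℂ), (∀ i, s i ≠ 0) → F s = G s) →
    iteratedResidue m F = iteratedResidue m G := by
  induction m with
  | zero =>
    intro F G h
    have := h.self_of_nhds fun i => i.elim0
    rw [iteratedResidue, iteratedResidue]
    convert! this
  | succ m ih =>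
    intro F G h
    refine ih ?_
    filter_upwards [eventually_snoc h] with s hs hne
    refine residue_congr ?_
    filter_upwards [nhdsWithin_le_nhds hs, self_mem_nhdsWithin] with z hz hz0
    exact hz fun i => snoc_ne_zero hne hz0 i

lemma iteratedResidue_zero (m : ℕ) : iteratedResidue m (fun _ => 0) = 0 := by
  induction m with
  | zero => rfl
  | succ m ih => simpa only [iteratedResidue, residue_zero] using ih

lemma HasDoublePoles.add {m : ℕ} {F G h k : (Fin m → ℂ) → ℂ} (HF : HasDoublePoles F h)
    (HG : HasDoublePoles G k) : HasDoublePoles (fun s => F s + G s) (fun s => h s + k s) := by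
  refine ⟨HF.1.fun_add HG.1, ?_⟩
  filter_upwards [HF.2, HG.2] with s h1 h2 hs
  rw [mul_add, h1 hs, h2 hs]

lemma iteratedResidue_add {m : ℕ} : ∀ {F G h k : (Fin m → ℂ) → ℂ}, HasDoublePoles F h →
    HasDoublePoles G k →
    iteratedResidue m (fun s => F s + G s) = iteratedResidue m F + iteratedResidue m G := by
  induction m with
  | zero => intros; rfl
  | succ m ih =>
    intro F G h k HF HG
    rw [iteratedResidue, iteratedResidue, iteratedResidue, ← ih HF.residue HG.residue]
    refine iteratedResidue_congr ?_
    filter_upwards [HF.residue.2, HG.residue.2, (HF.add HG).residue.2,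
      eventually_snoc HF.1.eventually_analyticAt, eventually_snoc HG.1.eventually_analyticAt]
      with s h1 h2 h3 h4 h5 hs
    have hP : (∏ i, s i ^ 2) ≠ 0 := Finset.prod_ne_zero_iff.2 fun i _ => pow_ne_zero 2 (hs i)
    refine mul_left_cancel₀ hP ?_
    rw [mul_add, h1 hs, h2 hs, h3 hs, fderiv_fun_add h4.self_of_nhds.differentiableAt
      h5.self_of_nhds.differentiableAt]
    rfl

/-- The iterated residue of a function without pole along one of the hyperplanes `s_j = 0`
vanishes: the absence of this pole persists when residues in other variables are taken. -/
lemma iteratedResidue_eq_zero {m : ℕ} : ∀ {F h : (Fin m → ℂ) → ℂ} (j : Fin m),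
    AnalyticAt ℂ h 0 → HasDoublePoles F (fun s => s j ^ 2 * h s) → iteratedResidue m F = 0 := by
  induction m with
  | zero => intro F h j; exact j.elim0
  | succ m ih =>
    intro F h j hh H
    have hev := eventually_snoc hh.eventually_analyticAt
    have hd : ∀ s : Fin m → ℂ, AnalyticAt ℂ h (Fin.snoc s 0) →
        fderiv ℂ (fun s : Fin (m + 1) → ℂ => s j ^ 2 * h s) (Fin.snoc s 0)
            (Pi.single (Fin.last m) 1)
          = (Fin.snoc s 0 : Fin (m + 1) → ℂ) j ^ 2
              * fderiv ℂ h (Fin.snoc s 0) (Pi.single (Fin.last m) 1)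
            + h (Fin.snoc s 0) * (2 * (Fin.snoc s 0 : Fin (m + 1) → ℂ) j
              * (Pi.single (Fin.last m) 1 : Fin (m + 1) → ℂ) j) := by
      intro s hs
      have h1 : HasFDerivAt (fun s : Fin (m + 1) → ℂ => s j)
          (ContinuousLinearMap.proj (R := ℂ) (φ := fun _ : Fin (m + 1) => ℂ) j) (Fin.snoc s 0) :=
        (ContinuousLinearMap.proj (R := ℂ) (φ := fun _ : Fin (m + 1) => ℂ) j).hasFDerivAt
      rw [((h1.pow 2).fun_mul hs.differentiableAt.hasFDerivAt).fderiv]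
      simp
    refine Fin.lastCases (fun H hd => ?_) (fun j' H hd => ?_) j H hd
    · rw [iteratedResidue]
      refine (iteratedResidue_congr ?_).trans (iteratedResidue_zero m)
      filter_upwards [H.residue.2, hev] with s h1 h2 hs
      have hP : (∏ i, s i ^ 2) ≠ 0 := Finset.prod_ne_zero_iff.2 fun i _ => pow_ne_zero 2 (hs i)
      refine mul_left_cancel₀ hP ?_
      rw [h1 hs, hd s h2.self_of_nhds]
      simp
    · rw [iteratedResidue]
      have hres := H.residue
      -- the numerator remains divisible by `s_j²`
      refine ih (h := fun s => fderiv ℂ h (Fin.snoc s 0) (Pi.single (Fin.last m) 1)) j'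
        (HasDoublePoles.residue (F := fun s => (∏ i, s i ^ 2)⁻¹ * h s) ⟨hh, ?_⟩).1 ⟨?_, ?_⟩
      · exact Eventually.of_forall fun s hs => mul_inv_cancel_left₀
          (Finset.prod_ne_zero_iff.2 fun i _ => pow_ne_zero 2 (hs i)) _
      · refine hres.1.congr ?_
        filter_upwards [hev] with s h2
        rw [hd s h2.self_of_nhds]
        simp
      · filter_upwards [hres.2, hev] with s h1 h2 hs
        rw [h1 hs, hd s h2.self_of_nhds]
        simp

lemma eventually_mem_regularSet (m : ℕ) :
    ∀ᶠ s in 𝓝 (0 : Fin m → ℂ), (∀ i, s i ≠ 0) → s ∈ regularSet m := by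
  filter_upwards [Metric.ball_mem_nhds (0 : Fin m → ℂ) two_pos] with s hs hne i k hk
  rw [mem_ball_zero_iff, pi_norm_lt_iff two_pos] at hs
  have h2 := hs i
  rw [hk, norm_mul, Complex.norm_ofNat, Complex.norm_intCast] at h2
  have hk0 : k = 0 := by
    have : |(k : ℝ)| < 1 := by linarith
    exact Int.abs_lt_one_iff.1 (by exact_mod_cast this)
  exact hne i (by rw [hk, hk0]; simp)

lemma iteratedResidue_congr_regularSet {m : ℕ} {F G : (Fin m → ℂ) → ℂ}
    (h : EqOn F G (regularSet m)) : iteratedResidue m F = iteratedResidue m G := by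
  refine iteratedResidue_congr ?_
  filter_upwards [eventually_mem_regularSet m] with s hs hne using h (hs hne)

open Classical in
/-- If `Z` has simple poles, then `∏_{i ∈ M} s_i⁻¹ Z(s)` has at most double poles along the
hyperplanes `s_i = 0` with `i ∈ M` and simple ones along the others. -/
lemma HasSimplePoles.exists_hasDoublePoles {m : ℕ} {Z : (Fin m → ℂ) → ℂ} (hZ : HasSimplePoles Z)
    (M : Finset (Fin m)) :
    ∃ h : (Fin m → ℂ) → ℂ, AnalyticAt ℂ h 0 ∧
      HasDoublePoles (fun s => (∏ i ∈ M, 1 / s i) * Z s) (fun s => (∏ i ∈ Mᶜ, s i) * h s) := by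
  obtain ⟨h, hh, hev⟩ := hZ 0
  refine ⟨h, hh, (Finset.analyticAt_fun_prod _ fun i _ => analyticAt_coord i 0).fun_mul hh, ?_⟩
  filter_upwards [hev, eventually_mem_regularSet m] with s h1 h2 hs
  rw [← h1 (h2 hs), Finset.filter_true_of_mem fun i _ => ⟨0, by simp⟩]
  have hM : (∏ i ∈ M, s i) * ∏ i ∈ M, 1 / s i = 1 := by
    rw [← Finset.prod_mul_distrib]
    exact Finset.prod_eq_one fun i _ => mul_one_div_cancel (hs i)
  have hsplit : ∏ i, s i = (∏ i ∈ M, s i) * ∏ i ∈ Mᶜ, s i := (Finset.prod_mul_prod_compl M s).symm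
  simp only [Pi.zero_apply, sub_zero, Finset.prod_pow]
  calc (∏ i, s i) ^ 2 * ((∏ i ∈ M, 1 / s i) * Z s)
      = (∏ i, s i) * (((∏ i ∈ M, s i) * ∏ i ∈ M, 1 / s i) * (∏ i ∈ Mᶜ, s i)) * Z s := by
        rw [sq]; nth_rewrite 1 [hsplit]; rw [hsplit]; ring
    _ = _ := by rw [hM]; ring

lemma iteratedResidue_simplePoles_add {m : ℕ} {Z Z' : (Fin m → ℂ) → ℂ} (hZ : HasSimplePoles Z)
    (hZ' : HasSimplePoles Z') (M : Finset (Fin m)) :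
    iteratedResidue m (fun s => (∏ i ∈ M, 1 / s i) * (Z s + Z' s))
      = iteratedResidue m (fun s => (∏ i ∈ M, 1 / s i) * Z s)
        + iteratedResidue m (fun s => (∏ i ∈ M, 1 / s i) * Z' s) := by
  obtain ⟨h, -, H⟩ := hZ.exists_hasDoublePoles M
  obtain ⟨h', -, H'⟩ := hZ'.exists_hasDoublePoles M
  rw [← iteratedResidue_add H H']
  simp only [mul_add]

lemma iteratedResidue_coord_mul {m : ℕ} {Z : (Fin m → ℂ) → ℂ} (hZ : HasSimplePoles Z)
    {M : Finset (Fin m)} {j : Fin m} (hj : j ∉ M) :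
    iteratedResidue m (fun s => (∏ i ∈ M, 1 / s i) * (s j * Z s)) = 0 := by
  obtain ⟨h, hh, H⟩ := hZ.exists_hasDoublePoles M
  have hj' : j ∈ Mᶜ := Finset.mem_compl.2 hj
  refine iteratedResidue_eq_zero (h := fun s => (∏ i ∈ Mᶜ.erase j, s i) * h s) j
    ((Finset.analyticAt_fun_prod _ fun i _ => analyticAt_coord i 0).fun_mul hh) ⟨?_, ?_⟩
  · exact ((analyticAt_coord j 0).fun_pow 2).fun_mul
      ((Finset.analyticAt_fun_prod _ fun i _ => analyticAt_coord i 0).fun_mul hh)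
  · filter_upwards [H.2] with s h1 hs
    have := h1 hs
    rw [← Finset.mul_prod_erase _ _ hj'] at this
    linear_combination s j * this

lemma iteratedResidue_coord_mul_of_mem {m : ℕ} (Z : (Fin m → ℂ) → ℂ)
    {M : Finset (Fin m)} {j : Fin m} (hj : j ∈ M) :
    iteratedResidue m (fun s => (∏ i ∈ M, 1 / s i) * (s j * Z s))
      = iteratedResidue m (fun s => (∏ i ∈ M.erase j, 1 / s i) * Z s) := by
  refine iteratedResidue_congr (Eventually.of_forall fun s hs => ?_)
  rw [← Finset.mul_prod_erase _ _ hj]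
  have := hs j
  field_simp

/-! ### Local zeta integrals on `ℂ ^ d` -/

/-- For `Re c > 1` the power rule holds at the origin as well. -/
lemma hasDerivAt_ofReal_cpow {c : ℂ} (hc : 1 < c.re) (x : ℝ) :
    HasDerivAt (fun x : ℝ => (x : ℂ) ^ c) (c * (x : ℂ) ^ (c - 1)) x := by
  have hc0 : c ≠ 0 := by
    rintro rfl
    simp at hc
    linarith
  rcases eq_or_ne x 0 with rfl | hx
  · refine hasDerivAt_of_hasDerivAt_of_ne (g := fun x : ℝ => c * (x : ℂ) ^ (c - 1))
      (fun y hy => hasDerivAt_ofReal_cpow_const hy hc0) ?_ ?_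
    · exact (Complex.continuous_ofReal_cpow_const (by linarith)).continuousAt
    · exact (continuous_const.mul
        (Complex.continuous_ofReal_cpow_const (by simp; linarith))).continuousAt
  · exact hasDerivAt_ofReal_cpow_const hx hc0

lemma contDiff_ofReal_cpow {c : ℂ} (hc : 1 < c.re) :
    ContDiff ℝ 1 fun x : ℝ => (x : ℂ) ^ c := by
  refine contDiff_one_iff_deriv.2
    ⟨fun x => (hasDerivAt_ofReal_cpow hc x).differentiableAt, ?_⟩
  rw [funext fun x => (hasDerivAt_ofReal_cpow hc x).deriv]
  exact continuous_const.mul (Complex.continuous_ofReal_cpow_const (by simp; linarith))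

/-- The function `ζ ^ n |ζ| ^ (2 c)` on the complex plane. -/
def powNormSq (n : ℕ) (c ζ : ℂ) : ℂ := ζ ^ n * (Complex.normSq ζ : ℂ) ^ c

lemma hasFDerivAt_normSq (ζ : ℂ) :
    HasFDerivAt Complex.normSq
      ((2 * ζ.re) • Complex.reCLM + (2 * ζ.im) • Complex.imCLM : ℂ →L[ℝ] ℝ) ζ := by
  have h := (Complex.reCLM.hasFDerivAt (x := ζ)).fun_mul
    (Complex.reCLM.hasFDerivAt (x := ζ)) |>.fun_add
    ((Complex.imCLM.hasFDerivAt (x := ζ)).fun_mul (Complex.imCLM.hasFDerivAt (x := ζ)))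
  convert! h using 1
  ext
  simp
  ring

lemma contDiff_normSq {n : WithTop ℕ∞} : ContDiff ℝ n Complex.normSq := by
  have h : (Complex.normSq : ℂ → ℝ) = fun ζ => Complex.reCLM ζ * Complex.reCLM ζ
      + Complex.imCLM ζ * Complex.imCLM ζ := rfl
  rw [h]
  fun_prop

lemma contDiff_powNormSq (n : ℕ) {c : ℂ} (hc : 1 < c.re) : ContDiff ℝ 1 (powNormSq n c) :=
  (contDiff_id.pow n).mul ((contDiff_ofReal_cpow hc).comp contDiff_normSq)

/-- The Wirtinger derivative `∂/∂z_j`. -/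
def wirtinger {d : ℕ} (j : Fin d) (f : (Fin d → ℂ) → ℂ) (z : Fin d → ℂ) : ℂ :=
  (fderiv ℝ f z (Pi.single j 1) - Complex.I * fderiv ℝ f z (Pi.single j Complex.I)) / 2

/-- In one variable, `∂/∂ζ (ζ ^ (n + 1) |ζ| ^ (2 c)) = (n + 1 + c) ζ ^ n |ζ| ^ (2 c)`. -/
lemma fderiv_powNormSq (n : ℕ) {c : ℂ} (hc : 1 < c.re) (ζ : ℂ) :
    (fderiv ℝ (powNormSq (n + 1) c) ζ 1
        - Complex.I * fderiv ℝ (powNormSq (n + 1) c) ζ Complex.I) / 2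
      = (n + 1 + c) * powNormSq n c ζ := by
  have hc1 : c - 1 ≠ 0 := by
    intro h
    rw [sub_eq_zero] at h
    rw [h] at hc
    simp at hc
  have hc0 : c ≠ 0 := by
    rintro rfl
    simp at hc
    linarith
  have h1 : HasFDerivAt (fun ζ : ℂ => ζ ^ (n + 1))
      ((((n + 1 : ℕ) : ℂ) * ζ ^ n) • (ContinuousLinearMap.id ℝ ℂ)) ζ := by
    have := ((hasDerivAt_pow (n + 1) ζ).hasFDerivAt).restrictScalars ℝ
    convert! this using 1
    ext
    simp
    ring
  have h2 := (hasDerivAt_ofReal_cpow hc (Complex.normSq ζ)).hasFDerivAt.comp ζ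
    (hasFDerivAt_normSq ζ)
  have h3 := (h1.fun_mul h2).fderiv
  have h4 : fderiv ℝ (powNormSq (n + 1) c) ζ = _ := h3
  rw [h4]
  simp only [Function.comp_apply, powNormSq]
  simp
  have h5 : (Complex.normSq ζ : ℂ) ^ (c - 1) * (Complex.normSq ζ : ℂ)
      = (Complex.normSq ζ : ℂ) ^ c := by
    rcases eq_or_ne ζ 0 with rfl | hζ
    · simp [hc0]
    · have : (Complex.normSq ζ : ℂ) ≠ 0 := by simpa using hζ
      rw [Complex.cpow_sub _ _ this, Complex.cpow_one, div_mul_cancel₀ _ this]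
  rw [← h5]
  have h6 : (Complex.normSq ζ : ℂ) = ζ * (ζ.re - ζ.im * Complex.I) := by
    rw [Complex.normSq_eq_conj_mul_self, mul_comm]
    congr 1
    apply Complex.ext <;> simp
  generalize (Complex.normSq ζ : ℂ) ^ (c - 1) = A at *
  rw [h6]
  have hI : Complex.I ^ 2 = -1 := Complex.I_sq
  have hre : (ζ.re : ℂ) + ζ.im * Complex.I = ζ := Complex.re_add_im ζ
  linear_combination
    (-(((n : ℂ) + 1) * ζ ^ n * A * (ζ * (ζ.re - ζ.im * Complex.I))) / 2) * hI

/-- The function `∏ z_{k i} ^ κ_i |z_{k i}| ^ s_i`, which represents `∏ μ_i ^ (s_i / 2)`, up to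
positive smooth factors, near a point through which the hypersurfaces with indices in `S` pass. -/
def weight {d m : ℕ} {S : Finset (Fin m)} (k : S ↪ Fin d) (κ : S → ℕ) (s : Fin m → ℂ)
    (z : Fin d → ℂ) : ℂ :=
  ∏ i : S, powNormSq (κ i) (s i / 2) (z (k i))

section weight

variable {d m : ℕ} {S : Finset (Fin m)} {k : S ↪ Fin d}

lemma one_lt_half_re {c : ℂ} (hc : 2 < c.re) : 1 < (c / 2).re := by
  have : (c / 2).re = c.re / 2 := by
    rw [show (2 : ℂ) = ((2 : ℝ) : ℂ) by simp, Complex.div_ofReal_re]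
  rw [this]
  linarith

lemma contDiff_weight (κ : S → ℕ) {s : Fin m → ℂ} (hs : ∀ i, 2 < (s i).re) :
    ContDiff ℝ 1 (weight k κ s) := by
  refine contDiff_prod fun i _ => ?_
  exact (contDiff_powNormSq _ (one_lt_half_re (hs i))).comp (contDiff_apply ℝ ℂ (k i))

open Classical in
/-- The exponent `κ_j` is lowered by differentiation. The bound on `Re s_i` ensures that the weight
is continuously differentiable on the coordinate hyperplanes. -/
lemma wirtinger_weight (κ : S → ℕ) {s : Fin m → ℂ} (hs : ∀ i, 2 < (s i).re) (j : S)
    (z : Fin d → ℂ) :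
    wirtinger (k j) (weight k (Function.update κ j (κ j + 1)) s) z
      = (κ j + 1 + s j / 2) * weight k κ s z := by
  set κ' := Function.update κ j (κ j + 1) with hκ'
  have hf : ∀ i : S, HasFDerivAt (fun z : Fin d → ℂ => powNormSq (κ' i) (s i / 2) (z (k i)))
      ((fderiv ℝ (powNormSq (κ' i) (s i / 2)) (z (k i))).comp
        (ContinuousLinearMap.proj (R := ℝ) (φ := fun _ : Fin d => ℂ) (k i))) z := fun i =>
    HasFDerivAt.comp z (((contDiff_powNormSq _ (one_lt_half_re (hs i))).differentiable
      one_ne_zero _).hasFDerivAt)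
      (ContinuousLinearMap.proj (R := ℝ) (φ := fun _ : Fin d => ℂ) (k i)).hasFDerivAt
  have hfd : ∀ v : ℂ, fderiv ℝ (weight k κ' s) z (Pi.single (k j) v)
      = (∏ i ∈ Finset.univ.erase j, powNormSq (κ' i) (s i / 2) (z (k i)))
        * fderiv ℝ (powNormSq (κ j + 1) (s j / 2)) (z (k j)) v := by
    intro v
    have h := (HasFDerivAt.finsetProd (u := Finset.univ) fun i _ => hf i).fderiv
    have h' : fderiv ℝ (weight k κ' s) z = _ := h
    rw [h', _root_.sum_apply, Finset.sum_eq_single j]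
    · simp [hκ']
    · intro i _ hij
      have : (Pi.single (k j) v : Fin d → ℂ) (k i) = 0 := by
        rw [Pi.single_apply, if_neg fun h => hij (k.injective h)]
      simp [this]
    · simp
  rw [wirtinger, hfd, hfd, weight, ← Finset.mul_prod_erase _ _ (Finset.mem_univ j)]
  have h1 := fderiv_powNormSq (κ j) (one_lt_half_re (hs j)) (z (k j))
  have h2 : ∏ i ∈ Finset.univ.erase j, powNormSq (κ' i) (s i / 2) (z (k i))
      = ∏ i ∈ Finset.univ.erase j, powNormSq (κ i) (s i / 2) (z (k i)) :=
    Finset.prod_congr rfl fun i hi => by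
      rw [hκ', Function.update_of_ne (Finset.ne_of_mem_erase hi)]
  rw [h2]
  linear_combination (∏ i ∈ Finset.univ.erase j, powNormSq (κ i) (s i / 2) (z (k i))) * h1

end weight

/-- Integration by parts for the Wirtinger derivative. -/
lemma integral_mul_wirtinger {d : ℕ} (j : Fin d) {f g : (Fin d → ℂ) → ℂ} (hf : ContDiff ℝ 1 f)
    (hg : ContDiff ℝ 1 g) (hgc : HasCompactSupport g) :
    ∫ z, f z * wirtinger j g z = -∫ z, wirtinger j f z * g z := by
  have hf' : ∀ v, Continuous fun z => fderiv ℝ f z v := fun v =>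
    (hf.continuous_fderiv one_ne_zero).clm_apply continuous_const
  have hg' : ∀ v, Continuous fun z => fderiv ℝ g z v := fun v =>
    (hg.continuous_fderiv one_ne_zero).clm_apply continuous_const
  have hgc' : ∀ v, HasCompactSupport fun z => fderiv ℝ g z v := fun v =>
    hgc.fderiv_apply (𝕜 := ℝ) v
  have h1 : ∀ v, Integrable fun z => fderiv ℝ f z v * g z := fun v =>
    ((hf' v).mul hg.continuous).integrable_of_hasCompactSupport hgc.mul_left
  have h2 : ∀ v, Integrable fun z => f z * fderiv ℝ g z v := fun v =>
    (hf.continuous.mul (hg' v)).integrable_of_hasCompactSupport (hgc' v).mul_left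
  have h3 : Integrable fun z => f z * g z :=
    (hf.continuous.mul hg.continuous).integrable_of_hasCompactSupport hgc.mul_left
  have h4 : ∀ v, ∫ z, f z * fderiv ℝ g z v = -∫ z, fderiv ℝ f z v * g z := fun v =>
    integral_mul_fderiv_eq_neg_fderiv_mul_of_integrable (h1 v) (h2 v) h3
      (fun z _ => hf.differentiable one_ne_zero z) fun z _ => hg.differentiable one_ne_zero z
  have e1 : ∀ z, f z * wirtinger j g z = (1 / 2) * (f z * fderiv ℝ g z (Pi.single j 1))
      - (Complex.I / 2) * (f z * fderiv ℝ g z (Pi.single j Complex.I)) := fun z => by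
    rw [wirtinger]; ring
  have e2 : ∀ z, wirtinger j f z * g z = (1 / 2) * (fderiv ℝ f z (Pi.single j 1) * g z)
      - (Complex.I / 2) * (fderiv ℝ f z (Pi.single j Complex.I) * g z) := fun z => by
    rw [wirtinger]; ring
  simp_rw [e1, e2]
  rw [integral_sub ((h2 _).const_mul _) ((h2 _).const_mul _),
    integral_sub ((h1 _).const_mul _) ((h1 _).const_mul _)]
  simp_rw [integral_const_mul]
  rw [h4, h4]
  ring

/-- Families of smooth functions on `ℂ ^ d`, supported in a fixed compact set and depending
holomorphically on parameters `s ∈ ℂ ^ m`. -/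
structure IsHolFamily {d m : ℕ} (G : (Fin m → ℂ) → (Fin d → ℂ) → ℂ) : Prop where
  smooth : ContDiff ℝ ∞ fun p : (Fin m → ℂ) × (Fin d → ℂ) => G p.1 p.2
  hol : ∀ z, Differentiable ℂ fun s => G s z
  supp : ∃ K : Set (Fin d → ℂ), IsCompact K ∧ ∀ z ∉ K, ∀ s, G s z = 0

namespace IsHolFamily

variable {d m : ℕ} {G : (Fin m → ℂ) → (Fin d → ℂ) → ℂ}

lemma contDiff (hG : IsHolFamily G) (s : Fin m → ℂ) : ContDiff ℝ ∞ (G s) :=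
  hG.smooth.comp (contDiff_const.prodMk contDiff_id)

lemma hasCompactSupport (hG : IsHolFamily G) (s : Fin m → ℂ) : HasCompactSupport (G s) := by
  obtain ⟨K, hK, hz⟩ := hG.supp
  exact HasCompactSupport.intro hK fun z h => hz z h s

/-- Derivatives in the space variables of a holomorphic family are holomorphic in the parameters,
by the symmetry of second derivatives. -/
lemma differentiable_fderiv (hG : IsHolFamily G) (z v : Fin d → ℂ) :
    Differentiable ℂ fun s => fderiv ℝ (G s) z v := by
  intro s
  set g : (Fin m → ℂ) × (Fin d → ℂ) → ℂ := fun p => G p.1 p.2 with hg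
  have hgs : ContDiff ℝ ∞ g := hG.smooth
  have hgd : Differentiable ℝ g := hgs.differentiable (by simp)
  have hg1 : ∀ s z v, fderiv ℝ (G s) z v = fderiv ℝ g (s, z) (0, v) := by
    intro s z v
    have h1 : HasFDerivAt (fun z => ((s, z) : (Fin m → ℂ) × (Fin d → ℂ)))
        (ContinuousLinearMap.inr ℝ (Fin m → ℂ) (Fin d → ℂ)) z := hasFDerivAt_prodMk_right s z
    have h2 : HasFDerivAt (G s) _ z := (hgd (s, z)).hasFDerivAt.comp z h1
    rw [h2.fderiv]
    simp
  have hg2 : ∀ s z w, fderiv ℝ g (s, z) (Complex.I • w, 0)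
      = Complex.I * fderiv ℝ g (s, z) (w, 0) := by
    intro s z w
    have h1 : HasFDerivAt (fun s => ((s, z) : (Fin m → ℂ) × (Fin d → ℂ)))
        (ContinuousLinearMap.inl ℝ (Fin m → ℂ) (Fin d → ℂ)) s := hasFDerivAt_prodMk_left s z
    have h2 : HasFDerivAt (g ∘ fun s => (s, z)) _ s := (hgd (s, z)).hasFDerivAt.comp s h1
    have h3 : HasFDerivAt (g ∘ fun s => (s, z)) _ s := (hG.hol z s).hasFDerivAt.restrictScalars ℝ
    have h4 := h2.unique h3
    have h5 : ∀ w, fderiv ℝ g (s, z) (w, 0) = fderiv ℂ (fun s => G s z) s w := fun w => by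
      have := DFunLike.congr_fun h4 w
      simpa using this
    rw [h5, h5, map_smul, smul_eq_mul]
  have hgf : ContDiff ℝ ∞ (fderiv ℝ g) := hgs.fderiv_right (by simp)
  have hgfd : Differentiable ℝ (fderiv ℝ g) := hgf.differentiable (by simp)
  have hsymm : IsSymmSndFDerivAt ℝ g (s, z) :=
    hgs.contDiffAt.isSymmSndFDerivAt (by
      simp only [minSmoothness_of_isRCLikeNormedField]
      exact WithTop.coe_le_coe.2 (le_top : (2 : ℕ∞) ≤ ⊤))
  -- the derivative of `fderiv ℝ g` in a direction `(0, v)`, evaluated at a fixed vector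
  have hdir : ∀ u, fderiv ℝ (fderiv ℝ g) (s, z) (0, v) u
      = deriv (fun t : ℝ => fderiv ℝ g (s, z + t • v) u) 0 := by
    intro u
    have h1 : HasDerivAt (fun t : ℝ => ((s, z + t • v) : (Fin m → ℂ) × (Fin d → ℂ))) (0, v) 0 := by
      refine HasDerivAt.prodMk (hasDerivAt_const _ _) ?_
      simpa using ((hasDerivAt_id' (0 : ℝ)).smul_const v).const_add z
    have h2 : HasDerivAt (fun t : ℝ => fderiv ℝ g (s, z + t • v))
        (fderiv ℝ (fderiv ℝ g) (s, z) (0, v)) 0 :=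
      (hgfd (s, z)).hasFDerivAt.comp_hasDerivAt_of_eq 0 h1 (by rw [zero_smul, add_zero])
    have h3 : HasDerivAt (fun t : ℝ => fderiv ℝ g (s, z + t • v) u)
        (fderiv ℝ (fderiv ℝ g) (s, z) (0, v) u) 0 := by
      have := h2.clm_apply (hasDerivAt_const (0 : ℝ) u)
      rwa [map_zero, add_zero] at this
    exact h3.deriv.symm
  have hlin : ∀ w, fderiv ℝ (fderiv ℝ g) (s, z) (Complex.I • w, 0) (0, v)
      = Complex.I * fderiv ℝ (fderiv ℝ g) (s, z) (w, 0) (0, v) := by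
    intro w
    rw [hsymm, hdir, hsymm, hdir]
    simp_rw [hg2]
    have hd : DifferentiableAt ℝ (fun t : ℝ => fderiv ℝ g (s, z + t • v) (w, 0)) 0 := by
      have : Differentiable ℝ fun t : ℝ => ((s, z + t • v) : (Fin m → ℂ) × (Fin d → ℂ)) := by
        fun_prop
      exact ((hgfd.comp this).clm_apply (differentiable_const _)) 0
    rw [deriv_const_mul _ hd]
  have hfun : (fun s => fderiv ℝ (G s) z v) = fun s => fderiv ℝ g (s, z) (0, v) :=
    funext fun s => hg1 s z v
  have h1 : HasFDerivAt (fun s => ((s, z) : (Fin m → ℂ) × (Fin d → ℂ)))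
      (ContinuousLinearMap.inl ℝ (Fin m → ℂ) (Fin d → ℂ)) s := hasFDerivAt_prodMk_left s z
  have h2 := ((hgfd (s, z)).hasFDerivAt.comp s h1).clm_apply
    (hasFDerivAt_const ((0, v) : (Fin m → ℂ) × (Fin d → ℂ)) s)
  rw [hfun]
  refine (differentiableAt_iff_restrictScalars ℝ h2.differentiableAt).2 ?_
  have h3 : ∀ w, fderiv ℝ (fun s => fderiv ℝ g (s, z) (0, v)) s w
      = fderiv ℝ (fderiv ℝ g) (s, z) (w, 0) (0, v) := by
    intro w
    have h4 : HasFDerivAt (fun s => fderiv ℝ g (s, z) (0, v)) _ s := h2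
    rw [h4.fderiv]
    simp
  refine ⟨{ toFun := fderiv ℝ (fun s => fderiv ℝ g (s, z) (0, v)) s
            map_add' := map_add _
            map_smul' := fun c w => ?_
            cont := (fderiv ℝ (fun s => fderiv ℝ g (s, z) (0, v)) s).continuous }, rfl⟩
  have hc : c • w = c.re • w + c.im • (Complex.I • w) := by
    ext i
    simp only [Pi.add_apply, Pi.smul_apply, smul_eq_mul, Complex.real_smul]
    nth_rewrite 1 [← Complex.re_add_im c]
    ring
  simp only [RingHom.id_apply, smul_eq_mul]
  nth_rewrite 1 [hc]
  rw [map_add, map_smul, map_smul, h3 (Complex.I • w), hlin, ← h3]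
  nth_rewrite 3 [← Complex.re_add_im c]
  simp only [Complex.real_smul]
  ring

protected lemma wirtinger (hG : IsHolFamily G) (j : Fin d) :
    IsHolFamily fun s => wirtinger j (G s) := by
  refine ⟨?_, fun z => ?_, ?_⟩
  · have h : ∀ v : Fin d → ℂ, ContDiff ℝ ∞ fun p : (Fin m → ℂ) × (Fin d → ℂ) =>
        fderiv ℝ (G p.1) p.2 v := fun v => by
      refine ContDiff.fderiv_apply (f := fun p : (Fin m → ℂ) × (Fin d → ℂ) => G p.1) (m := ∞)
        ?_ contDiff_snd contDiff_const (by simp)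
      exact hG.smooth.comp ((contDiff_fst.comp contDiff_fst).prodMk contDiff_snd)
    exact ((h _).sub (contDiff_const.mul (h _))).div_const 2
  · have h1 := hG.differentiable_fderiv z (Pi.single j 1)
    have h2 := hG.differentiable_fderiv z (Pi.single j Complex.I)
    unfold NormalCrossing.wirtinger
    fun_prop
  · obtain ⟨K, hK, hz⟩ := hG.supp
    refine ⟨K, hK, fun z h s => ?_⟩
    have : fderiv ℝ (G s) z = 0 := by
      have hev : G s =ᶠ[𝓝 z] fun _ => 0 := by
        filter_upwards [hK.isClosed.isOpen_compl.mem_nhds h] with w hw using hz w hw s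
      rw [hev.fderiv_eq]
      simp
    simp [wirtinger, this]

end IsHolFamily

/-- The function `∏ (1 + |z_j|⁻¹)` on a polydisc, zero elsewhere. It is integrable and dominates
the integrands of local zeta integrals. -/
def polydiscBound (d : ℕ) (ρ : ℝ) (z : Fin d → ℂ) : ℝ :=
  ∏ j, (Metric.ball (0 : ℂ) ρ).indicator (fun ζ => 1 + ‖ζ‖⁻¹) (z j)

lemma integrable_polydiscBound (d : ℕ) (ρ : ℝ) : Integrable (polydiscBound d ρ) := by
  refine Integrable.fintype_prod (f := fun _ => (Metric.ball (0 : ℂ) ρ).indicator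
    fun ζ => 1 + ‖ζ‖⁻¹) fun _ => ?_
  rw [integrable_indicator_iff Metric.isOpen_ball.measurableSet]
  refine Integrable.add ?_ ?_
  · exact integrableOn_const (by finiteness)
  · refine integrableOn_ball_of_norm_le_rpow (C := 1) (α := 1) (by simp) (by simp)
      (Eventually.of_forall fun ζ => ?_) (by fun_prop)
    simp [Real.rpow_neg_one]

lemma aestronglyMeasurable_weight {d m : ℕ} {S : Finset (Fin m)} (k : S ↪ Fin d) (κ : S → ℕ)
    (s : Fin m → ℂ) : AEStronglyMeasurable (weight k κ s) := by
  refine Measurable.aestronglyMeasurable ?_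
  refine Finset.measurable_prod _ fun i _ => ?_
  have h : Measurable fun z : Fin d → ℂ => z (k i) := measurable_pi_apply _
  refine (h.pow_const _).mul (Measurable.pow_const ?_ _)
  exact Complex.measurable_ofReal.comp (Complex.continuous_normSq.measurable.comp h)

/-- The exponent of `|ζ|` is at least `-1`, which keeps the singularity at the origin integrable. -/
lemma norm_powNormSq_le {n : ℕ} {s ζ : ℂ} {ρ L : ℝ} (hρ : 1 ≤ ρ) (hζρ : ‖ζ‖ ≤ ρ) (hζ : ζ ≠ 0)
    (hs : -(n : ℝ) - 1 ≤ s.re) (hL : n + s.re ≤ L) :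
    ‖powNormSq n (s / 2) ζ‖ ≤ ρ ^ (L + 1) * (1 + ‖ζ‖⁻¹) := by
  have h0 : 0 < ‖ζ‖ := norm_pos_iff.2 hζ
  have hre : (s / 2).re = s.re / 2 := by
    rw [show (2 : ℂ) = ((2 : ℝ) : ℂ) by simp, Complex.div_ofReal_re]
  have h1 : ‖powNormSq n (s / 2) ζ‖ = ‖ζ‖ ^ (n + s.re + 1) * ‖ζ‖⁻¹ := by
    rw [powNormSq, norm_mul, norm_pow, Complex.norm_cpow_eq_rpow_re_of_pos
      (Complex.normSq_pos.2 hζ), Complex.normSq_eq_norm_sq, hre, ← Real.rpow_natCast ‖ζ‖ 2,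
      ← Real.rpow_mul h0.le, ← Real.rpow_natCast, ← Real.rpow_add h0, ← Real.rpow_neg_one,
      ← Real.rpow_add h0]
    congr 1
    push_cast
    ring
  rw [h1]
  have h2 : ‖ζ‖ ^ (n + s.re + 1) ≤ ρ ^ (L + 1) :=
    (Real.rpow_le_rpow h0.le hζρ (by linarith)).trans
      (Real.rpow_le_rpow_of_exponent_le hρ (by linarith))
  have h3 : 0 ≤ ‖ζ‖⁻¹ := by positivity
  gcongr
  linarith

lemma norm_weight_le {d m : ℕ} {S : Finset (Fin m)} (k : S ↪ Fin d) {κ : S → ℕ}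
    {s : Fin m → ℂ} {z : Fin d → ℂ} {ρ L : ℝ} (hρ : 1 ≤ ρ) (hz : z ∈ Metric.ball 0 ρ)
    (hz0 : ∀ j, z j ≠ 0) (hs : ∀ i : S, -(κ i : ℝ) - 1 ≤ (s i).re)
    (hL : ∀ i : S, κ i + (s i).re ≤ L) :
    ‖weight k κ s z‖ ≤ (ρ ^ (L + 1)) ^ S.card * polydiscBound d ρ z := by
  have hzj : ∀ j, z j ∈ Metric.ball (0 : ℂ) ρ := fun j => by
    rw [mem_ball_zero_iff, pi_norm_lt_iff (by linarith)] at hz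
    exact mem_ball_zero_iff.2 (hz j)
  have h1 : ‖weight k κ s z‖ ≤ ∏ i : S, (ρ ^ (L + 1) * (1 + ‖z (k i)‖⁻¹)) := by
    rw [weight, norm_prod]
    exact Finset.prod_le_prod (fun _ _ => norm_nonneg _) fun i _ =>
      norm_powNormSq_le hρ (mem_ball_zero_iff.1 (hzj _)).le (hz0 _) (hs i) (hL i)
  refine h1.trans ?_
  rw [Finset.prod_mul_distrib, Finset.prod_const, Finset.card_univ, Fintype.card_coe]
  have h2 : 0 ≤ ρ ^ (L + 1) := by positivity
  gcongr
  have h3 : polydiscBound d ρ z = ∏ j, (1 + ‖z j‖⁻¹) :=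
    Finset.prod_congr rfl fun j _ => indicator_of_mem (hzj j) _
  rw [h3, ← Finset.prod_map Finset.univ k fun j => 1 + ‖z j‖⁻¹]
  have h4 : ∀ j, 0 ≤ ‖z j‖⁻¹ := fun j => by positivity
  exact Finset.prod_le_prod_of_subset_of_one_le (Finset.subset_univ _)
    (fun j _ => by linarith [h4 j]) fun j _ _ => by linarith [h4 j]

namespace IsHolFamily

variable {d m : ℕ} {G : (Fin m → ℂ) → (Fin d → ℂ) → ℂ} {S : Finset (Fin m)}

/-- Local integrable domination of the integrands of a local zeta integral. -/
lemma exists_bound (hG : IsHolFamily G) (k : S ↪ Fin d) (κ : S → ℕ) {a : Fin m → ℂ}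
    (ha : ∀ i : S, -(κ i : ℝ) - 1 < (a i).re) :
    ∃ r > 0, ∃ B : (Fin d → ℂ) → ℝ, Integrable B ∧
      ∀ᵐ z, ∀ s ∈ Metric.ball a r, ‖weight k κ s z * G s z‖ ≤ B z := by
  have hopen : IsOpen {s : Fin m → ℂ | ∀ i : S, -(κ i : ℝ) - 1 < (s i).re} := by
    simp only [ofPred_forall]
    exact isOpen_iInter_of_finite fun i =>
      isOpen_lt continuous_const (Complex.continuous_re.comp (continuous_apply _))
  obtain ⟨r, hr, hball⟩ := Metric.isOpen_iff.1 hopen a ha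
  obtain ⟨K, hK, hKz⟩ := hG.supp
  obtain ⟨ρ, hρ, hKρ⟩ := hK.isBounded.subset_ball_lt 1 0
  obtain ⟨C, hC⟩ := ((isCompact_closedBall a r).prod hK).exists_bound_of_continuousOn
    hG.smooth.continuous.continuousOn
  obtain ⟨L, hL⟩ := (Set.finite_range fun i : S => (κ i : ℝ) + (a i).re + r).bddAbove
  refine ⟨r, hr, fun z => (ρ ^ (L + 1)) ^ S.card * polydiscBound d ρ z * max C 0,
    ((integrable_polydiscBound d ρ).const_mul _).mul_const _, ?_⟩
  have hae : ∀ᵐ z : Fin d → ℂ, ∀ j, z j ≠ 0 :=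
    ae_all_iff.2 fun j => Measure.ae_eval_ne (fun _ => volume) j 0
  filter_upwards [hae] with z hz0 s hs
  have hpb : 0 ≤ polydiscBound d ρ z := Finset.prod_nonneg fun j _ =>
    indicator_nonneg (fun ζ _ => by positivity) _
  by_cases hz : z ∈ K
  · rw [norm_mul]
    refine mul_le_mul (norm_weight_le k hρ.le (hKρ hz) hz0 (fun i => (hball hs i).le) fun i => ?_)
      ((hC (s, z) ⟨Metric.ball_subset_closedBall hs, hz⟩).trans (le_max_left _ _)) (norm_nonneg _)
      (by positivity)
    have h1 := hL (mem_range_self i)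
    have h2 : (s i - a i).re ≤ r := (Complex.re_le_norm _).trans
      ((norm_le_pi_norm (s - a) i).trans (mem_ball_iff_norm.1 hs).le)
    rw [Complex.sub_re] at h2
    linarith
  · rw [hKz z hz s, mul_zero, norm_zero]
    positivity

lemma aestronglyMeasurable (hG : IsHolFamily G) (k : S ↪ Fin d) (κ : S → ℕ) (s : Fin m → ℂ) :
    AEStronglyMeasurable (fun z => weight k κ s z * G s z) :=
  (aestronglyMeasurable_weight k κ s).mul (hG.contDiff s).continuous.aestronglyMeasurable

lemma integrable (hG : IsHolFamily G) (k : S ↪ Fin d) (κ : S → ℕ) {s : Fin m → ℂ}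
    (hs : ∀ i : S, -(κ i : ℝ) - 1 < (s i).re) : Integrable fun z => weight k κ s z * G s z := by
  obtain ⟨r, hr, B, hB, hbd⟩ := hG.exists_bound k κ hs
  refine hB.mono' (hG.aestronglyMeasurable k κ s) ?_
  filter_upwards [hbd] with z hz using hz s (Metric.mem_ball_self hr)

lemma analyticAt_integral (hG : IsHolFamily G) (k : S ↪ Fin d) (κ : S → ℕ) {a : Fin m → ℂ}
    (ha : ∀ i : S, -(κ i : ℝ) - 1 < (a i).re) :
    AnalyticAt ℂ (fun s => ∫ z, weight k κ s z * G s z) a := by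
  obtain ⟨r, hr, B, hB, hbd⟩ := hG.exists_bound k κ ha
  refine NormalCrossing.analyticAt_integral hr (fun s _ => hG.aestronglyMeasurable k κ s) hB hbd ?_
  have hae : ∀ᵐ z : Fin d → ℂ, ∀ j, z j ≠ 0 :=
    ae_all_iff.2 fun j => Measure.ae_eval_ne (fun _ => volume) j 0
  filter_upwards [hae] with z hz0
  refine Differentiable.differentiableOn (Differentiable.mul ?_ (hG.hol z))
  have h : ∀ i : S, Differentiable ℂ fun s : Fin m → ℂ =>
      (Complex.normSq (z (k i)) : ℂ) ^ (s i / 2) := fun i =>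
    Differentiable.const_cpow (by fun_prop) (Or.inl (by simpa using hz0 (k i)))
  have h' : ∀ i ∈ (Finset.univ : Finset S), Differentiable ℂ fun s : Fin m → ℂ =>
      powNormSq (κ i) (s i / 2) (z (k i)) := fun i _ => (h i).const_mul _
  intro s
  exact (HasFDerivAt.finsetProd fun i hi => (h' i hi s).hasFDerivAt).differentiableAt

open Classical in
/-- One integration by parts in the variable `z_{k j}`. -/
lemma integral_update (hG : IsHolFamily G) (k : S ↪ Fin d) (κ : S → ℕ) (j : S) {s : Fin m → ℂ}
    (hs : ∀ i, 2 < (s i).re) :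
    ∫ z, weight k (Function.update κ j (κ j + 1)) s z * wirtinger (k j) (G s) z
      = -(κ j + 1 + s j / 2) * ∫ z, weight k κ s z * G s z := by
  rw [integral_mul_wirtinger (k j) (contDiff_weight _ hs)
    ((hG.contDiff s).of_le (by exact_mod_cast le_top)) (hG.hasCompactSupport s)]
  simp_rw [wirtinger_weight κ hs j, mul_assoc]
  rw [integral_const_mul]
  ring

open Classical in
/-- One integration by parts in each of the variables `z_{k i}` with `i ∈ A`. -/
lemma exists_integral_raise (hG : IsHolFamily G) (k : S ↪ Fin d) (n : ℕ) (A : Finset S) :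
    ∃ G' : (Fin m → ℂ) → (Fin d → ℂ) → ℂ, IsHolFamily G' ∧
      ∀ s : Fin m → ℂ, (∀ i, 2 < (s i).re) →
        ∫ z, weight k (fun i => if i ∈ A then n + 1 else n) s z * G' s z
          = (∏ i ∈ A, (-(s i + 2 * n + 2) / 2)) * ∫ z, weight k (fun _ => n) s z * G s z := by
  induction A using Finset.induction_on with
  | empty => exact ⟨G, hG, fun s _ => by simp⟩
  | insert j A hj ih =>
    obtain ⟨G', hG', h⟩ := ih
    refine ⟨_, hG'.wirtinger (k j), fun s hs => ?_⟩
    have hκ : (fun i : S => if i ∈ insert j A then n + 1 else n)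
        = Function.update (fun i => if i ∈ A then n + 1 else n) j
          ((if j ∈ A then n + 1 else n) + 1) := by
      ext i
      rcases eq_or_ne i j with rfl | hij
      · simp [hj]
      · simp [Finset.mem_insert, hij]
    rw [hκ, hG'.integral_update k _ j hs, h s hs, Finset.prod_insert hj, if_neg hj]
    ring

/-- `n` integrations by parts in each of the variables `z_{k i}`. -/
lemma exists_integral_iterate (hG : IsHolFamily G) (k : S ↪ Fin d) (n : ℕ) :
    ∃ G' : (Fin m → ℂ) → (Fin d → ℂ) → ℂ, IsHolFamily G' ∧
      ∀ s : Fin m → ℂ, (∀ i, 2 < (s i).re) →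
        ∫ z, weight k (fun _ => n) s z * G' s z
          = (∏ i : S, ∏ j ∈ Finset.range n, (-(s i + 2 * j + 2) / 2))
            * ∫ z, weight k (fun _ => 0) s z * G s z := by
  induction n with
  | zero => exact ⟨G, hG, fun s _ => by simp⟩
  | succ n ih =>
    obtain ⟨G', hG', h⟩ := ih
    obtain ⟨G'', hG'', h'⟩ := hG'.exists_integral_raise k n Finset.univ
    refine ⟨G'', hG'', fun s hs => ?_⟩
    have := h' s hs
    simp only [Finset.mem_univ, if_true] at this
    rw [this, h s hs, ← mul_assoc, ← Finset.prod_mul_distrib]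
    congr 1
    exact Finset.prod_congr rfl fun i _ => by rw [Finset.prod_range_succ, mul_comm]

/-- Meromorphic continuation of local zeta integrals. -/
theorem exists_continuation (hG : IsHolFamily G) (k : S ↪ Fin d) :
    ∃ Z, HasSimplePoles Z ∧ ∀ s : Fin m → ℂ, (∀ i, 2 < (s i).re) →
      Integrable (fun z => weight k (fun _ => 0) s z * G s z) ∧
        Z s = ∫ z, weight k (fun _ => 0) s z * G s z := by
  choose G' hG' hint using hG.exists_integral_iterate k
  obtain ⟨Z, hZ, hZs⟩ := exists_hasSimplePoles_of_poleFactor (m := m)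
    (F := fun s => ∫ z, weight k (fun _ => 0) s z * G s z)
    -- the factors with `i ∉ S`, without counterpart in the integral, are supplied by hand
    (J := fun n s => (∏ i ∈ Sᶜ, ∏ j ∈ Finset.range n, (-(s i + 2 * j + 2) / 2))
      * ∫ z, weight k (fun _ => n) s z * G' n s z)
    (fun n s hs => by
      refine AnalyticAt.fun_mul ?_ ((hG' n).analyticAt_integral k _ fun i => hs i)
      refine Finset.analyticAt_fun_prod _ fun i _ => Finset.analyticAt_fun_prod _ fun j _ => ?_
      exact ((((analyticAt_coord i s).fun_add analyticAt_const).fun_add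
        analyticAt_const).fun_neg).fun_div analyticAt_const two_ne_zero)
    (fun n s hs => by
      rw [hint n s hs, ← mul_assoc, poleFactor, ← Finset.prod_mul_prod_compl S,
        ← Finset.prod_coe_sort S]
      ring)
  refine ⟨Z, hZ, fun s hs => ⟨hG.integrable k _ fun i => ?_, hZs s hs⟩⟩
  have := hs i
  simp
  linarith

end IsHolFamily

/-! ### Normal crossing coordinates -/

/-- A function that is smooth on an open set and vanishes there off a closed subset extends smoothly
by zero. -/
lemma contDiff_indicator {E F : Type*} [NormedAddCommGroup E] [NormedSpace ℝ E]
    [NormedAddCommGroup F] [NormedSpace ℝ F] {f : E → F} {V K : Set E} (hV : IsOpen V)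
    (hf : ContDiffOn ℝ ∞ f V) (hK : IsClosed K) (hKV : K ⊆ V)
    (h0 : ∀ x ∈ V, x ∉ K → f x = 0) : ContDiff ℝ ∞ (V.indicator f) := by
  refine contDiff_iff_contDiffAt.2 fun x => ?_
  by_cases hx : x ∈ V
  · refine (hf.contDiffAt (hV.mem_nhds hx)).congr_of_eventuallyEq ?_
    filter_upwards [hV.mem_nhds hx] with y hy using indicator_of_mem hy f
  · refine contDiffAt_const (c := (0 : F)) |>.congr_of_eventuallyEq ?_
    filter_upwards [hK.isOpen_compl.mem_nhds fun h => hx (hKV h)] with y hy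
    by_cases hyV : y ∈ V
    · rw [indicator_of_mem hyV, h0 y hyV hy]
    · exact indicator_of_notMem hyV f

lemma contDiffOn_det {E : Type*} [NormedAddCommGroup E] [NormedSpace ℝ E] {d : ℕ} {V : Set E}
    {f : E → (Fin d → ℂ) →L[ℝ] (Fin d → ℂ)} (hf : ContDiffOn ℝ ∞ f V) :
    ContDiffOn ℝ ∞ (fun x => (f x).det) V := by
  let b := Module.finBasis ℝ (Fin d → ℂ)
  have h : (fun x => (f x).det) = fun x =>
      ∑ σ : Equiv.Perm (Fin (Module.finrank ℝ (Fin d → ℂ))), ((Equiv.Perm.sign σ : ℤ) : ℝ)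
        * ∏ i, b.equivFunL (f x (b i)) (σ i) := by
    ext x
    rw [ContinuousLinearMap.det, ← LinearMap.det_toMatrix b, Matrix.det_apply']
    simp [LinearMap.toMatrix_apply]
  rw [h]
  refine ContDiffOn.sum fun σ _ => contDiffOn_const.mul (contDiffOn_prod fun i _ => ?_)
  have h1 : ContDiffOn ℝ ∞ (fun x => f x (b i)) V := hf.clm_apply contDiffOn_const
  exact (contDiff_apply ℝ ℝ (σ i)).comp_contDiffOn (b.equivFunL.contDiff.comp_contDiffOn h1)

section

variable {d m : ℕ} {X : Type*} [TopologicalSpace X] [ChartedSpace (Fin d → ℂ) X]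

lemma mem_real_maximalAtlas {e : OpenPartialHomeomorph X (Fin d → ℂ)}
    (he : e ∈ IsManifold.maximalAtlas 𝓘(ℂ, Fin d → ℂ) ω X) :
    e ∈ IsManifold.maximalAtlas 𝓘(ℝ, Fin d → ℂ) ∞ X := by
  have hle : ∀ f ∈ contDiffGroupoid ω 𝓘(ℂ, Fin d → ℂ), f ∈ contDiffGroupoid ∞ 𝓘(ℝ, Fin d → ℂ) := by
    intro f hf
    rw [contDiffGroupoid, mem_groupoid_of_pregroupoid] at hf ⊢
    have h1 : ContDiffOn ℂ ω (𝓘(ℂ, Fin d → ℂ) ∘ f ∘ (𝓘(ℂ, Fin d → ℂ)).symm)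
      ((𝓘(ℂ, Fin d → ℂ)).symm ⁻¹' f.source ∩ range 𝓘(ℂ, Fin d → ℂ)) := hf.1
    have h2 : ContDiffOn ℂ ω (𝓘(ℂ, Fin d → ℂ) ∘ f.symm ∘ (𝓘(ℂ, Fin d → ℂ)).symm)
      ((𝓘(ℂ, Fin d → ℂ)).symm ⁻¹' f.target ∩ range 𝓘(ℂ, Fin d → ℂ)) := hf.2
    exact ⟨(h1.restrict_scalars ℝ).of_le le_top, (h2.restrict_scalars ℝ).of_le le_top⟩
  rw [IsManifold.maximalAtlas, mem_maximalAtlas_iff] at he ⊢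
  exact fun e' he' => ⟨hle _ (he e' he').1, hle _ (he e' he').2⟩

/-- Nonnegative smooth functions with zero set `Y` in the canonical conformal class of `Y`. The
condition on the rank of the Hessian is omitted, so that multiplication by positive functions
obviously preserves this class. -/
structure IsCanonical (d : ℕ) {X : Type*} [TopologicalSpace X] [ChartedSpace (Fin d → ℂ) X]
    (Y : Set X) (μ : X → ℝ) : Prop where
  smooth : ContMDiff 𝓘(ℝ, Fin d → ℂ) 𝓘(ℝ, ℝ) ∞ μ
  nonneg : ∀ x, 0 ≤ μ x
  zero_iff : ∀ x, μ x = 0 ↔ x ∈ Y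
  canonical : ∀ (U : Set X) (f : X → ℂ), IsOpen U → IsLocalEquation d Y U f →
    ∃ g : X → ℝ, ContMDiffOn 𝓘(ℝ, Fin d → ℂ) 𝓘(ℝ, ℝ) ∞ g U ∧
      ∀ x ∈ U, 0 < g x ∧ μ x = g x * ‖f x‖ ^ 2

lemma IsCanonicalMorseBott.isCanonical {Y : Set X} {μ : X → ℝ} (h : IsCanonicalMorseBott d Y μ) :
    IsCanonical d Y μ :=
  ⟨h.morseBott.smooth, h.morseBott.nonneg, h.morseBott.zero_iff, h.canonical⟩

lemma IsCanonical.pos {Y : Set X} {μ : X → ℝ} (h : IsCanonical d Y μ) {x : X} (hx : x ∉ Y) :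
    0 < μ x :=
  (h.nonneg x).lt_of_ne fun h0 => hx ((h.zero_iff x).1 h0.symm)

lemma IsCanonical.exp_mul {Y : Set X} {μ : X → ℝ} (h : IsCanonical d Y μ) {φ : X → ℝ}
    (hφ : ContMDiff 𝓘(ℝ, Fin d → ℂ) 𝓘(ℝ, ℝ) ∞ φ) :
    IsCanonical d Y fun x => Real.exp (2 * φ x) * μ x := by
  have hexp : ContMDiff 𝓘(ℝ, Fin d → ℂ) 𝓘(ℝ, ℝ) ∞ fun x => Real.exp (2 * φ x) := by
    have : ContDiff ℝ ∞ fun t : ℝ => Real.exp (2 * t) := by fun_prop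
    exact this.contMDiff.comp hφ
  refine ⟨hexp.mul h.smooth, fun x => mul_nonneg (Real.exp_pos _).le (h.nonneg x), fun x => ?_,
    fun U f hU hf => ?_⟩
  · rw [mul_eq_zero, or_iff_right (Real.exp_pos _).ne', h.zero_iff]
  · obtain ⟨g, hg, hgx⟩ := h.canonical U f hU hf
    refine ⟨fun x => Real.exp (2 * φ x) * g x, hexp.contMDiffOn.mul hg, fun x hx => ?_⟩
    exact ⟨mul_pos (Real.exp_pos _) (hgx x hx).1, by rw [(hgx x hx).2, mul_assoc]⟩

/-- In normal crossing coordinates, the coordinates which cut out the hypersurfaces are local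
equations of them. -/
lemma isLocalEquation_coord {Y U : Set X} {e : OpenPartialHomeomorph X (Fin d → ℂ)}
    (he : e ∈ IsManifold.maximalAtlas 𝓘(ℂ, Fin d → ℂ) ω X) (hU : IsOpen U) (hUe : U ⊆ e.source)
    (j : Fin d) (hY : ∀ x ∈ e.source, x ∈ Y ↔ e x j = 0) :
    IsLocalEquation d Y U fun x => e x j := by
  have hproj : MDifferentiable 𝓘(ℂ, Fin d → ℂ) 𝓘(ℂ, ℂ) fun z : Fin d → ℂ => z j :=
    (differentiable_apply j).mdifferentiable
  have hsm : MDifferentiableOn 𝓘(ℂ, Fin d → ℂ) 𝓘(ℂ, Fin d → ℂ) e e.source :=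
    (contMDiffOn_of_mem_maximalAtlas he).mdifferentiableOn (by simp)
  have hsm' : MDifferentiableOn 𝓘(ℂ, Fin d → ℂ) 𝓘(ℂ, Fin d → ℂ) e.symm e.target :=
    (contMDiffOn_symm_of_mem_maximalAtlas he).mdifferentiableOn (by simp)
  have hhol : MDifferentiableOn 𝓘(ℂ, Fin d → ℂ) 𝓘(ℂ, ℂ) (fun x => e x j) U :=
    hproj.comp_mdifferentiableOn (hsm.mono hUe)
  refine ⟨hhol, fun x hx => (hY x (hUe hx)).symm, fun x hx h0 => ?_⟩
  have hxe := hUe hx.1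
  -- composing with `e.symm` would give that the derivative of a coordinate function vanishes
  have h1 : MDifferentiableAt 𝓘(ℂ, Fin d → ℂ) 𝓘(ℂ, ℂ) (fun x => e x j) (e.symm (e x)) := by
    rw [e.left_inv hxe]
    exact hhol.mdifferentiableAt (hU.mem_nhds hx.1)
  have h2 : MDifferentiableAt 𝓘(ℂ, Fin d → ℂ) 𝓘(ℂ, Fin d → ℂ) e.symm (e x) :=
    hsm'.mdifferentiableAt (e.open_target.mem_nhds (e.map_source hxe))
  have h3 := mfderiv_comp (e x) h1 h2
  have h4 : mfderiv 𝓘(ℂ, Fin d → ℂ) 𝓘(ℂ, ℂ) ((fun x => e x j) ∘ e.symm) (e x)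
      = mfderiv 𝓘(ℂ, Fin d → ℂ) 𝓘(ℂ, ℂ) (fun z : Fin d → ℂ => z j) (e x) := by
    refine Filter.EventuallyEq.mfderiv_eq ?_
    filter_upwards [e.open_target.mem_nhds (e.map_source hxe)] with z hz
    simp [e.right_inv hz]
  have h5 : mfderiv 𝓘(ℂ, Fin d → ℂ) 𝓘(ℂ, ℂ) (fun x => e x j) (e.symm (e x)) = 0 := by
    rw [e.left_inv hxe]
    exact h0
  rw [h4, h5] at h3
  have h6 : mfderiv 𝓘(ℂ, Fin d → ℂ) 𝓘(ℂ, ℂ) (fun z : Fin d → ℂ => z j) (e x)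
      = ContinuousLinearMap.proj (R := ℂ) (φ := fun _ : Fin d => ℂ) j := by
    rw [mfderiv_eq_fderiv]
    exact (ContinuousLinearMap.proj (R := ℂ) (φ := fun _ : Fin d => ℂ) j).fderiv
  have h7 : (ContinuousLinearMap.proj (R := ℂ) (φ := fun _ : Fin d => ℂ) j) (Pi.single j 1) =
      0 := by
    have := DFunLike.congr_fun (h6.symm.trans h3) (Pi.single j 1 : Fin d → ℂ)
    exact this
  simp at h7

/-- On the open set `U`, contained in the domain of the coordinates `e`, the functions `μ_i` are
positive multiples of the squared absolute values of distinct coordinates if `i ∈ S`, and they are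
positive if `i ∉ S`. -/
structure LocalModel (d : ℕ) {m : ℕ} {X : Type*} [TopologicalSpace X]
    [ChartedSpace (Fin d → ℂ) X] (μ : Fin m → X → ℝ) (U : Set X) where
  /-- the coordinates -/
  e : OpenPartialHomeomorph X (Fin d → ℂ)
  mem_atlas : e ∈ IsManifold.maximalAtlas 𝓘(ℝ, Fin d → ℂ) ∞ X
  isOpen : IsOpen U
  subset : U ⊆ e.source
  /-- the indices of the hypersurfaces meeting `U` -/
  S : Finset (Fin m)
  /-- the coordinates cutting out these hypersurfaces -/
  k : S ↪ Fin d
  /-- the positive factors -/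
  g : Fin m → X → ℝ
  smooth : ∀ i, ContMDiffOn 𝓘(ℝ, Fin d → ℂ) 𝓘(ℝ, ℝ) ∞ (g i) U
  pos : ∀ i, ∀ x ∈ U, 0 < g i x
  eq_mul : ∀ i : S, ∀ x ∈ U, μ i x = g i x * Complex.normSq (e x (k i))
  eq : ∀ i ∉ S, ∀ x ∈ U, μ i x = g i x

lemma exists_localModel {D : Fin m → Set X} (hD : IsNormalCrossing d D) {μ : Fin m → X → ℝ}
    (hμ : ∀ i, IsCanonical d (D i) (μ i)) (p : X) :
    ∃ U : Set X, p ∈ U ∧ Nonempty (LocalModel d μ U) := by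
  classical
  obtain ⟨e, he, hpe, k, hk⟩ := hD.2 p
  set S : Finset (Fin m) := Finset.univ.filter fun i => p ∈ D i with hS
  have hmem : ∀ i, i ∈ S ↔ p ∈ D i := fun i => by simp [hS]
  let k' : S ↪ Fin d := ⟨fun i => k ⟨i, (hmem i).1 i.2⟩, fun i j h => by
    exact Subtype.ext (Subtype.mk.inj (k.injective h))⟩
  set U : Set X := e.source ∩ ⋂ i : {i // i ∉ S}, (D i)ᶜ with hUdef
  have hU : IsOpen U := e.open_source.inter
    (isOpen_iInter_of_finite fun i => (hD.1 i).isOpen_compl)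
  have hUe : U ⊆ e.source := inter_subset_left
  have hex : ∀ i : Fin m, ∃ g : X → ℝ, ContMDiffOn 𝓘(ℝ, Fin d → ℂ) 𝓘(ℝ, ℝ) ∞ g U ∧
      (∀ x ∈ U, 0 < g x) ∧
      (∀ hi : i ∈ S, ∀ x ∈ U, μ i x = g x * Complex.normSq (e x (k' ⟨i, hi⟩))) ∧
      (i ∉ S → ∀ x ∈ U, μ i x = g x) := by
    intro i
    by_cases hi : i ∈ S
    · obtain ⟨g, hg, hgx⟩ := (hμ i).canonical U _ hU
        (isLocalEquation_coord he hU hUe (k' ⟨i, hi⟩) (hk ⟨i, (hmem i).1 hi⟩))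
      refine ⟨g, hg, fun x hx => (hgx x hx).1, fun _ x hx => ?_, fun h => absurd hi h⟩
      rw [(hgx x hx).2, Complex.normSq_eq_norm_sq]
    · refine ⟨μ i, (hμ i).smooth.contMDiffOn, fun x hx => (hμ i).pos ?_, fun h => absurd h hi,
        fun _ x _ => rfl⟩
      exact mem_iInter.1 hx.2 ⟨i, hi⟩
  choose g hg hpos hgS hgS' using hex
  refine ⟨U, ⟨hpe, mem_iInter.2 fun i hi => i.2 ((hmem _).2 hi)⟩,
    ⟨⟨e, mem_real_maximalAtlas he, hU, hUe, S, k', g, hg, hpos, fun i x hx => hgS i i.2 x hx,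
      hgS'⟩⟩⟩

end

/-! ### Continuation of integrals supported in normal crossing coordinates -/

section

variable {d m : ℕ} {X : Type*} [TopologicalSpace X] [ChartedSpace (Fin d → ℂ) X]

/-- Families of functions on `X`, jointly smooth in all variables and holomorphic in the
parameters `s ∈ ℂ ^ m`. -/
structure IsSmoothFamily (d : ℕ) {m : ℕ} {X : Type*} [TopologicalSpace X]
    [ChartedSpace (Fin d → ℂ) X] (A : (Fin m → ℂ) → X → ℂ) : Prop where
  hol : ∀ x, Differentiable ℂ fun s => A s x
  smooth : ∀ e ∈ IsManifold.maximalAtlas 𝓘(ℝ, Fin d → ℂ) ∞ X,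
    ContDiffOn ℝ ∞ (fun p : (Fin m → ℂ) × (Fin d → ℂ) => A p.1 (e.symm p.2)) (univ ×ˢ e.target)

/-- The form `A_s μ₁^{s₁/2} ⋯ μ_m^{s_m/2} β`. The factor `A_s` accommodates the remainder term in
the expansion of the zeta function under a conformal change of the `μ_i`. -/
def twistedForm (A : (Fin m → ℂ) → X → ℂ) (μ : Fin m → X → ℝ) (β : TopForm d X)
    (s : Fin m → ℂ) : TopForm d X :=
  fun x => (A s x * ∏ i, (μ i x : ℂ) ^ (s i / 2)) • β x

lemma coeff_eq_zero {e : OpenPartialHomeomorph X (Fin d → ℂ)} {β : TopForm d X}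
    {y : Fin d → ℂ} (h : β (e.symm y) = 0) : coeff e β y = 0 := by
  rw [coeff, h]
  rfl

lemma twistedForm_apply (A : (Fin m → ℂ) → X → ℂ) (μ : Fin m → X → ℝ) (β : TopForm d X)
    (s : Fin m → ℂ) (x : X) (v : Fin (2 * d) → TangentSpace 𝓘(ℝ, Fin d → ℂ) x) :
    twistedForm A μ β s x v = (A s x * ∏ i, (μ i x : ℂ) ^ (s i / 2)) * β x v :=
  rfl

lemma coeff_twistedForm (e : OpenPartialHomeomorph X (Fin d → ℂ)) (A : (Fin m → ℂ) → X → ℂ)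
    (μ : Fin m → X → ℝ) (β : TopForm d X) (s : Fin m → ℂ) (y : Fin d → ℂ) :
    coeff e (twistedForm A μ β s) y
      = (A s (e.symm y) * ∏ i, (μ i (e.symm y) : ℂ) ^ (s i / 2)) * coeff e β y :=
  rfl

lemma twistedForm_eq_zero (A : (Fin m → ℂ) → X → ℂ) (μ : Fin m → X → ℝ) {β : TopForm d X}
    (s : Fin m → ℂ) {x : X} (h : β x = 0) : twistedForm A μ β s x = 0 := by
  ext v
  rw [twistedForm_apply, h]
  exact mul_zero _

/-- In local coordinates, the positive factor of `μ_i ^ (s_i / 2)` is an exponential, and the other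
factor is an absolute value of a coordinate. -/
lemma LocalModel.prod_cpow {μ : Fin m → X → ℝ} {U : Set X} (M : LocalModel d μ U) (s : Fin m → ℂ)
    {x : X} (hx : x ∈ U) :
    ∏ i, (μ i x : ℂ) ^ (s i / 2)
      = weight M.k (fun _ => 0) s (M.e x)
        * ∏ i, Complex.exp (s i / 2 * (Real.log (M.g i x) : ℂ)) := by
  have hexp : ∀ i, (M.g i x : ℂ) ^ (s i / 2)
      = Complex.exp (s i / 2 * (Real.log (M.g i x) : ℂ)) := fun i => by
    rw [Complex.cpow_def_of_ne_zero (by exact_mod_cast (M.pos i x hx).ne'),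
      Complex.ofReal_log (M.pos i x hx).le, mul_comm]
  rw [← Finset.prod_mul_prod_compl M.S, ← Finset.prod_mul_prod_compl M.S (fun i =>
    Complex.exp (s i / 2 * (Real.log (M.g i x) : ℂ))), ← mul_assoc]
  congr 1
  · rw [weight, ← Finset.prod_coe_sort M.S, ← Finset.prod_coe_sort M.S, ← Finset.prod_mul_distrib]
    refine Finset.prod_congr rfl fun i _ => ?_
    rw [M.eq_mul i x hx, powNormSq, pow_zero, one_mul, ← hexp, Complex.ofReal_mul,
      Complex.mul_cpow_ofReal_nonneg (M.pos i x hx).le (Complex.normSq_nonneg _), mul_comm]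
  · refine Finset.prod_congr rfl fun i hi => ?_
    rw [M.eq i (Finset.mem_compl.1 hi) x hx, hexp]

variable [IsManifold 𝓘(ℂ, Fin d → ℂ) ω X] [T2Space X] [SigmaCompactSpace X]

lemma tsupport_chartPartition_subset (c : X) :
    tsupport (chartPartition d X c) ⊆ (chartAt (Fin d → ℂ) c).source :=
  (SmoothPartitionOfUnity.exists_isSubordinate_chartAt_source 𝓘(ℝ, Fin d → ℂ) X).choose_spec c

/-- The change of variables from the chart at `c` to normal crossing coordinates turns the integral
of a twisted form into a local zeta integral. -/
theorem LocalModel.exists_continuation {μ : Fin m → X → ℝ} {U : Set X} (M : LocalModel d μ U)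
    {A : (Fin m → ℂ) → X → ℂ} (hA : IsSmoothFamily d A) {β : TopForm d X}
    (hβ : SmoothForm β) {K : Set X} (hK : IsCompact K) (hKU : K ⊆ U) (hβK : ∀ x ∉ K, β x = 0)
    (c : X) :
    ∃ Z, HasSimplePoles Z ∧ ∀ s : Fin m → ℂ, (∀ i, 2 < (s i).re) →
      IntegrableOn (localDensity (twistedForm A μ β s) c) (chartAt (Fin d → ℂ) c).target ∧
        Z s = ∫ y in (chartAt (Fin d → ℂ) c).target, localDensity (twistedForm A μ β s) c y := by
  set h := chartAt (Fin d → ℂ) c with hh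
  set e := M.e with he
  set ρ := chartPartition d X c with hρ
  have hatlas : h ∈ IsManifold.maximalAtlas 𝓘(ℝ, Fin d → ℂ) ∞ X :=
    IsManifold.chart_mem_maximalAtlas c
  set V : Set (Fin d → ℂ) := e.target ∩ e.symm ⁻¹' (h.source ∩ U) with hVdef
  have hV : IsOpen V := e.isOpen_inter_preimage_symm (h.open_source.inter M.isOpen)
  set Ψ : (Fin d → ℂ) → Fin d → ℂ := fun z => h (e.symm z) with hΨdef
  have hVe : V ⊆ e.target := inter_subset_left
  have hsymm : ContMDiffOn 𝓘(ℝ, Fin d → ℂ) 𝓘(ℝ, Fin d → ℂ) ∞ e.symm e.target :=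
    contMDiffOn_symm_of_mem_maximalAtlas M.mem_atlas
  have hΨ : ContDiffOn ℝ ∞ Ψ V := by
    refine ContMDiffOn.contDiffOn ?_
    exact (contMDiffOn_of_mem_maximalAtlas hatlas).comp (hsymm.mono hVe) fun z hz => hz.2.1
  have hΨmaps : ∀ z ∈ V, Ψ z ∈ h.target := fun z hz => h.map_source hz.2.1
  have hΨsymm : ∀ z ∈ V, h.symm (Ψ z) = e.symm z := fun z hz => h.left_inv hz.2.1
  have hΨd : ∀ z ∈ V, HasFDerivAt Ψ (fderiv ℝ Ψ z) z := fun z hz =>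
    ((hΨ.contDiffAt (hV.mem_nhds hz)).differentiableAt (by simp)).hasFDerivAt
  have hΨinj : InjOn Ψ V := by
    intro z hz w hw hzw
    have h1 : e.symm z = e.symm w := by rw [← hΨsymm z hz, ← hΨsymm w hw, hzw]
    exact e.symm.injOn (hVe hz) (hVe hw) h1
  have hΨimage : Ψ '' V = h.target ∩ h.symm ⁻¹' U := by
    ext y
    constructor
    · rintro ⟨z, hz, rfl⟩
      exact ⟨hΨmaps z hz, by rw [mem_preimage, hΨsymm z hz]; exact hz.2.2⟩
    · rintro ⟨hy, hyU⟩
      have hye : h.symm y ∈ e.source := M.subset hyU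
      refine ⟨e (h.symm y), ⟨e.map_source hye, ?_⟩, ?_⟩
      · rw [mem_preimage, e.left_inv hye]
        exact ⟨h.map_target hy, hyU⟩
      · simp only [hΨdef, e.left_inv hye, h.right_inv hy]
  -- the inverse of `Ψ` is smooth, so the Jacobian of `Ψ` does not vanish
  have hdet : ∀ z ∈ V, (fderiv ℝ Ψ z).det ≠ 0 := by
    intro z hz h0
    have hΦ : ContDiffOn ℝ ∞ (fun y => e (h.symm y)) (h.target ∩ h.symm ⁻¹' U) := by
      refine ContMDiffOn.contDiffOn ?_
      exact (contMDiffOn_of_mem_maximalAtlas M.mem_atlas).comp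
        ((contMDiffOn_symm_of_mem_maximalAtlas hatlas).mono inter_subset_left)
        fun y hy => M.subset hy.2
    have hmem : Ψ z ∈ h.target ∩ h.symm ⁻¹' U := hΨimage ▸ mem_image_of_mem Ψ hz
    have hopen : IsOpen (h.target ∩ h.symm ⁻¹' U) := h.isOpen_inter_preimage_symm M.isOpen
    have h1 := ((hΦ.contDiffAt (hopen.mem_nhds hmem)).differentiableAt (by simp)).hasFDerivAt
    have h2 := h1.comp z (hΨd z hz)
    have h3 : HasFDerivAt ((fun y => e (h.symm y)) ∘ Ψ) (ContinuousLinearMap.id ℝ _) z := by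
      refine (hasFDerivAt_id z).congr_of_eventuallyEq ?_
      filter_upwards [hV.mem_nhds hz] with w hw
      simp only [Function.comp_apply, hΨsymm w hw, e.right_inv (hVe hw), id]
    have h4 := congrArg ContinuousLinearMap.det (h2.unique h3)
    have h5 : ContinuousLinearMap.det ((fderiv ℝ (fun y => e (h.symm y)) (Ψ z)).comp
        (fderiv ℝ Ψ z)) = (fderiv ℝ (fun y => e (h.symm y)) (Ψ z)).det * (fderiv ℝ Ψ z).det :=
      LinearMap.det_comp _ _
    rw [h5, h0, mul_zero] at h4
    exact zero_ne_one (h4.trans (LinearMap.det_id))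
  -- the family of smooth densities in the coordinates `e`
  set G₀ : (Fin m → ℂ) → (Fin d → ℂ) → ℂ := fun s z =>
    ((|(fderiv ℝ Ψ z).det| : ℝ) : ℂ) * ((ρ (e.symm z) : ℂ) * ((A s (e.symm z)
      * ∏ i, Complex.exp (s i / 2 * (Real.log (M.g i (e.symm z)) : ℂ))) * coeff h β (Ψ z)))
    with hG₀
  set G : (Fin m → ℂ) → (Fin d → ℂ) → ℂ := fun s => V.indicator (G₀ s) with hG
  have hGin : ∀ s, ∀ z ∈ V, G s z = G₀ s z := fun s z hz => indicator_of_mem hz _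
  have hGout : ∀ s, ∀ z ∉ V, G s z = 0 := fun s z hz => indicator_of_notMem hz _
  set K' : Set (Fin d → ℂ) := e '' (K ∩ tsupport ρ) with hK'
  have hKsub : K ∩ tsupport ρ ⊆ e.source := fun x hx => M.subset (hKU hx.1)
  have hK'c : IsCompact K' :=
    (hK.inter_right (isClosed_tsupport _)).image_of_continuousOn (e.continuousOn.mono hKsub)
  have hK'V : K' ⊆ V := by
    rintro _ ⟨x, hx, rfl⟩
    refine ⟨e.map_source (hKsub hx), ?_⟩
    rw [mem_preimage, e.left_inv (hKsub hx)]
    exact ⟨tsupport_chartPartition_subset c hx.2, hKU hx.1⟩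
  have hG₀zero : ∀ s, ∀ z ∈ V, z ∉ K' → G₀ s z = 0 := by
    intro s z hz hzK
    by_cases hx : e.symm z ∈ K
    · have : e.symm z ∉ tsupport ρ := fun hx' =>
        hzK ⟨e.symm z, ⟨hx, hx'⟩, e.right_inv (hVe hz)⟩
      have : ρ (e.symm z) = 0 := image_eq_zero_of_notMem_tsupport this
      simp [hG₀, this]
    · have : coeff h β (Ψ z) = 0 := coeff_eq_zero (by rw [hΨsymm z hz, hβK _ hx])
      simp [hG₀, this]
  have hfam : IsHolFamily G := by
    refine ⟨?_, fun z => ?_, K', hK'c, fun z hz s => ?_⟩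
    · have hGind : (fun p : (Fin m → ℂ) × (Fin d → ℂ) => G p.1 p.2)
          = (univ ×ˢ V).indicator fun p => G₀ p.1 p.2 := by
        ext ⟨s, z⟩
        by_cases hz : z ∈ V
        · rw [indicator_of_mem (show (s, z) ∈ univ ×ˢ V from ⟨mem_univ _, hz⟩)]
          exact indicator_of_mem hz _
        · rw [indicator_of_notMem (show (s, z) ∉ univ ×ˢ V from fun h => hz h.2)]
          exact indicator_of_notMem hz _
      rw [hGind]
      refine contDiff_indicator (K := univ ×ˢ K') (isOpen_univ.prod hV) ?_
        (isClosed_univ.prod hK'c.isClosed) (prod_mono_right hK'V) fun p hp hpK =>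
          hG₀zero p.1 p.2 hp.2 fun h => hpK ⟨mem_univ _, h⟩
      have hsnd : ContDiffOn ℝ ∞ (Prod.snd : (Fin m → ℂ) × (Fin d → ℂ) → Fin d → ℂ)
          (univ ×ˢ V) := contDiff_snd.contDiffOn
      have hmaps : MapsTo (Prod.snd : (Fin m → ℂ) × (Fin d → ℂ) → Fin d → ℂ) (univ ×ˢ V) V :=
        fun p hp => hp.2
      have hofReal : ContDiff ℝ ∞ (fun t : ℝ => (t : ℂ)) := Complex.ofRealCLM.contDiff
      have h1 : ContDiffOn ℝ ∞ (fun z => ((|(fderiv ℝ Ψ z).det| : ℝ) : ℂ)) V := by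
        refine hofReal.comp_contDiffOn ?_
        have hd : ContDiffOn ℝ ∞ (fun z => (fderiv ℝ Ψ z).det) V :=
          contDiffOn_det (hΨ.fderiv_of_isOpen hV (by simp))
        exact fun z hz => ((hd.contDiffAt (hV.mem_nhds hz)).abs (hdet z hz)).contDiffWithinAt
      have h2 : ContDiffOn ℝ ∞ (fun z => (ρ (e.symm z) : ℂ)) V := by
        refine hofReal.comp_contDiffOn (ContMDiffOn.contDiffOn ?_)
        exact ρ.contMDiff.comp_contMDiffOn (hsymm.mono hVe)
      have h3 : ContDiffOn ℝ ∞ (fun z => coeff h β (Ψ z)) V :=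
        (hβ h (chart_mem_atlas _ c)).comp hΨ hΨmaps
      have h4 : ∀ i, ContDiffOn ℝ ∞ (fun z => (Real.log (M.g i (e.symm z)) : ℂ)) V := fun i => by
        refine hofReal.comp_contDiffOn (ContDiffOn.log (ContMDiffOn.contDiffOn ?_)
          fun z hz => (M.pos i _ hz.2.2).ne')
        exact (M.smooth i).comp (hsymm.mono hVe) fun z hz => hz.2.2
      have h5 : ContDiffOn ℝ ∞ (fun p : (Fin m → ℂ) × (Fin d → ℂ) => A p.1 (e.symm p.2))
          (univ ×ˢ V) := (hA.smooth e M.mem_atlas).mono (prod_mono_right hVe)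
      have h6 : ContDiffOn ℝ ∞ (fun p : (Fin m → ℂ) × (Fin d → ℂ) =>
          ∏ i, Complex.exp (p.1 i / 2 * (Real.log (M.g i (e.symm p.2)) : ℂ))) (univ ×ˢ V) := by
        refine contDiffOn_prod fun i _ => ?_
        refine ContDiff.comp_contDiffOn (g := Complex.exp) Complex.contDiff_exp ?_
        refine ContDiffOn.mul (ContDiff.contDiffOn ?_) ((h4 i).comp hsnd hmaps)
        have : ContDiff ℝ ∞ fun p : (Fin m → ℂ) × (Fin d → ℂ) => p.1 i :=
          (contDiff_apply ℝ ℂ i).comp contDiff_fst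
        exact this.div_const 2
      exact (h1.comp hsnd hmaps).mul ((h2.comp hsnd hmaps).mul
        ((h5.mul h6).mul (h3.comp hsnd hmaps)))
    · by_cases hz : z ∈ V
      · simp only [hGin _ z hz]
        have h1 := hA.hol (e.symm z)
        have h2 : Differentiable ℂ fun s : Fin m → ℂ =>
            ∏ i, Complex.exp (s i / 2 * (Real.log (M.g i (e.symm z)) : ℂ)) := by
          have : ∀ i ∈ (Finset.univ : Finset (Fin m)), Differentiable ℂ fun s : Fin m → ℂ =>
              Complex.exp (s i / 2 * (Real.log (M.g i (e.symm z)) : ℂ)) := fun i _ => by fun_prop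
          intro s
          exact (HasFDerivAt.finsetProd fun i hi => (this i hi s).hasFDerivAt).differentiableAt
        exact (((h1.mul h2).mul_const _).const_mul _).const_mul _
      · simp only [hGout _ z hz]
        exact differentiable_const _
    · by_cases hzV : z ∈ V
      · rw [hGin s z hzV, hG₀zero s z hzV hz]
      · exact hGout s z hzV
  obtain ⟨Z, hZ, hZs⟩ := hfam.exists_continuation M.k
  refine ⟨Z, hZ, fun s hs => ?_⟩
  obtain ⟨hint, hval⟩ := hZs s hs
  set L := localDensity (twistedForm A μ β s) c with hL
  have hsub : Ψ '' V ⊆ h.target := hΨimage ▸ inter_subset_left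
  have hLzero : ∀ y ∈ h.target \ Ψ '' V, L y = 0 := by
    intro y hy
    have hyU : h.symm y ∉ U := fun hyU => hy.2 (hΨimage ▸ ⟨hy.1, hyU⟩)
    have : coeff h (twistedForm A μ β s) y = 0 := by
      refine coeff_eq_zero ?_
      exact twistedForm_eq_zero A μ s (hβK _ fun hx => hyU (hKU hx))
    rw [hL, localDensity, this, mul_zero]
  have hpull : ∀ z ∈ V, |(fderiv ℝ Ψ z).det| • L (Ψ z)
      = weight M.k (fun _ => 0) s z * G s z := by
    intro z hz
    have h1 : L (Ψ z) = (ρ (e.symm z) : ℂ) * ((A s (e.symm z)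
        * ∏ i, (μ i (e.symm z) : ℂ) ^ (s i / 2)) * coeff h β (Ψ z)) := by
      rw [hL, localDensity, ← hh, hΨsymm z hz]
      congr 1
      rw [coeff_twistedForm, hΨsymm z hz]
    rw [h1, M.prod_cpow s hz.2.2, e.right_inv (hVe hz), hGin s z hz, hG₀,
      Complex.real_smul]
    ring
  have hwzero : ∀ z ∉ V, weight M.k (fun _ => 0) s z * G s z = 0 := fun z hz => by
    rw [hGout s z hz, mul_zero]
  have hfd : ∀ z ∈ V, HasFDerivWithinAt Ψ (fderiv ℝ Ψ z) V z := fun z hz =>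
    (hΨd z hz).hasFDerivWithinAt
  have hVm := hV.measurableSet
  constructor
  · refine IntegrableOn.of_forall_sdiff_eq_zero ?_ h.open_target.measurableSet hLzero
    rw [integrableOn_image_iff_integrableOn_abs_det_fderiv_smul volume hVm hfd hΨinj]
    exact hint.integrableOn.congr_fun (fun z hz => (hpull z hz).symm) hVm
  · rw [hval, setIntegral_eq_of_subset_of_forall_sdiff_eq_zero h.open_target.measurableSet hsub
      hLzero, integral_image_eq_integral_abs_det_fderiv_smul volume hVm hfd hΨinj,
      setIntegral_congr_fun hVm hpull, setIntegral_eq_integral_of_forall_compl_eq_zero hwzero]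

end

/-! ### Continuation of integrals over the manifold -/

section

variable {d m : ℕ} {X : Type*} [TopologicalSpace X] [ChartedSpace (Fin d → ℂ) X]

lemma coeff_mulForm (e : OpenPartialHomeomorph X (Fin d → ℂ)) (φ : X → ℝ) (β : TopForm d X)
    (y : Fin d → ℂ) : coeff e (mulForm φ β) y = (φ (e.symm y) : ℂ) * coeff e β y :=
  Complex.real_smul

lemma mulForm_eq_zero (φ : X → ℝ) {β : TopForm d X} {x : X} (h : β x = 0) :
    mulForm φ β x = 0 := by
  ext v
  have : mulForm φ β x v = φ x • β x v := rfl
  rw [this, h]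
  exact smul_zero _

lemma mulForm_eq_zero_of_eq_zero {φ : X → ℝ} (β : TopForm d X) {x : X} (h : φ x = 0) :
    mulForm φ β x = 0 := by
  ext v
  have : mulForm φ β x v = φ x • β x v := rfl
  rw [this, h, zero_smul]
  rfl

lemma IsSmoothFamily.comp_add {A : (Fin m → ℂ) → X → ℂ} (hA : IsSmoothFamily d A)
    (c : Fin m → ℂ) : IsSmoothFamily d fun s => A (s + c) := by
  refine ⟨fun x => (hA.hol x).comp (differentiable_id.add_const c), fun e he => ?_⟩
  have h : ContDiff ℝ ∞ fun p : (Fin m → ℂ) × (Fin d → ℂ) => (p.1 + c, p.2) := by fun_prop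
  exact (hA.smooth e he).comp h.contDiffOn fun p hp => ⟨mem_univ _, hp.2⟩

lemma isSmoothFamily_one : IsSmoothFamily d (m := m) (X := X) fun _ _ => 1 :=
  ⟨fun _ => differentiable_const _, fun _ _ => contDiffOn_const⟩

lemma twistedForm_one (μ : Fin m → X → ℝ) (α : TopForm d X) :
    twistedForm (fun _ _ => 1) μ α = weightedForm μ α := by
  funext s x
  rw [twistedForm, one_mul]
  rfl

variable [IsManifold 𝓘(ℂ, Fin d → ℂ) ω X]

lemma SmoothForm.mulForm {β : TopForm d X} (hβ : SmoothForm β) {φ : X → ℝ}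
    (hφ : ContMDiff 𝓘(ℝ, Fin d → ℂ) 𝓘(ℝ, ℝ) ∞ φ) : SmoothForm (mulForm φ β) := by
  intro e he
  have h1 : ContDiffOn ℝ ∞ (fun y => φ (e.symm y)) e.target := by
    refine ContMDiffOn.contDiffOn ?_
    exact hφ.comp_contMDiffOn
      (contMDiffOn_symm_of_mem_maximalAtlas (IsManifold.subset_maximalAtlas he))
  have h2 : ContDiffOn ℝ ∞ (fun y => (φ (e.symm y) : ℂ)) e.target :=
    Complex.ofRealCLM.contDiff.comp_contDiffOn h1
  exact (h2.mul (hβ e he)).congr fun y _ => coeff_mulForm e φ β y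

variable [T2Space X] [SigmaCompactSpace X]

/-- Only finitely many charts contribute to the integrals of the forms supported in `K`. -/
lemma exists_finset_localDensity_eq_zero {K : Set X} (hK : IsCompact K) :
    ∃ C : Finset X, ∀ α : TopForm d X, (∀ x ∉ K, α x = 0) →
      ∀ c ∉ C, ∀ y, localDensity α c y = 0 := by
  have hfin := (chartPartition d X).locallyFinite.finite_nonempty_inter_compact hK
  refine ⟨hfin.toFinset, fun α hα c hc y => ?_⟩
  set x := (chartAt (Fin d → ℂ) c).symm y with hx
  by_cases hxK : x ∈ K
  · have : chartPartition d X c x = 0 := by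
      by_contra h
      exact hc (hfin.mem_toFinset.2 ⟨x, h, hxK⟩)
    rw [localDensity, ← hx, this, Complex.ofReal_zero, zero_mul]
  · rw [localDensity, coeff_eq_zero (hα x hxK), mul_zero]

lemma formIntegral_eq_sum {C : Finset X} {α : TopForm d X}
    (h : ∀ c ∉ C, ∀ y, localDensity α c y = 0) :
    formIntegral α = ∑ c ∈ C, ∫ y in (chartAt (Fin d → ℂ) c).target, localDensity α c y := by
  refine finsum_eq_sum_of_support_subset _ fun c hc => ?_
  by_contra hcC
  exact hc (by simp only [h c hcC, integral_zero])

/-- For `Re s_i` large, the forms `η s` have support in a fixed compact set and they are integrable,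
and `Z` is a meromorphic continuation of their integrals. -/
def ContinuesIntegral (η : (Fin m → ℂ) → TopForm d X) (Z : (Fin m → ℂ) → ℂ) : Prop :=
  HasSimplePoles Z ∧ ∃ (R : ℝ) (K : Set X), IsCompact K ∧ ∀ s : Fin m → ℂ, (∀ i, R < (s i).re) →
    (∀ x ∉ K, η s x = 0) ∧ FormIntegrable (η s) ∧ Z s = formIntegral (η s)

lemma ContinuesIntegral.add {η η' : (Fin m → ℂ) → TopForm d X} {Z Z' : (Fin m → ℂ) → ℂ}
    (h : ContinuesIntegral η Z) (h' : ContinuesIntegral η' Z') :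
    ContinuesIntegral (fun s x => η s x + η' s x) fun s => Z s + Z' s := by
  obtain ⟨hZ, R, K, hK, H⟩ := h
  obtain ⟨hZ', R', K', hK', H'⟩ := h'
  refine ⟨hZ.add hZ', max R R', K ∪ K', hK.union hK', fun s hs => ?_⟩
  obtain ⟨h0, hint, hval⟩ := H s fun i => (le_max_left _ _).trans_lt (hs i)
  obtain ⟨h0', hint', hval'⟩ := H' s fun i => (le_max_right _ _).trans_lt (hs i)
  have hadd : ∀ c y, localDensity (fun x => η s x + η' s x) c y
      = localDensity (η s) c y + localDensity (η' s) c y := fun c y => mul_add _ _ _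
  have hz : ∀ x ∉ K ∪ K', η s x = 0 := fun x hx => h0 x fun hxK => hx (Or.inl hxK)
  have hz' : ∀ x ∉ K ∪ K', η' s x = 0 := fun x hx => h0' x fun hxK => hx (Or.inr hxK)
  have hzadd : ∀ x ∉ K ∪ K', η s x + η' s x = 0 := fun x hx => by
    ext v
    have : (η s x + η' s x) v = η s x v + η' s x v := rfl
    rw [this, hz x hx, hz' x hx]
    exact add_zero _
  refine ⟨hzadd, fun c => ?_, ?_⟩
  · exact ((hint c).add (hint' c)).congr_fun_ae (Eventually.of_forall fun y => (hadd c y).symm)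
  · obtain ⟨C, hC⟩ := exists_finset_localDensity_eq_zero (d := d) (hK.union hK')
    beta_reduce
    rw [hval, hval', formIntegral_eq_sum (hC _ hz), formIntegral_eq_sum (hC _ hz'),
      formIntegral_eq_sum (hC _ hzadd), ← Finset.sum_add_distrib]
    refine Finset.sum_congr rfl fun c _ => ?_
    simp only [hadd]
    exact (integral_add (hint c) (hint' c)).symm

lemma ContinuesIntegral.smul {η : (Fin m → ℂ) → TopForm d X} {Z : (Fin m → ℂ) → ℂ}
    (h : ContinuesIntegral η Z) {P : (Fin m → ℂ) → ℂ} (hP : ∀ a, AnalyticAt ℂ P a) :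
    ContinuesIntegral (fun s x => P s • η s x) fun s => P s * Z s := by
  obtain ⟨hZ, R, K, hK, H⟩ := h
  refine ⟨hZ.analytic_mul hP, R, K, hK, fun s hs => ?_⟩
  obtain ⟨h0, hint, hval⟩ := H s hs
  have hmul : ∀ c y, localDensity (fun x => P s • η s x) c y = P s * localDensity (η s) c y :=
    fun c y => mul_left_comm _ _ _
  refine ⟨fun x hx => ?_, fun c => ?_, ?_⟩
  · ext v
    have : (P s • η s x) v = P s * η s x v := rfl
    rw [this, h0 x hx]
    exact mul_zero _
  · exact ((hint c).const_mul (P s)).congr (Eventually.of_forall fun y => (hmul c y).symm)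
  · beta_reduce
    rw [hval, formIntegral, formIntegral, ← smul_eq_mul, smul_finsum]
    refine finsum_congr fun c => ?_
    simp only [hmul, integral_const_mul, smul_eq_mul]

lemma ContinuesIntegral.congr {η η' : (Fin m → ℂ) → TopForm d X} {Z : (Fin m → ℂ) → ℂ}
    (h : ContinuesIntegral η Z) {r : ℝ}
    (heq : ∀ s : Fin m → ℂ, (∀ i, r < (s i).re) → η s = η' s) : ContinuesIntegral η' Z := by
  obtain ⟨hZ, R, K, hK, H⟩ := h
  refine ⟨hZ, max R r, K, hK, fun s hs => ?_⟩
  rw [← heq s fun i => (le_max_right _ _).trans_lt (hs i)]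
  exact H s fun i => (le_max_left _ _).trans_lt (hs i)

/-- The case of smooth forms of compact support: a partition of unity reduces it to forms supported
in normal crossing coordinates. -/
theorem continuesIntegral_of_smooth {D : Fin m → Set X} (hD : IsNormalCrossing d D)
    {μ : Fin m → X → ℝ} (hμ : ∀ i, IsCanonical d (D i) (μ i)) {A : (Fin m → ℂ) → X → ℂ}
    (hA : IsSmoothFamily d A) {β : TopForm d X} (hβ : SmoothForm β) {K : Set X} (hK : IsCompact K)
    (hβK : ∀ x ∉ K, β x = 0) : ∃ Z, ContinuesIntegral (twistedForm A μ β) Z := by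
  choose U hpU hmodel using exists_localModel hD hμ
  obtain ⟨σ, hσ⟩ := SmoothPartitionOfUnity.exists_isSubordinate 𝓘(ℝ, Fin d → ℂ)
    (isClosed_univ (X := X)) U (fun p => (hmodel p).some.isOpen)
    fun p _ => mem_iUnion.2 ⟨p, hpU p⟩
  have hfin := σ.locallyFinite.finite_nonempty_inter_compact hK
  set P := hfin.toFinset with hP
  have hsum : ∀ x ∈ K, ∑ p ∈ P, σ p x = 1 := by
    intro x hx
    rw [← σ.sum_eq_one (mem_univ x)]
    refine (finsum_eq_sum_of_support_subset _ fun p hp => ?_).symm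
    exact hfin.mem_toFinset.2 ⟨x, hp, hx⟩
  -- in each of the charts used to define the integral
  have hloc : ∀ c : X, ∃ Z, HasSimplePoles Z ∧ ∀ s : Fin m → ℂ, (∀ i, 2 < (s i).re) →
      IntegrableOn (localDensity (twistedForm A μ β s) c) (chartAt (Fin d → ℂ) c).target ∧
        Z s = ∫ y in (chartAt (Fin d → ℂ) c).target, localDensity (twistedForm A μ β s) c y := by
    intro c
    have hp : ∀ p : X, ∃ Z, HasSimplePoles Z ∧ ∀ s : Fin m → ℂ, (∀ i, 2 < (s i).re) →
        IntegrableOn (localDensity (twistedForm A μ (mulForm (σ p) β) s) c)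
            (chartAt (Fin d → ℂ) c).target ∧
          Z s = ∫ y in (chartAt (Fin d → ℂ) c).target,
            localDensity (twistedForm A μ (mulForm (σ p) β) s) c y := by
      intro p
      refine (hmodel p).some.exists_continuation hA (hβ.mulForm (σ p).contMDiff)
        (hK.inter_right (isClosed_tsupport (σ p))) (fun x hx => hσ p hx.2) (fun x hx => ?_) c
      by_cases hxK : x ∈ K
      · exact mulForm_eq_zero_of_eq_zero β
          (image_eq_zero_of_notMem_tsupport fun h => hx ⟨hxK, h⟩)
      · exact mulForm_eq_zero _ (hβK x hxK)
    choose Z hZ H using hp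
    have hdens : ∀ s y, localDensity (twistedForm A μ β s) c y
        = ∑ p ∈ P, localDensity (twistedForm A μ (mulForm (σ p) β) s) c y := by
      intro s y
      simp only [localDensity, coeff_twistedForm, coeff_mulForm]
      rw [← Finset.mul_sum, ← Finset.mul_sum, ← Finset.sum_mul]
      by_cases hx : (chartAt (Fin d → ℂ) c).symm y ∈ K
      · rw [← Complex.ofReal_sum, hsum _ hx, Complex.ofReal_one, one_mul]
      · simp only [coeff_eq_zero (hβK _ hx), mul_zero]
    refine ⟨fun s => ∑ p ∈ P, Z p s, HasSimplePoles.sum fun p _ => hZ p, fun s hs => ?_⟩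
    simp only [hdens]
    refine ⟨?_, ?_⟩
    · have := integrable_finsetSum P fun p _ => (H p s hs).1
      exact this.congr (Eventually.of_forall fun y => (hdens s y).symm)
    · rw [integral_finsetSum P fun p _ => (H p s hs).1]
      exact Finset.sum_congr rfl fun p _ => (H p s hs).2
  choose Z hZ H using hloc
  obtain ⟨C, hC⟩ := exists_finset_localDensity_eq_zero (d := d) hK
  refine ⟨fun s => ∑ c ∈ C, Z c s, HasSimplePoles.sum fun c _ => hZ c, 2, K, hK, fun s hs => ?_⟩
  have h0 : ∀ x ∉ K, twistedForm A μ β s x = 0 := fun x hx =>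
    twistedForm_eq_zero A μ s (hβK x hx)
  refine ⟨h0, fun c => (H c s hs).1, ?_⟩
  rw [formIntegral_eq_sum (hC _ h0)]
  exact Finset.sum_congr rfl fun c _ => (H c s hs).2

/-- A pole of order `N` of `α` is removed by the shift of `s` by `2 N`. -/
theorem exists_continuesIntegral {D : Fin m → Set X} (hD : IsNormalCrossing d D)
    {μ : Fin m → X → ℝ} (hμ : ∀ i, IsCanonical d (D i) (μ i)) {A : (Fin m → ℂ) → X → ℂ}
    (hA : IsSmoothFamily d A) {α : TopForm d X} (hα : HasPolesAlong D μ α) :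
    ∃ Z, ContinuesIntegral (twistedForm A μ α) Z := by
  obtain ⟨N, β, hβ, ⟨K, hK, hβK⟩, hαβ⟩ := hα
  obtain ⟨Z, hZ, R, K', hK', H⟩ :=
    continuesIntegral_of_smooth hD hμ (hA.comp_add fun _ => 2 * (N : ℂ)) hβ hK hβK
  have key : ∀ s : Fin m → ℂ, (∀ i, 2 * (N : ℝ) < (s i).re) → twistedForm A μ α s
      = twistedForm (fun s => A (s + fun _ => 2 * (N : ℂ))) μ β fun i => s i - 2 * N := by
    intro s hs
    have hsub : (fun i => s i - 2 * (N : ℂ)) + (fun _ => 2 * (N : ℂ)) = s := by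
      ext i
      simp
    funext x
    ext v
    simp only [twistedForm_apply, hsub]
    by_cases hx : x ∈ ⋃ i, D i
    -- on the divisor both forms vanish, as `0 ^ c = 0` for `c ≠ 0`, whatever the value of `α`
    · obtain ⟨i, hi⟩ := mem_iUnion.1 hx
      have hμ0 : (μ i x : ℂ) = 0 := by exact_mod_cast ((hμ i).zero_iff x).2 hi
      have hs0 : 0 < (s i - 2 * N).re := by
        have := hs i
        simp
        linarith
      have hs1 : s i / 2 ≠ 0 := fun h => by
        have h3 : s i = 0 := by simpa using h
        have := hs i
        rw [h3, Complex.zero_re] at this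
        have : (0 : ℝ) ≤ N := N.cast_nonneg
        linarith
      have hs2 : (s i - 2 * N) / 2 ≠ 0 := fun h => by
        have h3 : s i - 2 * N = 0 := by simpa using h
        rw [h3, Complex.zero_re] at hs0
        exact hs0.false
      rw [Finset.prod_eq_zero (Finset.mem_univ i) (by rw [hμ0, Complex.zero_cpow hs1]),
        Finset.prod_eq_zero (Finset.mem_univ i) (by rw [hμ0, Complex.zero_cpow hs2])]
      simp
    · have h3 : β x v = ((∏ i, μ i x) ^ N : ℝ) * α x v := by
        rw [← hαβ x hx]
        exact Complex.real_smul
      rw [h3]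
      have h4 : ∀ i, (μ i x : ℂ) ^ (s i / 2)
          = (μ i x : ℂ) ^ ((s i - 2 * N) / 2) * (μ i x : ℂ) ^ N := fun i => by
        have hne : (μ i x : ℂ) ≠ 0 := by
          exact_mod_cast ((hμ i).pos fun h => hx (mem_iUnion.2 ⟨i, h⟩)).ne'
        rw [← Complex.cpow_natCast, ← Complex.cpow_add _ _ hne]
        congr 1
        ring
      simp only [h4, Finset.prod_mul_distrib]
      push_cast
      rw [Finset.prod_pow]
      ring
  have hZ' : ContinuesIntegral (fun s => twistedForm (fun s => A (s + fun _ => 2 * (N : ℂ))) μ β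
      fun i => s i - 2 * N) fun s => Z fun i => s i - 2 * N := by
    refine ⟨hZ.comp_sub_even N, R + 2 * N, K', hK', fun s hs => H _ fun i => ?_⟩
    have := hs i
    simp
    linarith
  exact ⟨_, hZ'.congr fun s hs => (key s hs).symm⟩

lemma IsZetaContinuation.eqOn {μ : Fin m → X → ℝ} {α : TopForm d X} {Z Z' : (Fin m → ℂ) → ℂ}
    (h : IsZetaContinuation μ α Z) (h' : IsZetaContinuation μ α Z') :
    EqOn Z Z' (regularSet m) := by
  obtain ⟨R, H⟩ := h.eq_integral
  obtain ⟨R', H'⟩ := h'.eq_integral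
  refine h.meromorphic.eqOn_of_eq h'.meromorphic (R := max R R') fun s hs => ?_
  rw [(H s fun i => (le_max_left _ _).trans_lt (hs i)).2,
    (H' s fun i => (le_max_right _ _).trans_lt (hs i)).2]

lemma ContinuesIntegral.isZetaContinuation {μ : Fin m → X → ℝ} {α : TopForm d X}
    {Z : (Fin m → ℂ) → ℂ} (h : ContinuesIntegral (weightedForm μ α) Z) :
    IsZetaContinuation μ α Z :=
  let ⟨hZ, R, _, _, H⟩ := h
  ⟨⟨R, fun s hs => (H s hs).2⟩, hZ⟩

lemma exists_continuesIntegral_weightedForm {D : Fin m → Set X} (hD : IsNormalCrossing d D)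
    {μ : Fin m → X → ℝ} (hμ : ∀ i, IsCanonical d (D i) (μ i)) {α : TopForm d X}
    (hα : HasPolesAlong D μ α) : ∃ Z, ContinuesIntegral (weightedForm μ α) Z := by
  rw [← twistedForm_one]
  exact exists_continuesIntegral hD hμ isSmoothFamily_one hα

theorem isZetaContinuation_zeta {D : Fin m → Set X} (hD : IsNormalCrossing d D)
    {μ : Fin m → X → ℝ} (hμ : ∀ i, IsCanonical d (D i) (μ i)) {α : TopForm d X}
    (hα : HasPolesAlong D μ α) : IsZetaContinuation μ α (zeta μ α) :=
  let ⟨_, hZ⟩ := exists_continuesIntegral_weightedForm hD hμ hα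
  Classical.epsilon_spec ⟨_, hZ.isZetaContinuation⟩

lemma continuesIntegral_zeta {D : Fin m → Set X} (hD : IsNormalCrossing d D)
    {μ : Fin m → X → ℝ} (hμ : ∀ i, IsCanonical d (D i) (μ i)) {α : TopForm d X}
    (hα : HasPolesAlong D μ α) : ContinuesIntegral (weightedForm μ α) (zeta μ α) := by
  obtain ⟨Z, -, R, K, hK, H⟩ := exists_continuesIntegral_weightedForm hD hμ hα
  obtain ⟨⟨R', H'⟩, hζ⟩ := isZetaContinuation_zeta hD hμ hα
  exact ⟨hζ, max R R', K, hK, fun s hs =>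
    ⟨(H s fun i => (le_max_left _ _).trans_lt (hs i)).1,
      H' s fun i => (le_max_right _ _).trans_lt (hs i)⟩⟩

end

/-! ### Conformal changes of the Morse--Bott functions -/

/-- Taylor's formula of second order for the exponential function, with an entire remainder. -/
lemma exists_exp_eq : ∃ E : ℂ → ℂ, Differentiable ℂ E ∧
    ∀ w : ℂ, Complex.exp w = 1 + w + w ^ 2 * E w := by
  have hd : ∀ f : ℂ → ℂ, Differentiable ℂ f → Differentiable ℂ (dslope f 0) := fun f hf =>
    differentiableOn_univ.1 ((Complex.differentiableOn_dslope univ_mem).2 hf.differentiableOn)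
  refine ⟨dslope (dslope Complex.exp 0) 0, hd _ (hd _ Complex.differentiable_exp), fun w => ?_⟩
  have h1 := sub_smul_dslope Complex.exp 0 w
  have h2 := sub_smul_dslope (dslope Complex.exp 0) 0 w
  have h3 : dslope Complex.exp 0 0 = 1 := by simp [dslope_same]
  simp only [sub_zero, smul_eq_mul, h3, Complex.exp_zero] at h1 h2
  linear_combination -h1 - w * h2

lemma prod_eq_mul_prod {ι R : Type*} [Fintype ι] [CommMonoid R] {F G : ι → R} {j : ι} {a : R}
    (hj : F j = a * G j) (h : ∀ i, i ≠ j → F i = G i) : ∏ i, F i = a * ∏ i, G i := by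
  classical
  rw [← Finset.mul_prod_erase _ F (Finset.mem_univ j), ← Finset.mul_prod_erase _ G
    (Finset.mem_univ j), hj, mul_assoc]
  congr 2
  exact Finset.prod_congr rfl fun i hi => h i (Finset.ne_of_mem_erase hi)

/-- The conformal change of `μ_j` by the factor `e ^ (2 φ)`. -/
def rescale {m : ℕ} {X : Type*} (μ : Fin m → X → ℝ) (j : Fin m) (φ : X → ℝ) : Fin m → X → ℝ :=
  Function.update μ j fun x => Real.exp (2 * φ x) * μ j x

lemma rescale_self {m : ℕ} {X : Type*} (μ : Fin m → X → ℝ) (j : Fin m) (φ : X → ℝ) (x : X) :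
    rescale μ j φ j x = Real.exp (2 * φ x) * μ j x := by
  rw [rescale, Function.update_self]

lemma rescale_of_ne {m : ℕ} {X : Type*} (μ : Fin m → X → ℝ) {i j : Fin m} (h : i ≠ j) (φ : X → ℝ) :
    rescale μ j φ i = μ i :=
  Function.update_of_ne h _ _

/-- The conformal change of `μ_j` multiplies `∏ μ_i ^ (s_i / 2)` by `e ^ (s_j φ)`. -/
lemma cpow_rescale {m : ℕ} {X : Type*} {μ : Fin m → X → ℝ} (j : Fin m) (φ : X → ℝ)
    {x : X} (h : 0 ≤ μ j x) (s : Fin m → ℂ) : ∏ i, (rescale μ j φ i x : ℂ) ^ (s i / 2)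
      = Complex.exp (s j * φ x) * ∏ i, (μ i x : ℂ) ^ (s i / 2) := by
  refine prod_eq_mul_prod ?_ fun i hi => by rw [rescale_of_ne μ hi]
  rw [rescale_self, Complex.ofReal_mul, Complex.mul_cpow_ofReal_nonneg (Real.exp_pos _).le h,
    Complex.cpow_def_of_ne_zero (by exact_mod_cast (Real.exp_pos _).ne'),
    ← Complex.ofReal_log (Real.exp_pos _).le, Real.log_exp]
  congr 2
  push_cast
  ring

section

variable {d m : ℕ} {X : Type*} [TopologicalSpace X] [ChartedSpace (Fin d → ℂ) X]

lemma mulForm_mulForm (φ ψ : X → ℝ) (α : TopForm d X) :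
    mulForm φ (mulForm ψ α) = mulForm (fun x => φ x * ψ x) α := by
  funext x
  exact (mul_smul _ _ _).symm

lemma mulForm_one (α : TopForm d X) : mulForm (fun _ => 1) α = α := by
  funext x
  exact one_smul _ _

lemma IsCanonical.rescale {D : Fin m → Set X} {μ : Fin m → X → ℝ}
    (hμ : ∀ i, IsCanonical d (D i) (μ i)) (j : Fin m) {φ : X → ℝ}
    (hφ : ContMDiff 𝓘(ℝ, Fin d → ℂ) 𝓘(ℝ, ℝ) ∞ φ) (i : Fin m) :
    IsCanonical d (D i) (rescale μ j φ i) := by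
  by_cases h : i = j
  · subst h
    rw [NormalCrossing.rescale, Function.update_self]
    exact (hμ i).exp_mul hφ
  · rw [rescale_of_ne μ h]
    exact hμ i

/-- The factor in the remainder term of the expansion of `e ^ (s_j φ)`. -/
lemma isSmoothFamily_comp {E : ℂ → ℂ} (hE : Differentiable ℂ E) (j : Fin m) {φ : X → ℝ}
    (hφ : ContMDiff 𝓘(ℝ, Fin d → ℂ) 𝓘(ℝ, ℝ) ∞ φ) :
    IsSmoothFamily d fun (s : Fin m → ℂ) x => (φ x : ℂ) ^ 2 * E (s j * φ x) := by
  refine ⟨fun x => ?_, fun e he => ?_⟩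
  · exact (hE.comp ((differentiable_apply j).mul_const _)).const_mul _
  · have h1 : ContDiffOn ℝ ∞ (fun y => φ (e.symm y)) e.target :=
      (hφ.comp_contMDiffOn (contMDiffOn_symm_of_mem_maximalAtlas he)).contDiffOn
    have h2 : ContDiffOn ℝ ∞ (fun p : (Fin m → ℂ) × (Fin d → ℂ) => (φ (e.symm p.2) : ℂ))
        (univ ×ˢ e.target) :=
      (Complex.ofRealCLM.contDiff.comp_contDiffOn h1).comp contDiff_snd.contDiffOn
        fun p hp => hp.2
    have h3 : ContDiff ℝ ∞ fun p : (Fin m → ℂ) × (Fin d → ℂ) => p.1 j :=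
      (contDiff_apply ℝ ℂ j).comp contDiff_fst
    have h4 : ContDiff ℝ ∞ E := (hE.contDiff (n := ∞)).restrict_scalars ℝ
    exact (h2.pow 2).mul (h4.comp_contDiffOn (h3.contDiffOn.mul h2))

variable [IsManifold 𝓘(ℂ, Fin d → ℂ) ω X]

lemma HasPolesAlong.mulForm {D : Fin m → Set X} {μ : Fin m → X → ℝ} {α : TopForm d X}
    (hα : HasPolesAlong D μ α) {φ : X → ℝ} (hφ : ContMDiff 𝓘(ℝ, Fin d → ℂ) 𝓘(ℝ, ℝ) ∞ φ) :
    HasPolesAlong D μ (mulForm φ α) := by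
  obtain ⟨N, β, hβ, ⟨K, hK, hβK⟩, h⟩ := hα
  refine ⟨N, NormalCrossing.mulForm φ β, hβ.mulForm hφ, ⟨K, hK, fun x hx =>
    mulForm_eq_zero φ (hβK x hx)⟩, fun x hx => ?_⟩
  have : NormalCrossing.mulForm φ β x = φ x • β x := rfl
  rw [this, ← h x hx]
  exact smul_comm _ _ _

lemma HasPolesAlong.rescale {D : Fin m → Set X} {μ : Fin m → X → ℝ} {α : TopForm d X}
    (hα : HasPolesAlong D μ α) (j : Fin m) {φ : X → ℝ}
    (hφ : ContMDiff 𝓘(ℝ, Fin d → ℂ) 𝓘(ℝ, ℝ) ∞ φ) : HasPolesAlong D (rescale μ j φ) α := by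
  obtain ⟨N, β, hβ, ⟨K, hK, hβK⟩, h⟩ := hα
  have hexp : ContMDiff 𝓘(ℝ, Fin d → ℂ) 𝓘(ℝ, ℝ) ∞ fun x => Real.exp (2 * φ x) ^ N := by
    have : ContDiff ℝ ∞ fun t : ℝ => Real.exp (2 * t) ^ N := by fun_prop
    exact this.contMDiff.comp hφ
  refine ⟨N, NormalCrossing.mulForm _ β, hβ.mulForm hexp, ⟨K, hK, fun x hx =>
    mulForm_eq_zero _ (hβK x hx)⟩, fun x hx => ?_⟩
  have h1 : NormalCrossing.mulForm (fun x => Real.exp (2 * φ x) ^ N) β x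
    = Real.exp (2 * φ x) ^ N • β x := rfl
  have h2 : ∏ i, NormalCrossing.rescale μ j φ i x = Real.exp (2 * φ x) * ∏ i, μ i x :=
    prod_eq_mul_prod (rescale_self μ j φ x) fun i hi => by rw [rescale_of_ne μ hi]
  rw [h1, ← h x hx, h2, mul_pow]
  exact mul_smul _ _ _

variable [T2Space X] [SigmaCompactSpace X]

/-- Any two functions in the canonical conformal class differ by a global conformal factor: locally
the quotient extends smoothly, and being such an extension is a convex condition. -/
lemma exists_eq_exp_mul {D : Fin m → Set X} (hD : IsNormalCrossing d D) {j : Fin m}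
    {μ μ' : X → ℝ} (hμ : IsCanonical d (D j) μ) (hμ' : IsCanonical d (D j) μ') :
    ∃ φ : X → ℝ, ContMDiff 𝓘(ℝ, Fin d → ℂ) 𝓘(ℝ, ℝ) ∞ φ ∧
      μ' = fun x => Real.exp (2 * φ x) * μ x := by
  have hconv : ∀ x, Convex ℝ {r : ℝ | 0 < r ∧ μ' x = r * μ x} := by
    intro x
    refine (convex_Ioi (0 : ℝ)).inter fun a ha b hb p q _ _ hpq => ?_
    have ha' : μ' x = a * μ x := ha
    have hb' : μ' x = b * μ x := hb
    have : μ' x = (p * a + q * b) * μ x := by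
      linear_combination p * ha' + q * hb' - (μ' x) * hpq
    exact this
  obtain ⟨R, hR⟩ := exists_contMDiffMap_forall_mem_convex_of_local 𝓘(ℝ, Fin d → ℂ) (n := ⊤)
    hconv fun p => by
      by_cases hp : p ∈ D j
      · obtain ⟨e, he, hpe, k, hk⟩ := hD.2 p
        have heq := isLocalEquation_coord he e.open_source subset_rfl (k ⟨j, hp⟩) (hk ⟨j, hp⟩)
        obtain ⟨g, hg, hgx⟩ := hμ.canonical _ _ e.open_source heq
        obtain ⟨g', hg', hgx'⟩ := hμ'.canonical _ _ e.open_source heq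
        refine ⟨e.source, e.open_source.mem_nhds hpe, fun x => g' x / g x,
          hg'.div₀ hg fun x hx => (hgx x hx).1.ne', fun x hx => ?_⟩
        have h1 := (hgx x hx).1
        refine ⟨div_pos (hgx' x hx).1 h1, ?_⟩
        rw [(hgx x hx).2, (hgx' x hx).2]
        field_simp
      · have hopen := (hD.1 j).isOpen_compl
        refine ⟨(D j)ᶜ, hopen.mem_nhds hp, fun x => μ' x / μ x,
          hμ'.smooth.contMDiffOn.div₀ hμ.smooth.contMDiffOn fun x hx => (hμ.pos hx).ne',
          fun x hx => ?_⟩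
        have h1 := hμ.pos hx
        exact ⟨div_pos (hμ'.pos hx) h1, by field_simp⟩
  refine ⟨fun x => Real.log (R x) / 2, ?_, ?_⟩
  · intro x
    have h1 : ContDiffAt ℝ ∞ (fun t : ℝ => Real.log t / 2) (R x) :=
      (Real.contDiffAt_log.2 (hR x).1.ne').div_const 2
    exact h1.contMDiffAt.comp x R.contMDiff.contMDiffAt
  · funext x
    rw [mul_div_cancel₀ _ two_ne_zero, Real.exp_log (hR x).1]
    exact (hR x).2

/-- The expansion of `e ^ (s_j φ)` to second order gives the dependence of the zeta function on
`μ_j`. -/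
theorem exists_zeta_rescale {D : Fin m → Set X} (hD : IsNormalCrossing d D)
    {μ : Fin m → X → ℝ} (hμ : ∀ i, IsCanonical d (D i) (μ i)) {α : TopForm d X}
    (hα : HasPolesAlong D μ α) (j : Fin m) {φ : X → ℝ}
    (hφ : ContMDiff 𝓘(ℝ, Fin d → ℂ) 𝓘(ℝ, ℝ) ∞ φ) :
    ∃ Z, HasSimplePoles Z ∧ ∀ s ∈ regularSet m, zeta (rescale μ j φ) α s
      = zeta μ α s + s j * (zeta μ (mulForm φ α) s + s j * Z s) := by
  obtain ⟨E, hE, hexp⟩ := exists_exp_eq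
  obtain ⟨Z, hZ⟩ := exists_continuesIntegral hD hμ (isSmoothFamily_comp hE j hφ) hα
  refine ⟨Z, hZ.1, ?_⟩
  have h1 := continuesIntegral_zeta hD hμ hα
  have h2 := continuesIntegral_zeta hD hμ (hα.mulForm hφ)
  have h3 := h1.add ((h2.add (hZ.smul (analyticAt_coord j))).smul (analyticAt_coord j))
  refine (isZetaContinuation_zeta hD (IsCanonical.rescale hμ j hφ) (hα.rescale j hφ)).eqOn
    (ContinuesIntegral.isZetaContinuation (h3.congr (r := 0) fun s _ => ?_))
  funext x
  ext v
  set w := ∏ i, (μ i x : ℂ) ^ (s i / 2) with hw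
  have e1 : (weightedForm μ α s x + s j • (weightedForm μ (mulForm φ α) s x
      + s j • twistedForm (fun s x => (φ x : ℂ) ^ 2 * E (s j * φ x)) μ α s x)) v
    = w * α x v + s j * (w * (φ x • α x v)
      + s j * ((φ x : ℂ) ^ 2 * E (s j * φ x) * w * α x v)) := rfl
  have e2 : weightedForm (rescale μ j φ) α s x v
    = (∏ i, (rescale μ j φ i x : ℂ) ^ (s i / 2)) * α x v := rfl
  rw [e2, cpow_rescale j φ ((hμ j).nonneg x), hexp]
  refine Eq.trans e1 ?_
  rw [Complex.real_smul]
  ring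

theorem residueCoeff_rescale_of_notMem {D : Fin m → Set X} (hD : IsNormalCrossing d D)
    {μ : Fin m → X → ℝ} (hμ : ∀ i, IsCanonical d (D i) (μ i)) {α : TopForm d X}
    (hα : HasPolesAlong D μ α) {M : Finset (Fin m)} {j : Fin m} (hj : j ∉ M) {φ : X → ℝ}
    (hφ : ContMDiff 𝓘(ℝ, Fin d → ℂ) 𝓘(ℝ, ℝ) ∞ φ) :
    residueCoeff M (rescale μ j φ) α = residueCoeff M μ α := by
  obtain ⟨Z, hZ, hζ⟩ := exists_zeta_rescale hD hμ hα j hφ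
  have h1 := (isZetaContinuation_zeta hD hμ hα).meromorphic
  have h2 := (isZetaContinuation_zeta hD hμ (hα.mulForm hφ)).meromorphic
  have h3 := h2.add (hZ.analytic_mul (analyticAt_coord j))
  rw [residueCoeff, iteratedResidue_congr_regularSet fun s hs => congrArg _ (hζ s hs),
    iteratedResidue_simplePoles_add h1 (h3.analytic_mul (analyticAt_coord j)),
    iteratedResidue_coord_mul h3 hj, add_zero, residueCoeff]

theorem residueCoeff_rescale_of_mem {D : Fin m → Set X} (hD : IsNormalCrossing d D)
    {μ : Fin m → X → ℝ} (hμ : ∀ i, IsCanonical d (D i) (μ i)) {α : TopForm d X}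
    (hα : HasPolesAlong D μ α) {M : Finset (Fin m)} {j : Fin m} (hj : j ∈ M) {φ : X → ℝ}
    (hφ : ContMDiff 𝓘(ℝ, Fin d → ℂ) 𝓘(ℝ, ℝ) ∞ φ) :
    residueCoeff M (rescale μ j φ) α
      = residueCoeff M μ α + residueCoeff (M.erase j) μ (mulForm φ α) := by
  obtain ⟨Z, hZ, hζ⟩ := exists_zeta_rescale hD hμ hα j hφ
  have h1 := (isZetaContinuation_zeta hD hμ hα).meromorphic
  have h2 := (isZetaContinuation_zeta hD hμ (hα.mulForm hφ)).meromorphic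
  have h3 := h2.add (hZ.analytic_mul (analyticAt_coord j))
  rw [residueCoeff, iteratedResidue_congr_regularSet fun s hs => congrArg _ (hζ s hs),
    iteratedResidue_simplePoles_add h1 (h3.analytic_mul (analyticAt_coord j)),
    iteratedResidue_coord_mul_of_mem _ hj,
    iteratedResidue_simplePoles_add h2 (hZ.analytic_mul (analyticAt_coord j)),
    iteratedResidue_coord_mul hZ (Finset.notMem_erase j M), add_zero, residueCoeff, residueCoeff]

/-- The functions `μ_j`, `j ∉ M`, are exchanged one at a time. -/
theorem residueCoeff_eq_of_eqOn {D : Fin m → Set X} (hD : IsNormalCrossing d D)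
    {μ μ' : Fin m → X → ℝ} (hμ : ∀ i, IsCanonical d (D i) (μ i))
    (hμ' : ∀ i, IsCanonical d (D i) (μ' i)) {α : TopForm d X} (hα : HasPolesAlong D μ α)
    {M : Finset (Fin m)} (hM : ∀ i ∈ M, μ' i = μ i) :
    residueCoeff M μ' α = residueCoeff M μ α := by
  have key : ∀ T : Finset (Fin m), Disjoint T M → HasPolesAlong D (T.piecewise μ' μ) α ∧
      residueCoeff M (T.piecewise μ' μ) α = residueCoeff M μ α := by
    intro T
    induction T using Finset.induction_on with
    | empty => simpa using hα
    | insert j T hj ih =>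
      intro hT
      rw [Finset.disjoint_insert_left] at hT
      obtain ⟨ih1, ih2⟩ := ih hT.2
      have hν : ∀ i, IsCanonical d (D i) (T.piecewise μ' μ i) := fun i => by
        by_cases hi : i ∈ T
        · rw [Finset.piecewise_eq_of_mem _ _ _ hi]
          exact hμ' i
        · rw [Finset.piecewise_eq_of_notMem _ _ _ hi]
          exact hμ i
      obtain ⟨φ, hφ, hφμ⟩ := exists_eq_exp_mul hD (hμ j) (hμ' j)
      have : (insert j T).piecewise μ' μ = rescale (T.piecewise μ' μ) j φ := by
        rw [Finset.piecewise_insert, rescale, Finset.piecewise_eq_of_notMem _ _ _ hj, ← hφμ]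
      rw [this]
      exact ⟨ih1.rescale j hφ, (residueCoeff_rescale_of_notMem hD hν ih1 hT.1 hφ).trans ih2⟩
  have hcompl : Mᶜ.piecewise μ' μ = μ' := by
    funext i
    by_cases hi : i ∈ M
    · rw [Finset.piecewise_eq_of_notMem _ _ _ (by simpa using hi), hM i hi]
    · exact Finset.piecewise_eq_of_mem _ _ _ (Finset.mem_compl.2 hi)
  rw [← (key Mᶜ disjoint_compl_left).2, hcompl]

/-- The change of `I_M` when the `μ_i` with `i ∈ S ⊆ M` are rescaled. The induction on `S` uses the
formula for `I_M(α)` and for `I_{M ∖ j}(φ_j α)`. -/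
theorem residueCoeff_piecewise {D : Fin m → Set X} (hD : IsNormalCrossing d D)
    {μ : Fin m → X → ℝ} (hμ : ∀ i, IsCanonical d (D i) (μ i)) {φ : Fin m → X → ℝ}
    (hφ : ∀ i, ContMDiff 𝓘(ℝ, Fin d → ℂ) 𝓘(ℝ, ℝ) ∞ (φ i)) (S : Finset (Fin m)) :
    ∀ {α : TopForm d X}, HasPolesAlong D μ α → ∀ {M : Finset (Fin m)}, S ⊆ M →
      HasPolesAlong D (S.piecewise (fun i x => Real.exp (2 * φ i x) * μ i x) μ) α ∧
      residueCoeff M (S.piecewise (fun i x => Real.exp (2 * φ i x) * μ i x) μ) α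
        = ∑ T ∈ S.powerset, residueCoeff (M \ T) μ (mulForm (fun x => ∏ i ∈ T, φ i x) α) := by
  induction S using Finset.induction_on with
  | empty =>
    intro α hα M _
    simpa [mulForm_one] using hα
  | insert j S hj ih =>
    intro α hα M hS
    rw [Finset.insert_subset_iff] at hS
    set ν := S.piecewise (fun i x => Real.exp (2 * φ i x) * μ i x) μ with hν
    have hcan : ∀ i, IsCanonical d (D i) (ν i) := fun i => by
      by_cases hi : i ∈ S
      · rw [hν, Finset.piecewise_eq_of_mem _ _ _ hi]
        exact (hμ i).exp_mul (hφ i)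
      · rw [hν, Finset.piecewise_eq_of_notMem _ _ _ hi]
        exact hμ i
    have hins : (insert j S).piecewise (fun i x => Real.exp (2 * φ i x) * μ i x) μ
        = rescale ν j (φ j) := by
      rw [Finset.piecewise_insert, rescale, hν, Finset.piecewise_eq_of_notMem _ _ _ hj]
    obtain ⟨h1, h2⟩ := ih hα hS.2
    have hSe : S ⊆ M.erase j := Finset.subset_erase.2 ⟨hS.2, hj⟩
    obtain ⟨-, h4⟩ := ih (hα.mulForm (hφ j)) hSe
    rw [hins]
    refine ⟨h1.rescale j (hφ j), ?_⟩
    rw [residueCoeff_rescale_of_mem hD hcan h1 hS.1 (hφ j), h2, h4,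
      Finset.sum_powerset_insert hj]
    congr 1
    refine Finset.sum_congr rfl fun T hT => ?_
    have hjT : j ∉ T := fun h => hj (Finset.mem_powerset.1 hT h)
    rw [mulForm_mulForm, Finset.sdiff_insert, Finset.erase_sdiff_comm]
    congr 2
    funext x
    rw [Finset.prod_insert hjT, mul_comm]

end

end NormalCrossing

end

open NormalCrossing in
theorem mainTheorem9 {d m : ℕ} {X : Type*} [TopologicalSpace X] [ChartedSpace (Fin d → ℂ) X]
    [IsManifold 𝓘(ℂ, Fin d → ℂ) ω X] [T2Space X] [SigmaCompactSpace X]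
    (D : Fin m → Set X) (hD : NormalCrossing.IsNormalCrossing d D)
    (μ : Fin m → X → ℝ) (hμ : ∀ i, NormalCrossing.IsCanonicalMorseBott d (D i) (μ i))
    (α : NormalCrossing.TopForm d X) (hα : NormalCrossing.HasPolesAlong D μ α) :
    -- the meromorphic continuation of the zeta function exists and is unique
    (NormalCrossing.IsZetaContinuation μ α (NormalCrossing.zeta μ α) ∧
      ∀ Z, NormalCrossing.IsZetaContinuation μ α Z →
        Set.EqOn Z (NormalCrossing.zeta μ α) (NormalCrossing.regularSet m)) ∧
    -- `I_M` is independent of `μ_j` for `j ∉ M`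
    (∀ (M : Finset (Fin m)) (μ' : Fin m → X → ℝ),
      (∀ i, NormalCrossing.IsCanonicalMorseBott d (D i) (μ' i)) → (∀ i ∈ M, μ' i = μ i) →
        NormalCrossing.residueCoeff M μ' α = NormalCrossing.residueCoeff M μ α) ∧
    -- the dependence of `I_M` on `μ_i` for `i ∈ M`
    (∀ (M : Finset (Fin m)), ∀ i ∈ M, ∀ φ : X → ℝ,
      ContMDiff 𝓘(ℝ, Fin d → ℂ) 𝓘(ℝ, ℝ) ∞ φ →
        NormalCrossing.residueCoeff M
            (Function.update μ i fun x => Real.exp (2 * φ x) * μ i x) α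
          = NormalCrossing.residueCoeff M μ α
            + NormalCrossing.residueCoeff (M.erase i) μ (NormalCrossing.mulForm φ α)) ∧
    -- the change of the finite part
    (∀ φ : Fin m → X → ℝ, (∀ i, ContMDiff 𝓘(ℝ, Fin d → ℂ) 𝓘(ℝ, ℝ) ∞ (φ i)) →
      NormalCrossing.finitePart (fun i x => Real.exp (2 * φ i x) * μ i x) α
          = ∑ M : Finset (Fin m), NormalCrossing.residueCoeff M μ
              (NormalCrossing.mulForm (fun x => ∏ i ∈ Mᶜ, φ i x) α) ∧
      NormalCrossing.finitePart (fun i x => Real.exp (2 * φ i x) * μ i x) α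
          = NormalCrossing.finitePart μ α
            + ∑ M ∈ (Finset.univ : Finset (Finset (Fin m))).erase Finset.univ,
                NormalCrossing.residueCoeff M μ
                  (NormalCrossing.mulForm (fun x => ∏ i ∈ Mᶜ, φ i x) α)) := by
  have hμ' := fun i => (hμ i).isCanonical
  have hζ := isZetaContinuation_zeta hD hμ' hα
  have hsum : ∀ φ : Fin m → X → ℝ, (∀ i, ContMDiff 𝓘(ℝ, Fin d → ℂ) 𝓘(ℝ, ℝ) ∞ (φ i)) →
      finitePart (fun i x => Real.exp (2 * φ i x) * μ i x) α
        = ∑ M : Finset (Fin m), residueCoeff M μ (mulForm (fun x => ∏ i ∈ Mᶜ, φ i x) α) := by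
    intro φ hφ
    have h := (residueCoeff_piecewise hD hμ' hφ Finset.univ hα subset_rfl).2
    rw [Finset.piecewise_univ, Finset.powerset_univ] at h
    rw [finitePart, h]
    refine Fintype.sum_bijective compl compl_bijective _ _ fun T => ?_
    rw [compl_compl, Finset.compl_eq_univ_sdiff]
  refine ⟨⟨hζ, fun Z hZ => hZ.eqOn hζ⟩, fun M ν hν hM => ?_, fun M i hi φ hφ => ?_,
    fun φ hφ => ⟨hsum φ hφ, ?_⟩⟩
  · exact residueCoeff_eq_of_eqOn hD hμ' (fun i => (hν i).isCanonical) hα hM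
  · exact residueCoeff_rescale_of_mem hD hμ' hα hi hφ
  · rw [hsum φ hφ, ← Finset.add_sum_erase _ _ (Finset.mem_univ Finset.univ), Finset.compl_univ]
    simp only [Finset.prod_empty, mulForm_one]
    rfl
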